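/- Let $M$ be an $n$-dimensional complex manifold with local holomorphic coordinates $(z^k)$ and induced coordinates $(z^k,\eta^k)$ on the holomorphic tangent bundle $T'M$. Let $h=h_{i\bar j}(z)\,dz^i\otimes d\bar z^j$ be a smooth Hermitian metric on $M$, $f=\|u\|_h:M\to\mathbb R$ a smooth function, and $W=W^i\,\partial/\partial z^i$ a smooth section of $T'M$ with $0<\|W\|_h<f\le 1$ everywhere. Put $$\tilde\varepsilon=f^2-\|W\|_h^2,\quad W_i=h_{i\bar j}\bar W^j,\quad a_{i\bar j}=\frac{h_{i\bar j}}{\tilde\varepsilon}+\frac{W_i\bar W_j}{\tilde\varepsilon^2},\quad b_i=\frac{W_i}{\tilde\varepsilon},\quad \beta=b_i\eta^i,\quad \alpha=\sqrt{a_{i\bar j}\eta^i\bar\eta^j}.$$ The complex Randers solution of the generalized Zermelo navigation problem (constant angle $\varphi$ with $\cos\varphi=-1$) is $$F(z,\eta)=\frac{\sqrt{|h(\eta,\bar W)|^2+\tilde\varepsilon\|\eta\|_h^2}+|h(\eta,\bar W)|}{\tilde\varepsilon}=\alpha+|\beta|.$$ To a complex Finsler function $\Phi$ (applied to $F$, to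 $\sqrt{h_{i\bar j}\eta^i\bar\eta^j}$ and to $\alpha$) associate $$g_{i\bar j}=\frac{\partial^2\Phi^2}{\partial\eta^i\partial\bar\eta^j},\quad N^i_j=g^{\bar m i}\frac{\partial g_{l\bar m}}{\partial z^j}\eta^l,\quad G^i=\tfrac12N^i_j\eta^j,\quad L^i_{jk}=\frac{\partial N^i_k}{\partial\eta^j},\quad \theta^{*k}=g^{\bar mk}g_{q\bar p}\,(L^{\bar p}_{\bar j\bar m}-L^{\bar p}_{\bar m\bar j})\,\eta^q\bar\eta^j .$$ $\Phi$ is generalized Berwald if $\partial G^i/\partial\bar\eta^k=0$ at all $\eta\ne0$ around which $\Phi$ is smooth (for $F$ with $n\ge2$ this is the set $\beta\ne0$). Two such functions $\Phi,\tilde\Phi$ are projectively related if $\tilde G^i=G^i+\frac12(\tilde\theta^{*i}-\theta^{*i})+P\eta^i$ for $\eta\neq 0$, with a smooth complex-valued function $P$ on $T'M$. Further put $$\Gamma_{l\bar r\bar m}=\frac{\partial a_{l\bar m}}{\partial\bar z^r}-\frac{\partial a_{l\bar r}}{\partial\bar z^m},\qquad \Omega_{\bar m}=\overset{a}{N}{}^{\bar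 s}_{\bar m}\,b_{\bar s}-\frac{\partial b_{\bar r}}{\partial\bar z^m}\bar\eta^r-\frac{\bar\beta^2}{|\beta|^2}\frac{\partial b_l}{\partial\bar z^m}\eta^l\quad(\beta\ne0),$$ where $b_{\bar s}=\overline{b_s}$ and $\overset{a}{N}$ is the connection $N$ of $\alpha$. **Theorem 4.5.** Suppose that $F$ is generalized Berwald. Then $h$ and $a$ are projectively related if and only if $\overset{h}{\theta}{}^{*i}=\overset{a}{\theta}{}^{*i}$ for all $i$. Moreover, if $n\ge2$, each of these two conditions implies, in all holomorphic coordinates and at every point, $\Gamma_{l\bar s\bar m}\bar W^m=0$ for all $l,s$; $\Omega_{\bar m}\bar W^m=\frac1{2\tilde\varepsilon}\frac{\partial\tilde\varepsilon}{\partial\bar z^m}\bar\eta^m$ for all $\eta$ with $\beta\ne0$; and $\frac{\partial\tilde\varepsilon}{\partial\bar z^m}\bar W^m=0$. -/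

import Mathlib

open scoped ContDiff Manifold ComplexConjugate

noncomputable section

namespace Zermelo

/-! ### Wirtinger derivatives on `ℂⁿ` -/

/-- The Wirtinger derivative `∂u/∂zⁱ` of `u : ℂⁿ → ℂ`. -/
def wirt {n : ℕ} (i : Fin n) (u : (Fin n → ℂ) → ℂ) (z : Fin n → ℂ) : ℂ :=
  (1 / 2 : ℂ) * (fderiv ℝ u z (Pi.single i 1) - Complex.I * fderiv ℝ u z (Pi.single i Complex.I))

/-- The Wirtinger derivative `∂u/∂z̄ⁱ` of `u : ℂⁿ → ℂ`. -/
def wirtBar {n : ℕ} (i : Fin n) (u : (Fin n → ℂ) → ℂ) (z : Fin n → ℂ) : ℂ :=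
  (1 / 2 : ℂ) * (fderiv ℝ u z (Pi.single i 1) + Complex.I * fderiv ℝ u z (Pi.single i Complex.I))

/-! ### Local geometry of a complex Finsler function

`Φ z η` is the expression of a complex Finsler function in local coordinates `(zᵏ, ηᵏ)` of the
holomorphic tangent bundle. -/

section Local

variable {n : ℕ}

/-- The fundamental tensor `g_{i j̄} = ∂²(Φ²)/∂ηⁱ∂η̄ʲ`; rows carry the index `i`, columns `j̄`. -/
def fundTensor (Φ : (Fin n → ℂ) → (Fin n → ℂ) → ℝ) (z η : Fin n → ℂ) :
    Matrix (Fin n) (Fin n) ℂ :=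
  Matrix.of fun i j => wirt i (fun ξ => wirtBar j (fun ζ => ((Φ z ζ ^ 2 : ℝ) : ℂ)) ξ) η

/-- The coefficients `N^i_j = g^{m̄ i} (∂g_{l m̄}/∂zʲ) ηˡ` of the Chern-Finsler connection. -/
def nonlinConn (Φ : (Fin n → ℂ) → (Fin n → ℂ) → ℝ) (z η : Fin n → ℂ) (i j : Fin n) : ℂ :=
  ∑ m, ∑ l, (fundTensor Φ z η)⁻¹ m i * wirt j (fun w => fundTensor Φ w η l m) z * η l

/-- The spray coefficients `Gⁱ = ½ N^i_j ηʲ`. -/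
def spray (Φ : (Fin n → ℂ) → (Fin n → ℂ) → ℝ) (z η : Fin n → ℂ) (i : Fin n) : ℂ :=
  (1 / 2 : ℂ) * ∑ j, nonlinConn Φ z η i j * η j

/-- The coefficients `L^i_{jk} = ∂N^i_k/∂ηʲ`. -/
def horizCoeff (Φ : (Fin n → ℂ) → (Fin n → ℂ) → ℝ) (z η : Fin n → ℂ) (i j k : Fin n) : ℂ :=
  wirt j (fun ξ => nonlinConn Φ z ξ i k) η

/-- The functions `θ*ᵏ = g^{m̄ k} g_{q p̄} (L^{p̄}_{j̄ m̄} - L^{p̄}_{m̄ j̄}) η^q η̄ʲ`, the right-hand side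
of the geodesic equations `γ̈ᵏ + 2 Gᵏ(γ, γ̇) = θ*ᵏ(γ, γ̇)`. -/
def thetaStar (Φ : (Fin n → ℂ) → (Fin n → ℂ) → ℝ) (z η : Fin n → ℂ) (k : Fin n) : ℂ :=
  ∑ m, ∑ q, ∑ p, ∑ j, (fundTensor Φ z η)⁻¹ m k * fundTensor Φ z η q p *
    conj (horizCoeff Φ z η p j m - horizCoeff Φ z η p m j) * η q * conj (η j)

end Local

/-! ### Objects on a complex manifold -/

section Manifold

variable {n : ℕ} {M : Type*} [TopologicalSpace M] [ChartedSpace (Fin n → ℂ) M]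

/-- The holomorphic tangent space `T'ₓM` of a complex manifold modelled on `ℂⁿ`. -/
abbrev HolTangent (n : ℕ) {M : Type*} [TopologicalSpace M] [ChartedSpace (Fin n → ℂ) M]
    (x : M) : Type :=
  TangentSpace 𝓘(ℂ, Fin n → ℂ) x

/-- The holomorphic local coordinate systems of `M`. -/
def charts (n : ℕ) (M : Type*) [TopologicalSpace M] [ChartedSpace (Fin n → ℂ) M] :
    Set (OpenPartialHomeomorph M (Fin n → ℂ)) :=
  IsManifold.maximalAtlas 𝓘(ℂ, Fin n → ℂ) ω M

/-- The tangent vector `ηⁱ ∂/∂zⁱ` at the point with coordinates `z` in the chart `φ`. -/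
def tangentOf (φ : OpenPartialHomeomorph M (Fin n → ℂ)) (z η : Fin n → ℂ) :
    HolTangent n (φ.symm z) :=
  mfderiv 𝓘(ℂ, Fin n → ℂ) 𝓘(ℂ, Fin n → ℂ) φ.symm z η

/-- The coordinate vector field `∂/∂zⁱ` of the chart `φ`. -/
def coordVec (φ : OpenPartialHomeomorph M (Fin n → ℂ)) (z : Fin n → ℂ) (i : Fin n) :
    HolTangent n (φ.symm z) :=
  tangentOf φ z (Pi.single i 1)

/-- The components `Wⁱ(z)` of a `(1,0)` vector field `W` in the chart `φ`. -/
def vecComp (W : ∀ x : M, HolTangent n x) (φ : OpenPartialHomeomorph M (Fin n → ℂ))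
    (z : Fin n → ℂ) : Fin n → ℂ :=
  mfderiv 𝓘(ℂ, Fin n → ℂ) 𝓘(ℂ, Fin n → ℂ) φ (φ.symm z) (W (φ.symm z))

/-- The components `h_{i j̄}(z)` of a field of sesquilinear forms in the chart `φ`. -/
def formComp (h : ∀ x : M, HolTangent n x → HolTangent n x → ℂ)
    (φ : OpenPartialHomeomorph M (Fin n → ℂ)) (z : Fin n → ℂ) (i j : Fin n) : ℂ :=
  h (φ.symm z) (coordVec φ z i) (coordVec φ z j)

/-- `h x v w` stands for `h(v, w̄)`: a smooth (in the real sense) positive definite Hermitian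
metric on the holomorphic tangent bundle, linear in `v` and conjugate-linear in `w`. -/
structure IsHermitianMetric (h : ∀ x : M, HolTangent n x → HolTangent n x → ℂ) : Prop where
  add_left : ∀ x v v' w, h x (v + v') w = h x v w + h x v' w
  smul_left : ∀ x (c : ℂ) v w, h x (c • v) w = c * h x v w
  conj_symm : ∀ x v w, conj (h x v w) = h x w v
  pos : ∀ x v, v ≠ 0 → 0 < (h x v v).re
  smooth : ∀ φ ∈ charts n M, ∀ i j, ContDiffOn ℝ ∞ (fun z => formComp h φ z i j) φ.target

/-- The norm `‖v‖_h = √(h(v, v̄))`, that is, the complex Finsler function of a Hermitian metric. -/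
def hnorm (h : ∀ x : M, HolTangent n x → HolTangent n x → ℂ) (x : M) (v : HolTangent n x) : ℝ :=
  Real.sqrt (h x v v).re

/-- The local expression of a function on the holomorphic tangent bundle in the chart `φ`. -/
def inChart (F : ∀ x : M, HolTangent n x → ℝ) (φ : OpenPartialHomeomorph M (Fin n → ℂ))
    (z η : Fin n → ℂ) : ℝ :=
  F (φ.symm z) (tangentOf φ z η)

/-- Generalized Berwald: `∂Gⁱ/∂η̄ᵏ = 0`, i.e. the spray coefficients are holomorphic in `η`,
at all nonzero vectors around which the metric is smooth. (A complex Randers metric `α + |β|` is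
smooth exactly off the hyperplanes `β = 0`.) -/
def IsGeneralizedBerwald (F : ∀ x : M, HolTangent n x → ℝ) : Prop :=
  ∀ φ ∈ charts n M, ∀ z ∈ φ.target, ∀ η : Fin n → ℂ, η ≠ 0 →
    ContDiffAt ℝ ∞ (fun p : (Fin n → ℂ) × (Fin n → ℂ) => inChart F φ p.1 p.2) (z, η) →
    ∀ i k, wirtBar k (fun ξ => spray (inChart F φ) z ξ i) η = 0

/-- Projectively related: the spray coefficients are connected by a projective change
`G̃ⁱ = Gⁱ + Bⁱ + P ηⁱ`, `Bⁱ = ½ (θ̃*ⁱ - θ*ⁱ)`, where `P` is a smooth complex-valued function on the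
holomorphic tangent bundle. -/
def ProjectivelyRelated (F F' : ∀ x : M, HolTangent n x → ℝ) : Prop :=
  ∃ P : ∀ x : M, HolTangent n x → ℂ,
    (∀ φ ∈ charts n M, ContDiffOn ℝ ∞
      (fun p : (Fin n → ℂ) × (Fin n → ℂ) => P (φ.symm p.1) (tangentOf φ p.1 p.2))
      (φ.target ×ˢ Set.univ)) ∧
    ∀ φ ∈ charts n M, ∀ z ∈ φ.target, ∀ η : Fin n → ℂ, η ≠ 0 → ∀ i,
      spray (inChart F' φ) z η i = spray (inChart F φ) z η i
        + (1 / 2 : ℂ) * (thetaStar (inChart F' φ) z η i - thetaStar (inChart F φ) z η i)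
        + P (φ.symm z) (tangentOf φ z η) * η i

/-- Equality `θ*ⁱ = θ̃*ⁱ` of the functions attached to two complex Finsler functions. -/
def SameThetaStar (F F' : ∀ x : M, HolTangent n x → ℝ) : Prop :=
  ∀ φ ∈ charts n M, ∀ z ∈ φ.target, ∀ η : Fin n → ℂ, η ≠ 0 → ∀ i,
    thetaStar (inChart F φ) z η i = thetaStar (inChart F' φ) z η i

/-! ### Generalized navigation data and their solution -/

/-- Generalized navigation data `(h, ‖u‖_h = f, W)` with nowhere vanishing mild wind:
`0 < ‖W‖_h < f ≤ 1`. -/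
structure IsNavigationData (h : ∀ x : M, HolTangent n x → HolTangent n x → ℂ)
    (f : M → ℝ) (W : ∀ x : M, HolTangent n x) : Prop where
  metric : IsHermitianMetric h
  smooth_speed : ∀ φ ∈ charts n M, ContDiffOn ℝ ∞ (fun z => f (φ.symm z)) φ.target
  smooth_wind : ∀ φ ∈ charts n M, ContDiffOn ℝ ∞ (vecComp W φ) φ.target
  wind_pos : ∀ x, 0 < hnorm h x (W x)
  wind_lt : ∀ x, hnorm h x (W x) < f x
  speed_le : ∀ x, f x ≤ 1

/-- `ε̃ = ‖u‖²_h - ‖W‖²_h`. -/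
def epsT (h : ∀ x : M, HolTangent n x → HolTangent n x → ℂ) (f : M → ℝ)
    (W : ∀ x : M, HolTangent n x) (x : M) : ℝ :=
  f x ^ 2 - hnorm h x (W x) ^ 2

/-- The new Hermitian metric `a_{i j̄} = h_{i j̄}/ε̃ + (W_i/ε̃)(W̄_j/ε̃)`, where `W_i = h_{i j̄} W̄ʲ`. -/
def newMetric (h : ∀ x : M, HolTangent n x → HolTangent n x → ℂ) (f : M → ℝ)
    (W : ∀ x : M, HolTangent n x) (x : M) (v w : HolTangent n x) : ℂ :=
  h x v w / epsT h f W x +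
    (h x v (W x) / epsT h f W x) * (conj (h x w (W x)) / epsT h f W x)

/-- The `(1,0)`-form `b_i = W_i/ε̃`, `β = b_i ηⁱ`. -/
def newForm (h : ∀ x : M, HolTangent n x → HolTangent n x → ℂ) (f : M → ℝ)
    (W : ∀ x : M, HolTangent n x) (x : M) (v : HolTangent n x) : ℂ :=
  h x v (W x) / epsT h f W x

/-- The complex Randers solution of the generalized navigation problem, i.e. the solution for the
constant angle `φ = arg h(v, W̄) = π`, `cos φ = -1`:
`F = √(|h(η,W̄)|² cos² φ + ‖η‖²_h ε̃)/ε̃ - |h(η,W̄)| cos φ/ε̃`. -/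
def randersSolution (h : ∀ x : M, HolTangent n x → HolTangent n x → ℂ) (f : M → ℝ)
    (W : ∀ x : M, HolTangent n x) (x : M) (v : HolTangent n x) : ℝ :=
  Real.sqrt (‖h x v (W x)‖ ^ 2 + hnorm h x v ^ 2 * epsT h f W x) / epsT h f W x
    + ‖h x v (W x)‖ / epsT h f W x

/-- The solution has the complex Randers form `F = α + |β|`. -/
theorem randersSolution_eq {h : ∀ x : M, HolTangent n x → HolTangent n x → ℂ} {f : M → ℝ}
    {W : ∀ x : M, HolTangent n x} (hd : IsNavigationData h f W) (x : M) (v : HolTangent n x) :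
    randersSolution h f W x v = hnorm (newMetric h f W) x v + ‖newForm h f W x v‖ := by
  have h0 := hd.wind_pos x
  have h1 := hd.wind_lt x
  have he : 0 < epsT h f W x := by unfold epsT; nlinarith
  have hv : 0 ≤ (h x v v).re := by
    by_cases hv : v = 0
    · have := hd.metric.smul_left x 0 v v
      rw [zero_smul, zero_mul] at this
      subst hv
      rw [this]; simp
    · exact (hd.metric.pos x v hv).le
  have hre : (newMetric h f W x v v).re
      = (‖h x v (W x)‖ ^ 2 + hnorm h x v ^ 2 * epsT h f W x) / epsT h f W x ^ 2 := by
    unfold newMetric hnorm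
    rw [Real.sq_sqrt hv, div_mul_div_comm, Complex.mul_conj, Complex.normSq_eq_norm_sq,
      Complex.add_re, ← Complex.ofReal_mul, Complex.div_ofReal_re, Complex.div_ofReal_re,
      Complex.ofReal_re]
    field_simp
    ring
  unfold randersSolution newForm
  rw [show hnorm (newMetric h f W) x v = Real.sqrt (newMetric h f W x v v).re from rfl, hre,
    Real.sqrt_div' _ (by positivity), Real.sqrt_sq he.le, norm_div,
    Complex.norm_real, Real.norm_of_nonneg he.le]

/-- `Γ_{l r̄ m̄} = ∂a_{l m̄}/∂z̄ʳ - ∂a_{l r̄}/∂z̄ᵐ` in the chart `φ`. -/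
def Gam (a : ∀ x : M, HolTangent n x → HolTangent n x → ℂ)
    (φ : OpenPartialHomeomorph M (Fin n → ℂ)) (z : Fin n → ℂ) (l r m : Fin n) : ℂ :=
  wirtBar r (fun w => formComp a φ w l m) z - wirtBar m (fun w => formComp a φ w l r) z

/-- The components `b_i(z)` of a `(1,0)`-form in the chart `φ`. -/
def covComp (b : ∀ x : M, HolTangent n x → ℂ) (φ : OpenPartialHomeomorph M (Fin n → ℂ))
    (z : Fin n → ℂ) (i : Fin n) : ℂ :=
  b (φ.symm z) (coordVec φ z i)

/-- `Ω_m̄ = N^{s̄}_{m̄} b_{s̄} - (∂b_{r̄}/∂z̄ᵐ) η̄ʳ - (β̄²/|β|²) (∂b_l/∂z̄ᵐ) ηˡ` in the chart `φ`, where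
`N` is the Chern-Finsler connection of `a`, `b_{s̄}` is the conjugate of `b_s`, and `β = b_i ηⁱ`. -/
def Omg (a : ∀ x : M, HolTangent n x → HolTangent n x → ℂ) (b : ∀ x : M, HolTangent n x → ℂ)
    (φ : OpenPartialHomeomorph M (Fin n → ℂ)) (z η : Fin n → ℂ) (m : Fin n) : ℂ :=
  (∑ s, conj (nonlinConn (inChart (hnorm a) φ) z η s m) * conj (covComp b φ z s))
    - (∑ r, wirtBar m (fun w => conj (covComp b φ w r)) z * conj (η r))
    - (conj (∑ i, covComp b φ z i * η i) ^ 2 / (‖∑ i, covComp b φ z i * η i‖ : ℂ) ^ 2) *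
      ∑ l, wirtBar m (fun w => covComp b φ w l) z * η l

end Manifold

end Zermelo

end

/-! Write ∂_u for the (1,0)-derivative along u in the base. For a Hermitian metric m, lowering
indices gives m(2G(η), t̄) = ∂_η m(η, t̄), and m(θ*(η), s̄) is the conjugate of the torsion ∂_s m(η,
η̄) - ∂_η m(s, η̄). Only these inverse-free forms are used.

The Berwald condition. Pairing the spray equation of F = α + |β| with η̄ gives |β| p = -α q
(`LocalNav.spray_euler`), where p and q are conjugate-linear forms evaluated at η. After squaring, β
β̄ p² = α² q² is polynomial in η̄. Its coefficients are holomorphic in η because the spray is, so η̄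
can be varied independently of η (`LocalNav.spray_split`). For n ≥ 2 and generic η the linear forms
β̄ and a(η, ·) are independent, and unique factorization forces p = q = 0 (`eq_zero_of_mul_sq_eq`).
This is `BerwaldAt`. It makes b̄ recurrent, ∂_u b̄ = τ(u) b̄, and then a = h/ε̃ + b ⊗ b̄ yields 2G_a
= 2G_h + ε̃ ∂_η(1/ε̃) η (`LocalNav.spray_sub`). In dimension one a is conformal to h, with a spray
formula of the same shape.

The equivalence. The sprays of h and a thus always differ by a smooth multiple of η. If the θ*
agree, this multiple is the projective factor. Conversely, projective relatedness makes the two θ*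
differ by a multiple of η, and linear algebra on the deviation form `LocalNav.torsionDiff` shows
that this multiple vanishes (`LocalNav.torsionDiff_eq_zero`).

The consequences. If the deviation form vanishes, the torsion of a is that of h divided by ε̃, and
both are annihilated by W, which is the statement on Γ. Expanding a leaves a relation between
d(1/ε̃), db and τ (`LocalNav.wedge_eq_zero`). Evaluated on W and on the kernel of b, it gives the
statements on ε̃ and Ω. -/

noncomputable section

namespace Zermelo

variable {n : ℕ}

/-! ### Calculus of Wirtinger derivatives -/

/-- The real differential is the sum of its `(1,0)` and `(0,1)` parts. -/
theorem fderiv_eq_sum_wirt (u : (Fin n → ℂ) → ℂ) (z v : Fin n → ℂ) :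
    fderiv ℝ u z v = ∑ i, wirt i u z * v i + ∑ i, wirtBar i u z * conj (v i) := by
  have hv : v = ∑ i, ((v i).re • (Pi.single i 1 : Fin n → ℂ)
      + (v i).im • (Pi.single i Complex.I : Fin n → ℂ)) := by
    ext j
    simp [Finset.sum_apply, Pi.single_apply, Finset.sum_add_distrib]
  conv_lhs => rw [hv]
  rw [map_sum, ← Finset.sum_add_distrib]
  refine Finset.sum_congr rfl fun i _ => ?_
  rw [map_add, map_smul, map_smul]
  unfold wirt wirtBar
  conv_rhs => rw [← Complex.re_add_im (v i)]
  simp only [Complex.real_smul, map_add, map_mul, Complex.conj_ofReal, Complex.conj_I]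
  linear_combination ((v i).im * fderiv ℝ u z (Pi.single i Complex.I)) * Complex.I_sq

/-- `u` is real differentiable at `z` with `∂u/∂zⁱ = pᵢ` and `∂u/∂z̄ⁱ = qᵢ`. -/
structure HasWirt (u : (Fin n → ℂ) → ℂ) (p q : Fin n → ℂ) (z : Fin n → ℂ) : Prop where
  diff : DifferentiableAt ℝ u z
  wirt_eq : ∀ i, wirt i u z = p i
  bar_eq : ∀ i, wirtBar i u z = q i

theorem hasWirt_of_diff {u : (Fin n → ℂ) → ℂ} {z : Fin n → ℂ} (hu : DifferentiableAt ℝ u z) :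
    HasWirt u (fun i => wirt i u z) (fun i => wirtBar i u z) z :=
  ⟨hu, fun _ => rfl, fun _ => rfl⟩

theorem wirt_congr {u v : (Fin n → ℂ) → ℂ} {z : Fin n → ℂ} (h : u =ᶠ[nhds z] v) (i : Fin n) :
    wirt i u z = wirt i v z := by
  unfold wirt; rw [h.fderiv_eq]

theorem wirtBar_congr {u v : (Fin n → ℂ) → ℂ} {z : Fin n → ℂ} (h : u =ᶠ[nhds z] v) (i : Fin n) :
    wirtBar i u z = wirtBar i v z := by
  unfold wirtBar; rw [h.fderiv_eq]

namespace HasWirt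

variable {u v : (Fin n → ℂ) → ℂ} {p q p' q' z : Fin n → ℂ}

theorem congr (hu : HasWirt u p q z) (h : v =ᶠ[nhds z] u) : HasWirt v p q z :=
  ⟨hu.diff.congr_of_eventuallyEq h, fun i => (wirt_congr h i).trans (hu.wirt_eq i),
    fun i => (wirtBar_congr h i).trans (hu.bar_eq i)⟩

theorem congr_val (hu : HasWirt u p q z) (hp : ∀ i, p' i = p i) (hq : ∀ i, q' i = q i) :
    HasWirt u p' q' z :=
  ⟨hu.diff, fun i => (hu.wirt_eq i).trans (hp i).symm, fun i => (hu.bar_eq i).trans (hq i).symm⟩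

theorem const (c : ℂ) : HasWirt (fun _ => c) (fun _ => 0) (fun _ => 0) z :=
  ⟨differentiableAt_const c, fun i => by simp [wirt], fun i => by simp [wirtBar]⟩

theorem add (hu : HasWirt u p q z) (hv : HasWirt v p' q' z) :
    HasWirt (fun w => u w + v w) (fun i => p i + p' i) (fun i => q i + q' i) z := by
  refine ⟨hu.diff.add hv.diff, fun i => ?_, fun i => ?_⟩
  · rw [← hu.wirt_eq, ← hv.wirt_eq]
    unfold wirt
    rw [fderiv_fun_add hu.diff hv.diff]
    simp only [add_apply]; ring
  · rw [← hu.bar_eq, ← hv.bar_eq]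
    unfold wirtBar
    rw [fderiv_fun_add hu.diff hv.diff]
    simp only [add_apply]; ring

theorem mul (hu : HasWirt u p q z) (hv : HasWirt v p' q' z) :
    HasWirt (fun w => u w * v w) (fun i => p i * v z + u z * p' i)
      (fun i => q i * v z + u z * q' i) z := by
  refine ⟨hu.diff.mul hv.diff, fun i => ?_, fun i => ?_⟩
  · rw [← hu.wirt_eq, ← hv.wirt_eq]
    unfold wirt
    rw [fderiv_fun_mul hu.diff hv.diff]
    simp only [add_apply, smul_apply, smul_eq_mul]; ring
  · rw [← hu.bar_eq, ← hv.bar_eq]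
    unfold wirtBar
    rw [fderiv_fun_mul hu.diff hv.diff]
    simp only [add_apply, smul_apply, smul_eq_mul]; ring

theorem const_mul (c : ℂ) (hu : HasWirt u p q z) :
    HasWirt (fun w => c * u w) (fun i => c * p i) (fun i => c * q i) z :=
  ((const c).mul hu).congr_val (fun i => by ring) (fun i => by ring)

theorem mul_const (hu : HasWirt u p q z) (c : ℂ) :
    HasWirt (fun w => u w * c) (fun i => p i * c) (fun i => q i * c) z :=
  (hu.mul (const c)).congr_val (fun i => by ring) (fun i => by ring)

theorem sum {ι : Type*} (s : Finset ι) {f : ι → (Fin n → ℂ) → ℂ} {P Q : ι → Fin n → ℂ}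
    (h : ∀ k ∈ s, HasWirt (f k) (P k) (Q k) z) :
    HasWirt (fun w => ∑ k ∈ s, f k w) (fun i => ∑ k ∈ s, P k i) (fun i => ∑ k ∈ s, Q k i) z := by
  classical
  induction s using Finset.induction_on with
  | empty => simpa using (const (z := z) (0 : ℂ))
  | insert a s ha ih =>
    simp only [Finset.sum_insert ha]
    exact (h a (Finset.mem_insert_self a s)).add
      (ih fun k hk => h k (Finset.mem_insert_of_mem hk))

theorem conjugate (hu : HasWirt u p q z) :
    HasWirt (fun w => conj (u w)) (fun i => conj (q i)) (fun i => conj (p i)) z := by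
  have hc : HasFDerivAt (fun w => (starRingEnd ℂ) (u w))
      ((Complex.conjCLE : ℂ →L[ℝ] ℂ).comp (fderiv ℝ u z)) z :=
    (Complex.conjCLE : ℂ →L[ℝ] ℂ).hasFDerivAt.comp z hu.diff.hasFDerivAt
  refine ⟨hc.differentiableAt, fun i => ?_, fun i => ?_⟩
  · rw [← hu.bar_eq]
    unfold wirt wirtBar
    rw [hc.fderiv]
    simp only [ContinuousLinearMap.comp_apply, map_mul, map_add, map_div₀, map_one, map_ofNat,
      Complex.conj_I, ContinuousLinearEquiv.coe_coe, Complex.conjCLE_apply]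
    ring
  · rw [← hu.wirt_eq]
    unfold wirt wirtBar
    rw [hc.fderiv]
    simp only [ContinuousLinearMap.comp_apply, map_mul, map_sub, map_div₀, map_one, map_ofNat,
      Complex.conj_I, ContinuousLinearEquiv.coe_coe, Complex.conjCLE_apply]
    ring

theorem coord (k : Fin n) :
    HasWirt (fun w => w k) (fun i => if i = k then 1 else 0) (fun _ => 0) z := by
  have hc : HasFDerivAt (𝕜 := ℝ) (fun w : Fin n → ℂ => w k)
      (ContinuousLinearMap.proj k) z :=
    hasFDerivAt_apply k z
  refine ⟨hc.differentiableAt, fun i => ?_, fun i => ?_⟩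
  · unfold wirt
    rw [hc.fderiv]
    by_cases h : i = k
    · subst h; simp; norm_num
    · simp [h]
  · unfold wirtBar
    rw [hc.fderiv]
    by_cases h : i = k
    · subst h; simp
    · simp [h]

/-- Wirtinger derivatives of a square root. -/
theorem of_sq {s : (Fin n → ℂ) → ℂ} (hu : HasWirt u p q z) (hs : DifferentiableAt ℝ s z)
    (h : ∀ᶠ w in nhds z, u w = s w * s w) (h0 : s z ≠ 0) :
    HasWirt s (fun i => p i / (2 * s z)) (fun i => q i / (2 * s z)) z := by
  -- Since s is already known to be differentiable, the product rule for u = s · s can be solved for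
  -- the derivatives of s.
  have h1 := hasWirt_of_diff hs
  have h2 := (h1.mul h1).congr h
  refine ⟨hs, fun i => ?_, fun i => ?_⟩
  · have := (hu.wirt_eq i).symm.trans (h2.wirt_eq i)
    rw [eq_div_iff (by simpa using h0), this]; ring
  · have := (hu.bar_eq i).symm.trans (h2.bar_eq i)
    rw [eq_div_iff (by simpa using h0), this]; ring

theorem div (hu : HasWirt u p q z) (hv : HasWirt v p' q' z) (h0 : v z ≠ 0) :
    HasWirt (fun w => u w / v w) (fun i => (p i * v z - u z * p' i) / v z ^ 2)
      (fun i => (q i * v z - u z * q' i) / v z ^ 2) z := by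
  have hd : DifferentiableAt ℝ (fun w => u w / v w) z := by
    have := hu.diff; have := hv.diff
    simp only [div_eq_mul_inv]; fun_prop (disch := assumption)
  have h1 := hasWirt_of_diff hd
  have hev : ∀ᶠ w in nhds z, u w = (u w / v w) * v w := by
    filter_upwards [hv.diff.continuousAt.eventually_ne h0] with w hw
    rw [div_mul_cancel₀ _ hw]
  have h2 := (h1.mul hv).congr hev
  refine ⟨hd, fun i => ?_, fun i => ?_⟩
  · have := (hu.wirt_eq i).symm.trans (h2.wirt_eq i)
    rw [eq_div_iff (pow_ne_zero 2 h0), this]; field_simp; ring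
  · have := (hu.bar_eq i).symm.trans (h2.bar_eq i)
    rw [eq_div_iff (pow_ne_zero 2 h0), this]; field_simp; ring

end HasWirt

/-- A real differentiable function with vanishing `∂̄` is complex differentiable. -/
theorem differentiableAt_complex_of_wirtBar_eq_zero {u : (Fin n → ℂ) → ℂ} {z : Fin n → ℂ}
    (hu : DifferentiableAt ℝ u z) (h : ∀ i, wirtBar i u z = 0) : DifferentiableAt ℂ u z := by
  let L : (Fin n → ℂ) →L[ℂ] ℂ :=
    ∑ i, wirt i u z • ContinuousLinearMap.proj (R := ℂ) (φ := fun _ : Fin n => ℂ) i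
  refine (hasFDerivAt_of_restrictScalars ℝ (f' := L) hu.hasFDerivAt ?_).differentiableAt
  ext v
  rw [fderiv_eq_sum_wirt]
  simp [L, h]

/-- The `(1,0)`-differential `∂u(v) = (∂u/∂zⁱ) vⁱ`. -/
def dz (u : (Fin n → ℂ) → ℂ) (z v : Fin n → ℂ) : ℂ := ∑ i, wirt i u z * v i

theorem HasWirt.dz_eq {u : (Fin n → ℂ) → ℂ} {p q z : Fin n → ℂ} (h : HasWirt u p q z)
    (v : Fin n → ℂ) : dz u z v = ∑ i, p i * v i := by
  simp only [dz, h.wirt_eq]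

theorem dz_add_vec (u : (Fin n → ℂ) → ℂ) (z v v' : Fin n → ℂ) :
    dz u z (v + v') = dz u z v + dz u z v' := by
  simp [dz, mul_add, Finset.sum_add_distrib]

theorem dz_smul_vec (u : (Fin n → ℂ) → ℂ) (z : Fin n → ℂ) (c : ℂ) (v : Fin n → ℂ) :
    dz u z (c • v) = c * dz u z v := by
  simp only [dz, Pi.smul_apply, smul_eq_mul, Finset.mul_sum]
  exact Finset.sum_congr rfl fun i _ => by ring

theorem dz_congr {u v : (Fin n → ℂ) → ℂ} {z : Fin n → ℂ} (h : u =ᶠ[nhds z] v) (w : Fin n → ℂ) :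
    dz u z w = dz v z w := by
  simp only [dz, wirt_congr h]

theorem dz_add {u v : (Fin n → ℂ) → ℂ} {z : Fin n → ℂ} (hu : DifferentiableAt ℝ u z)
    (hv : DifferentiableAt ℝ v z) (w : Fin n → ℂ) :
    dz (fun x => u x + v x) z w = dz u z w + dz v z w := by
  rw [((hasWirt_of_diff hu).add (hasWirt_of_diff hv)).dz_eq]
  simp [dz, add_mul, Finset.sum_add_distrib]

theorem dz_mul {u v : (Fin n → ℂ) → ℂ} {z : Fin n → ℂ} (hu : DifferentiableAt ℝ u z)
    (hv : DifferentiableAt ℝ v z) (w : Fin n → ℂ) :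
    dz (fun x => u x * v x) z w = dz u z w * v z + u z * dz v z w := by
  rw [((hasWirt_of_diff hu).mul (hasWirt_of_diff hv)).dz_eq]
  simp only [dz, Finset.sum_mul, Finset.mul_sum, ← Finset.sum_add_distrib]
  exact Finset.sum_congr rfl fun i _ => by ring

theorem dz_mul_const {u : (Fin n → ℂ) → ℂ} {z : Fin n → ℂ} (hu : DifferentiableAt ℝ u z) (c : ℂ)
    (w : Fin n → ℂ) : dz (fun x => u x * c) z w = dz u z w * c := by
  rw [((hasWirt_of_diff hu).mul_const c).dz_eq]
  simp only [dz, Finset.sum_mul]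
  exact Finset.sum_congr rfl fun i _ => by ring

theorem dz_sum {ι : Type*} (s : Finset ι) {f : ι → (Fin n → ℂ) → ℂ} {z : Fin n → ℂ}
    (h : ∀ k ∈ s, DifferentiableAt ℝ (f k) z) (w : Fin n → ℂ) :
    dz (fun x => ∑ k ∈ s, f k x) z w = ∑ k ∈ s, dz (f k) z w := by
  rw [(HasWirt.sum s fun k hk => hasWirt_of_diff (h k hk)).dz_eq]
  simp only [dz, Finset.sum_mul]
  exact Finset.sum_comm

/-- `∂̄u = conj (∂ū)`. -/
theorem wirtBar_eq_conj {u : (Fin n → ℂ) → ℂ} {z : Fin n → ℂ} (hu : DifferentiableAt ℝ u z)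
    (i : Fin n) : wirtBar i u z = conj (wirt i (fun x => conj (u x)) z) := by
  rw [(hasWirt_of_diff hu).conjugate.wirt_eq, Complex.conj_conj]

theorem sum_wirtBar_mul_conj {u : (Fin n → ℂ) → ℂ} {z : Fin n → ℂ} (hu : DifferentiableAt ℝ u z)
    (v : Fin n → ℂ) :
    ∑ i, wirtBar i u z * conj (v i) = conj (dz (fun x => conj (u x)) z v) := by
  simp only [dz, map_sum, map_mul, wirtBar_eq_conj hu]

/-! ### Sesquilinear forms in coordinates -/

/-- The sesquilinear form `m_{i j̄} vⁱ t̄ʲ`. -/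
def sesq (m : Fin n → Fin n → ℂ) (v t : Fin n → ℂ) : ℂ := ∑ i, ∑ j, m i j * v i * conj (t j)

/-- The linear form `b_i vⁱ`. -/
def linF (b v : Fin n → ℂ) : ℂ := ∑ i, b i * v i

theorem linF_add (b v v' : Fin n → ℂ) : linF b (v + v') = linF b v + linF b v' := by
  simp [linF, mul_add, Finset.sum_add_distrib]

theorem linF_smul (b : Fin n → ℂ) (c : ℂ) (v : Fin n → ℂ) : linF b (c • v) = c * linF b v := by
  simp only [linF, Pi.smul_apply, smul_eq_mul, Finset.mul_sum]
  exact Finset.sum_congr rfl fun i _ => by ring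

theorem linF_add_form (b b' v : Fin n → ℂ) :
    linF (fun i => b i + b' i) v = linF b v + linF b' v := by
  simp [linF, add_mul, Finset.sum_add_distrib]

theorem sesq_eq_linF (m : Fin n → Fin n → ℂ) (v t : Fin n → ℂ) :
    sesq m v t = linF (fun i => ∑ j, m i j * conj (t j)) v := by
  simp only [sesq, linF, Finset.sum_mul]
  exact Finset.sum_congr rfl fun i _ => Finset.sum_congr rfl fun j _ => by ring

theorem sesq_eq_linF_conj (m : Fin n → Fin n → ℂ) (v t : Fin n → ℂ) :
    sesq m v t = linF (fun j => ∑ i, m i j * v i) (fun j => conj (t j)) := by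
  simp only [sesq, linF, Finset.sum_mul]
  exact Finset.sum_comm

theorem sesq_add_left (m : Fin n → Fin n → ℂ) (v v' t : Fin n → ℂ) :
    sesq m (v + v') t = sesq m v t + sesq m v' t := by
  simp only [sesq_eq_linF, linF_add]

theorem sesq_smul_left (m : Fin n → Fin n → ℂ) (c : ℂ) (v t : Fin n → ℂ) :
    sesq m (c • v) t = c * sesq m v t := by
  simp only [sesq_eq_linF, linF_smul]

theorem sesq_add_right (m : Fin n → Fin n → ℂ) (v t t' : Fin n → ℂ) :
    sesq m v (t + t') = sesq m v t + sesq m v t' := by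
  simp only [sesq_eq_linF_conj, ← linF_add]
  congr 1; ext j; simp

theorem sesq_smul_right (m : Fin n → Fin n → ℂ) (c : ℂ) (v t : Fin n → ℂ) :
    sesq m v (c • t) = conj c * sesq m v t := by
  simp only [sesq_eq_linF_conj, ← linF_smul]
  congr 1; ext j; simp

theorem sesq_add_form (m m' : Fin n → Fin n → ℂ) (v t : Fin n → ℂ) :
    sesq (fun i j => m i j + m' i j) v t = sesq m v t + sesq m' v t := by
  simp only [sesq, add_mul, Finset.sum_add_distrib]

theorem sesq_smul_form (c : ℂ) (m : Fin n → Fin n → ℂ) (v t : Fin n → ℂ) :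
    sesq (fun i j => c * m i j) v t = c * sesq m v t := by
  simp only [sesq, Finset.mul_sum]
  exact Finset.sum_congr rfl fun i _ => Finset.sum_congr rfl fun j _ => by ring

theorem sesq_prod_form (b c v t : Fin n → ℂ) :
    sesq (fun i j => b i * c j) v t = linF b v * linF c (fun j => conj (t j)) := by
  simp only [sesq, linF, Finset.sum_mul_sum]
  exact Finset.sum_congr rfl fun i _ => Finset.sum_congr rfl fun j _ => by ring

theorem conj_linF (b v : Fin n → ℂ) :
    conj (linF b v) = linF (fun i => conj (b i)) (fun i => conj (v i)) := by
  simp [linF]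

theorem sesq_single_right (m : Fin n → Fin n → ℂ) (v : Fin n → ℂ) (j : Fin n) :
    sesq m v (Pi.single j 1) = ∑ i, m i j * v i := by
  rw [sesq_eq_linF_conj, linF, Finset.sum_eq_single j]
  · simp
  · intro k _ hk; simp [hk]
  · simp

theorem sesq_neg_left (m : Fin n → Fin n → ℂ) (v t : Fin n → ℂ) :
    sesq m (-v) t = -sesq m v t := by
  rw [← neg_one_smul ℂ v, sesq_smul_left]; ring

theorem sesq_sub_left (m : Fin n → Fin n → ℂ) (v v' t : Fin n → ℂ) :
    sesq m (v - v') t = sesq m v t - sesq m v' t := by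
  rw [sub_eq_add_neg, sesq_add_left, sesq_neg_left]; ring

theorem eq_sum_of_linear {f : (Fin n → ℂ) → ℂ} (ha : ∀ v w, f (v + w) = f v + f w)
    (hs : ∀ (c : ℂ) v, f (c • v) = c * f v) (v : Fin n → ℂ) :
    f v = ∑ i, v i * f (Pi.single i 1) := by
  have h := LinearMap.pi_apply_eq_sum_univ (IsLinearMap.mk' f ⟨ha, hs⟩) v
  simp only [IsLinearMap.mk'_apply, smul_eq_mul] at h
  rw [h]
  refine Finset.sum_congr rfl fun i _ => ?_
  congr 2
  ext j
  simp [Pi.single_apply, eq_comm]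

/-- Positive definite Hermitian matrices. -/
structure IsPosHerm (m : Fin n → Fin n → ℂ) : Prop where
  herm : ∀ i j, conj (m i j) = m j i
  pos : ∀ v, v ≠ 0 → 0 < (sesq m v v).re

namespace IsPosHerm

variable {m : Fin n → Fin n → ℂ}

theorem conj_sesq (hm : IsPosHerm m) (v t : Fin n → ℂ) : conj (sesq m v t) = sesq m t v := by
  simp only [sesq, map_sum, map_mul, hm.herm, Complex.conj_conj]
  rw [Finset.sum_comm]
  exact Finset.sum_congr rfl fun i _ => Finset.sum_congr rfl fun j _ => by ring

theorem sesq_self (hm : IsPosHerm m) (v : Fin n → ℂ) : ((sesq m v v).re : ℂ) = sesq m v v :=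
  Complex.conj_eq_iff_re.mp (hm.conj_sesq v v)

theorem nonneg (hm : IsPosHerm m) (v : Fin n → ℂ) : 0 ≤ (sesq m v v).re := by
  by_cases h : v = 0
  · subst h; simp [sesq]
  · exact (hm.pos v h).le

theorem sesq_self_ne (hm : IsPosHerm m) {v : Fin n → ℂ} (hv : v ≠ 0) : sesq m v v ≠ 0 := by
  intro h
  have := hm.pos v hv
  simp [h] at this

theorem eq_zero (hm : IsPosHerm m) {v : Fin n → ℂ} (h : ∀ t, sesq m v t = 0) : v = 0 := by
  by_contra hv
  exact hm.sesq_self_ne hv (h v)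

theorem ext (hm : IsPosHerm m) {v w : Fin n → ℂ} (h : ∀ t, sesq m v t = sesq m w t) : v = w := by
  rw [← sub_eq_zero]
  exact hm.eq_zero fun t => by rw [sesq_sub_left, h, sub_self]

end IsPosHerm

/-- A matrix with a nondegenerate form has invertible determinant. -/
theorem isUnit_det_of_sesq {g : Matrix (Fin n) (Fin n) ℂ}
    (h : ∀ v, v ≠ 0 → sesq (fun i j => g i j) v v ≠ 0) : IsUnit g.det := by
  rw [isUnit_iff_ne_zero]
  intro h0
  obtain ⟨v, hv, hv0⟩ := Matrix.exists_vecMul_eq_zero_iff.mpr h0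
  refine h v hv ?_
  rw [sesq_eq_linF_conj]
  have : (fun j => ∑ i, g i j * v i) = 0 := by
    rw [← hv0]; ext j
    simp [Matrix.vecMul, dotProduct, mul_comm]
  rw [this]; simp [linF]

/-- Raising an index with the inverse matrix solves the corresponding linear system. -/
theorem sum_inv_mul {g : Matrix (Fin n) (Fin n) ℂ} (hg : IsUnit g.det) (y : Fin n → ℂ)
    (p : Fin n) : ∑ i, g i p * ∑ k, g⁻¹ k i * y k = y p := by
  have h1 : g⁻¹ * g = 1 := Matrix.nonsing_inv_mul g hg
  calc ∑ i, g i p * ∑ k, g⁻¹ k i * y k = ∑ k, (g⁻¹ * g) k p * y k := by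
        simp only [Matrix.mul_apply, Finset.sum_mul, Finset.mul_sum]
        rw [Finset.sum_comm]
        exact Finset.sum_congr rfl fun i _ => Finset.sum_congr rfl fun j _ => by ring
    _ = y p := by simp [h1, Matrix.one_apply]

theorem sesq_inv_mul {g : Matrix (Fin n) (Fin n) ℂ} (hg : IsUnit g.det) (y t : Fin n → ℂ) :
    sesq (fun i j => g i j) (fun i => ∑ k, g⁻¹ k i * y k) t = ∑ k, y k * conj (t k) := by
  rw [sesq_eq_linF_conj, linF]
  exact Finset.sum_congr rfl fun p _ => by rw [sum_inv_mul hg y p]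

/-! ### Derivatives of matrix valued functions -/

/-- The `(1,0)`-differential of a matrix valued function. -/
def dmat (a : (Fin n → ℂ) → Fin n → Fin n → ℂ) (z u : Fin n → ℂ) (i j : Fin n) : ℂ :=
  dz (fun w => a w i j) z u

/-- The `(1,0)`-differential of a vector valued function. -/
def dvec (b : (Fin n → ℂ) → Fin n → ℂ) (z u : Fin n → ℂ) (i : Fin n) : ℂ :=
  dz (fun w => b w i) z u

theorem sesq_dmat_add (a : (Fin n → ℂ) → Fin n → Fin n → ℂ) (z u u' v t : Fin n → ℂ) :
    sesq (dmat a z (u + u')) v t = sesq (dmat a z u) v t + sesq (dmat a z u') v t := by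
  rw [← sesq_add_form]; congr 1; ext i j; simp [dmat, dz_add_vec]

theorem sesq_dmat_smul (a : (Fin n → ℂ) → Fin n → Fin n → ℂ) (z : Fin n → ℂ) (c : ℂ)
    (u v t : Fin n → ℂ) :
    sesq (dmat a z (c • u)) v t = c * sesq (dmat a z u) v t := by
  rw [← sesq_smul_form]; congr 1; ext i j; simp [dmat, dz_smul_vec]

theorem linF_dvec_add (a : (Fin n → ℂ) → Fin n → ℂ) (z u u' v : Fin n → ℂ) :
    linF (dvec a z (u + u')) v = linF (dvec a z u) v + linF (dvec a z u') v := by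
  rw [← linF_add_form]; congr 1; ext i; simp [dvec, dz_add_vec]

theorem differentiableAt_linF {b : (Fin n → ℂ) → Fin n → ℂ} {z : Fin n → ℂ}
    (hb : ∀ i, DifferentiableAt ℝ (fun w => b w i) z) (v : Fin n → ℂ) :
    DifferentiableAt ℝ (fun w => linF (b w) v) z := by
  unfold linF
  fun_prop

theorem dz_linF {b : (Fin n → ℂ) → Fin n → ℂ} {z : Fin n → ℂ}
    (hb : ∀ i, DifferentiableAt ℝ (fun w => b w i) z) (u v : Fin n → ℂ) :
    dz (fun w => linF (b w) v) z u = linF (dvec b z u) v := by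
  unfold linF
  rw [dz_sum _ (fun i _ => (hb i).mul_const _)]
  exact Finset.sum_congr rfl fun i _ => dz_mul_const (hb i) _ _

theorem dz_sesq {a : (Fin n → ℂ) → Fin n → Fin n → ℂ} {z : Fin n → ℂ}
    (ha : ∀ i j, DifferentiableAt ℝ (fun w => a w i j) z) (u v t : Fin n → ℂ) :
    dz (fun w => sesq (a w) v t) z u = sesq (dmat a z u) v t := by
  unfold sesq
  rw [dz_sum _ (fun i _ => by fun_prop)]
  refine Finset.sum_congr rfl fun i _ => ?_
  rw [dz_sum _ (fun j _ => by fun_prop)]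
  refine Finset.sum_congr rfl fun j _ => ?_
  rw [dz_mul_const (by fun_prop), dz_mul_const (ha i j)]
  rfl

/-! ### Euler form of the spray equations -/

section Spray

variable {Φ : (Fin n → ℂ) → (Fin n → ℂ) → ℝ}

/-- Lowering the index of N with g cancels the inverse matrix in its definition. -/
theorem sesq_nonlinConn {z η : Fin n → ℂ} (hg : IsUnit (fundTensor Φ z η).det)
    (u t : Fin n → ℂ) :
    sesq (fun i j => fundTensor Φ z η i j) (fun i => ∑ j, nonlinConn Φ z η i j * u j) t =
      sesq (dmat (fun w i j => fundTensor Φ w η i j) z u) η t := by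
  have h1 : (fun i => ∑ j, nonlinConn Φ z η i j * u j) = fun i => ∑ k, (fundTensor Φ z η)⁻¹ k i *
      ∑ l, dz (fun w => fundTensor Φ w η l k) z u * η l := by
    ext i
    simp only [nonlinConn, dz, Finset.sum_mul, Finset.mul_sum]
    rw [Finset.sum_comm]
    refine Finset.sum_congr rfl fun k _ => ?_
    rw [Finset.sum_comm]
    exact Finset.sum_congr rfl fun l _ => Finset.sum_congr rfl fun j _ => by ring
  rw [h1, sesq_inv_mul hg, sesq_eq_linF_conj]
  rfl

theorem sesq_spray {z η : Fin n → ℂ} (hg : IsUnit (fundTensor Φ z η).det) (t : Fin n → ℂ) :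
    sesq (fun i j => fundTensor Φ z η i j) ((2 : ℂ) • spray Φ z η) t =
      sesq (dmat (fun w i j => fundTensor Φ w η i j) z η) η t := by
  rw [← sesq_nonlinConn hg]
  congr 1
  ext i
  simp [spray]

end Spray

/-! ### Hermitian metrics -/

/-- `Φ` is the norm of the Hermitian metric `h` over the open set `T`. -/
structure IsHermNorm (T : Set (Fin n → ℂ)) (h : (Fin n → ℂ) → Fin n → Fin n → ℂ)
    (Φ : (Fin n → ℂ) → (Fin n → ℂ) → ℝ) : Prop where
  isOpen : IsOpen T
  diff : ∀ z ∈ T, ∀ i j, DifferentiableAt ℝ (fun w => h w i j) z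
  pos : ∀ z ∈ T, IsPosHerm (h z)
  norm_eq : ∀ z ∈ T, ∀ η, Φ z η = Real.sqrt (sesq (h z) η η).re

theorem hasWirt_sesq_self (m : Fin n → Fin n → ℂ) (ξ : Fin n → ℂ) :
    HasWirt (fun ζ => sesq m ζ ζ) (fun i => ∑ j, m i j * conj (ξ j))
      (fun j => ∑ i, m i j * ξ i) ξ := by
  unfold sesq
  refine (HasWirt.sum (z := ξ) Finset.univ fun i _ => HasWirt.sum Finset.univ fun j _ =>
    ((HasWirt.coord i).const_mul (m i j)).mul (HasWirt.coord j).conjugate).congr_val ?_ ?_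
  · intro k
    simp
  · intro k
    simp [apply_ite conj]

theorem hasWirt_linF (b ξ : Fin n → ℂ) :
    HasWirt (fun ζ => linF b ζ) (fun i => b i) (fun _ => 0) ξ := by
  unfold linF
  refine (HasWirt.sum (z := ξ) Finset.univ fun i _ =>
    ((HasWirt.coord i).const_mul (b i))).congr_val ?_ ?_
  · intro k; simp
  · intro k; simp

namespace IsHermNorm

variable {T : Set (Fin n → ℂ)} {h : (Fin n → ℂ) → Fin n → Fin n → ℂ}
  {Φ : (Fin n → ℂ) → (Fin n → ℂ) → ℝ} (hΦ : IsHermNorm T h Φ)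
include hΦ

theorem fundTensor_eq {z : Fin n → ℂ} (hz : z ∈ T) (η : Fin n → ℂ) (i j : Fin n) :
    fundTensor Φ z η i j = h z i j := by
  have h1 : (fun ζ => ((Φ z ζ ^ 2 : ℝ) : ℂ)) = fun ζ => sesq (h z) ζ ζ := by
    ext ζ
    rw [hΦ.norm_eq z hz, Real.sq_sqrt ((hΦ.pos z hz).nonneg ζ), (hΦ.pos z hz).sesq_self]
  unfold fundTensor
  rw [Matrix.of_apply, h1]
  have h2 : (fun ξ => wirtBar j (fun ζ => sesq (h z) ζ ζ) ξ) =
      fun ξ => linF (fun i => h z i j) ξ := by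
    ext ξ
    rw [(hasWirt_sesq_self (h z) ξ).bar_eq]
    rfl
  rw [h2, (hasWirt_linF _ η).wirt_eq]

theorem fundTensor_form {z : Fin n → ℂ} (hz : z ∈ T) (η : Fin n → ℂ) :
    (fun i j => fundTensor Φ z η i j) = h z := by
  ext i j; exact hΦ.fundTensor_eq hz η i j

theorem isUnit_det {z : Fin n → ℂ} (hz : z ∈ T) (η : Fin n → ℂ) :
    IsUnit (fundTensor Φ z η).det := by
  refine isUnit_det_of_sesq fun v hv => ?_
  rw [hΦ.fundTensor_form hz]
  exact (hΦ.pos z hz).sesq_self_ne hv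

theorem wirt_fundTensor {z : Fin n → ℂ} (hz : z ∈ T) (η : Fin n → ℂ) (i j k : Fin n) :
    wirt k (fun w => fundTensor Φ w η i j) z = wirt k (fun w => h w i j) z := by
  refine wirt_congr ?_ k
  filter_upwards [hΦ.isOpen.mem_nhds hz] with w hw
  exact hΦ.fundTensor_eq hw η i j

theorem dmat_fundTensor {z : Fin n → ℂ} (hz : z ∈ T) (η u : Fin n → ℂ) :
    dmat (fun w i j => fundTensor Φ w η i j) z u = dmat h z u := by
  ext i j
  simp only [dmat, dz, hΦ.wirt_fundTensor hz]

theorem sesq_nonlinConn {z : Fin n → ℂ} (hz : z ∈ T) (η u t : Fin n → ℂ) :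
    sesq (h z) (fun i => ∑ j, nonlinConn Φ z η i j * u j) t = sesq (dmat h z u) η t := by
  have := Zermelo.sesq_nonlinConn (hΦ.isUnit_det hz η) u t
  rwa [hΦ.fundTensor_form hz, hΦ.dmat_fundTensor hz] at this

theorem sesq_spray {z : Fin n → ℂ} (hz : z ∈ T) (η t : Fin n → ℂ) :
    sesq (h z) ((2 : ℂ) • spray Φ z η) t = sesq (dmat h z η) η t := by
  have := Zermelo.sesq_spray (hΦ.isUnit_det hz η) t
  rwa [hΦ.fundTensor_form hz, hΦ.dmat_fundTensor hz] at this

theorem nonlinConn_eq {z : Fin n → ℂ} (hz : z ∈ T) (η : Fin n → ℂ) (i k : Fin n) :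
    nonlinConn Φ z η i k = linF (fun l => ∑ m, (Matrix.of (h z))⁻¹ m i *
      wirt k (fun w => h w l m) z) η := by
  have hm : fundTensor Φ z η = Matrix.of (h z) := by
    ext i j; exact hΦ.fundTensor_eq hz η i j
  simp only [nonlinConn, hm, hΦ.wirt_fundTensor hz, linF, Finset.sum_mul]
  exact Finset.sum_comm

/-- For a Hermitian metric N is complex linear in η, so its derivative in a coordinate direction is
its value on the basis vector. -/
theorem horizCoeff_eq {z : Fin n → ℂ} (hz : z ∈ T) (η : Fin n → ℂ) (i j k : Fin n) :
    horizCoeff Φ z η i j k = nonlinConn Φ z (Pi.single j 1) i k := by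
  unfold horizCoeff
  rw [show (fun ξ => nonlinConn Φ z ξ i k) = fun ξ => linF (fun l => ∑ m,
    (Matrix.of (h z))⁻¹ m i * wirt k (fun w => h w l m) z) ξ from
      funext fun ξ => hΦ.nonlinConn_eq hz ξ i k, (hasWirt_linF _ η).wirt_eq, hΦ.nonlinConn_eq hz]
  simp [linF, Pi.single_apply]

theorem sum_horizCoeff {z : Fin n → ℂ} (hz : z ∈ T) (η v : Fin n → ℂ) (i k : Fin n) :
    ∑ j, horizCoeff Φ z η i j k * v j = nonlinConn Φ z v i k := by
  simp only [hΦ.horizCoeff_eq hz, hΦ.nonlinConn_eq hz, linF]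
  simp [Pi.single_apply]

/-- Contracting L with η̄ on either lower index turns it into N, and lowering the index of N gives a
derivative of h. What remains is the torsion contracted with η twice. -/
theorem sesq_thetaStar {z : Fin n → ℂ} (hz : z ∈ T) (η t : Fin n → ℂ) :
    sesq (h z) (thetaStar Φ z η) t =
      conj (sesq (dmat h z t) η η - sesq (dmat h z η) t η) := by
  have hP := hΦ.pos z hz
  have key : ∀ m, ∑ q, ∑ p, ∑ j, fundTensor Φ z η q p *
      conj (horizCoeff Φ z η p j m - horizCoeff Φ z η p m j) * η q * conj (η j) =
      conj (sesq (dmat h z (Pi.single m 1)) η η - sesq (dmat h z η) (Pi.single m 1) η) := by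
    intro m
    have e1 : (fun i => nonlinConn Φ z η i m) =
        fun i => ∑ j, nonlinConn Φ z η i j * (Pi.single m 1 : Fin n → ℂ) j := by
      ext i; simp [Pi.single_apply]
    rw [← hΦ.sesq_nonlinConn hz, ← hΦ.sesq_nonlinConn hz, ← e1, ← sesq_sub_left, hP.conj_sesq]
    unfold sesq
    refine Finset.sum_congr rfl fun q _ => Finset.sum_congr rfl fun p _ => ?_
    rw [hΦ.fundTensor_eq hz, Pi.sub_apply, ← hΦ.sum_horizCoeff hz η η p m]
    simp only [← hΦ.horizCoeff_eq hz η]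
    rw [← Finset.sum_sub_distrib, map_sum, Finset.mul_sum]
    refine Finset.sum_congr rfl fun j _ => ?_
    simp only [map_sub, map_mul]
    ring
  have h1 : thetaStar Φ z η = fun k => ∑ m, (fundTensor Φ z η)⁻¹ m k *
      conj (sesq (dmat h z (Pi.single m 1)) η η - sesq (dmat h z η) (Pi.single m 1) η) := by
    ext k
    unfold thetaStar
    refine Finset.sum_congr rfl fun m _ => ?_
    rw [← key m]
    simp only [Finset.mul_sum]
    exact Finset.sum_congr rfl fun q _ => Finset.sum_congr rfl fun p _ =>
      Finset.sum_congr rfl fun j _ => by ring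
  have h2 := sesq_inv_mul (hΦ.isUnit_det hz η) (fun m =>
      conj (sesq (dmat h z (Pi.single m 1)) η η - sesq (dmat h z η) (Pi.single m 1) η)) t
  rw [hΦ.fundTensor_form hz, ← h1] at h2
  rw [h2]
  -- The torsion is linear in t, so the basis values computed in `key` determine it.
  rw [eq_sum_of_linear (f := fun t => sesq (dmat h z t) η η - sesq (dmat h z η) t η)
    (fun v w => by simp only [sesq_dmat_add, sesq_add_left]; ring)
    (fun c v => by simp only [sesq_dmat_smul, sesq_smul_left]; ring) t, map_sum]
  refine Finset.sum_congr rfl fun m _ => ?_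
  simp only [map_sub, map_mul]
  ring

end IsHermNorm

/-! ### Auxiliary linear algebra -/

/-- A continuous function vanishing off two hyperplanes vanishes. -/
theorem eq_zero_of_generic {B C d : Fin n → ℂ} (hB : linF B d ≠ 0) (hC : linF C d ≠ 0)
    {g : (Fin n → ℂ) → ℂ} (hg : Continuous g)
    (h : ∀ ξ, linF B ξ ≠ 0 → linF C ξ ≠ 0 → g ξ = 0) (ξ : Fin n → ℂ) : g ξ = 0 := by
  have hcont : Continuous fun t : ℂ => g (ξ + t • d) := by fun_prop
  -- On the line ξ + t d each form is affine in t with nonzero slope, so it has one zero. Every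
  -- small t ≠ 0 avoids both zeros, and continuity gives t = 0.
  have hlin : ∀ D : Fin n → ℂ, linF D d ≠ 0 →
      ∀ᶠ t in nhdsWithin (0 : ℂ) {0}ᶜ, linF D (ξ + t • d) ≠ 0 := by
    intro D hD
    have h1 : ∀ t, t ≠ -linF D ξ / linF D d → linF D (ξ + t • d) ≠ 0 := by
      intro t ht h0
      rw [linF_add, linF_smul] at h0
      refine ht ?_
      rw [eq_div_iff hD]
      linear_combination h0
    by_cases h0 : -linF D ξ / linF D d = 0
    · filter_upwards [self_mem_nhdsWithin] with t ht
      exact h1 t (by rw [h0]; exact ht)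
    · filter_upwards [nhdsWithin_le_nhds (isOpen_ne.mem_nhds (Ne.symm h0))] with t ht
      exact h1 t ht
  have hev : (fun t : ℂ => g (ξ + t • d)) =ᶠ[nhdsWithin (0 : ℂ) {0}ᶜ] fun _ => 0 := by
    filter_upwards [hlin B hB, hlin C hC] with t h1 h2
    exact h _ h1 h2
  have h1 : Filter.Tendsto (fun t : ℂ => g (ξ + t • d)) (nhdsWithin (0 : ℂ) {0}ᶜ) (nhds (g ξ)) := by
    have := (hcont.tendsto 0).mono_left (nhdsWithin_le_nhds (s := ({0}ᶜ : Set ℂ)))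
    simpa using this
  exact tendsto_nhds_unique h1 ((Filter.tendsto_congr' hev).mpr tendsto_const_nhds)

/-- Averaging conj t times the identity over the fourth roots of unity keeps the monomials whose
exponent difference is 1 modulo 4. Among those listed only c10 t qualifies. -/
theorem coeff_eq_zero {c00 c10 c01 c02 c11 c12 : ℂ}
    (h : ∀ t : ℂ, c00 + c10 * t + c01 * conj t + c02 * conj t ^ 2 + c11 * (t * conj t)
      + c12 * (t * conj t ^ 2) = 0) : c10 = 0 := by
  have h1 := h 1
  have h2 := h (-1)
  have h3 := h Complex.I
  have h4 := h (-Complex.I)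
  simp only [map_one, map_neg, Complex.conj_I] at h1 h2 h3 h4
  linear_combination (1 / 4) * h1 - (1 / 4) * h2 - (1 / 4) * Complex.I * h3
    + (1 / 4) * Complex.I * h4 +
    ((1 / 2) * c10 - (1 / 2) * c01 + (1 / 2) * c12 * Complex.I ^ 2 - (1 / 2) * c12) * Complex.I_sq

/-- For `n ≥ 2` a linear form has a nontrivial kernel. -/
theorem exists_ker (hn : 2 ≤ n) (b : Fin n → ℂ) : ∃ v : Fin n → ℂ, v ≠ 0 ∧ linF b v = 0 := by
  let i : Fin n := ⟨0, by omega⟩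
  let j : Fin n := ⟨1, by omega⟩
  have hij : i ≠ j := by simp [i, j, Fin.ext_iff]
  have hs : ∀ k, linF b (Pi.single k 1) = b k := by
    intro k; simp [linF, Pi.single_apply]
  by_cases hi : b i = 0
  · refine ⟨Pi.single i 1, ?_, by rw [hs, hi]⟩
    intro h0
    have := congrFun h0 i
    simp at this
  · refine ⟨b j • Pi.single i 1 + (-b i) • Pi.single j 1, ?_, ?_⟩
    · intro h0
      have := congrFun h0 j
      simp [hij.symm, hi] at this
    · rw [linF_add, linF_smul, linF_smul, hs, hs]; ring

/-! ### Navigation data in coordinates -/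

/-- Navigation data `(h, W)` over an open set `T` of coordinates, with the new metric `a` and the
new form `b`. -/
structure LocalNav (T : Set (Fin n → ℂ)) (h a : (Fin n → ℂ) → Fin n → Fin n → ℂ)
    (b W : (Fin n → ℂ) → Fin n → ℂ) (ε : (Fin n → ℂ) → ℝ) : Prop where
  isOpen : IsOpen T
  smooth_h : ∀ z ∈ T, ∀ i j, ContDiffAt ℝ ∞ (fun w => h w i j) z
  smooth_b : ∀ z ∈ T, ∀ i, ContDiffAt ℝ ∞ (fun w => b w i) z
  smooth_eps : ∀ z ∈ T, ContDiffAt ℝ ∞ ε z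
  pos : ∀ z ∈ T, IsPosHerm (h z)
  eps_pos : ∀ z ∈ T, 0 < ε z
  wind_ne : ∀ z ∈ T, W z ≠ 0
  a_eq : ∀ z ∈ T, ∀ i j, a z i j = (ε z : ℂ)⁻¹ * h z i j + b z i * conj (b z j)
  h_wind : ∀ z ∈ T, ∀ v, sesq (h z) v (W z) = ε z * linF (b z) v

namespace LocalNav

variable {T : Set (Fin n → ℂ)} {h a : (Fin n → ℂ) → Fin n → Fin n → ℂ}
  {b W : (Fin n → ℂ) → Fin n → ℂ} {ε : (Fin n → ℂ) → ℝ} (D : LocalNav T h a b W ε)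
  {z : Fin n → ℂ} (hz : z ∈ T)
include D hz

theorem eps_ne : (ε z : ℂ) ≠ 0 := by exact_mod_cast (D.eps_pos z hz).ne'

/-- The constant is ‖W‖²/ε̃. Its reality removes conjugates, and its positivity makes both κ and 1 +
κ invertible. -/
theorem exists_kappa : ∃ κ : ℝ, 0 < κ ∧ linF (b z) (W z) = κ := by
  refine ⟨(sesq (h z) (W z) (W z)).re / ε z,
    div_pos ((D.pos z hz).pos _ (D.wind_ne z hz)) (D.eps_pos z hz), ?_⟩
  rw [Complex.ofReal_div, (D.pos z hz).sesq_self, D.h_wind z hz,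
    mul_div_cancel_left₀ _ (D.eps_ne hz)]

theorem sesq_a (v t : Fin n → ℂ) :
    sesq (a z) v t = (ε z : ℂ)⁻¹ * sesq (h z) v t + linF (b z) v * conj (linF (b z) t) := by
  rw [conj_linF, ← sesq_prod_form, ← sesq_smul_form, ← sesq_add_form]
  congr 1; ext i j; exact D.a_eq z hz i j

theorem pos_a : IsPosHerm (a z) := by
  refine ⟨fun i j => ?_, fun v hv => ?_⟩
  · rw [D.a_eq z hz, D.a_eq z hz, map_add, map_mul, map_mul, (D.pos z hz).herm, Complex.conj_conj,
      map_inv₀, Complex.conj_ofReal]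
    ring
  · rw [D.sesq_a hz, ← (D.pos z hz).sesq_self, Complex.mul_conj, ← Complex.ofReal_inv,
      ← Complex.ofReal_mul, ← Complex.ofReal_add, Complex.ofReal_re]
    have h1 := mul_pos (inv_pos.mpr (D.eps_pos z hz)) ((D.pos z hz).pos v hv)
    have h2 := Complex.normSq_nonneg (linF (b z) v)
    linarith

theorem smooth_a (i j : Fin n) : ContDiffAt ℝ ∞ (fun w => a w i j) z := by
  have h1 : (fun w => a w i j) =ᶠ[nhds z]
      fun w => (((ε w)⁻¹ : ℝ) : ℂ) * h w i j + b w i * conj (b w j) := by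
    filter_upwards [D.isOpen.mem_nhds hz] with w hw
    rw [D.a_eq w hw, Complex.ofReal_inv]
  refine ContDiffAt.congr_of_eventuallyEq ?_ h1
  have e1 : ContDiffAt ℝ ∞ (fun w => (((ε w)⁻¹ : ℝ) : ℂ)) z :=
    Complex.ofRealCLM.contDiff.contDiffAt.comp z ((D.smooth_eps z hz).inv (D.eps_pos z hz).ne')
  have e2 : ContDiffAt ℝ ∞ (fun w => conj (b w j)) z :=
    (Complex.conjCLE : ℂ →L[ℝ] ℂ).contDiff.contDiffAt.comp z (D.smooth_b z hz j)
  exact (e1.mul (D.smooth_h z hz i j)).add ((D.smooth_b z hz i).mul e2)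

theorem diff_h (i j : Fin n) : DifferentiableAt ℝ (fun w => h w i j) z :=
  (D.smooth_h z hz i j).differentiableAt (by simp)

theorem diff_a (i j : Fin n) : DifferentiableAt ℝ (fun w => a w i j) z :=
  (D.smooth_a hz i j).differentiableAt (by simp)

theorem diff_b (i : Fin n) : DifferentiableAt ℝ (fun w => b w i) z :=
  (D.smooth_b z hz i).differentiableAt (by simp)

theorem diff_bconj (i : Fin n) : DifferentiableAt ℝ (fun w => conj (b w i)) z :=
  (hasWirt_of_diff (D.diff_b hz i)).conjugate.diff

theorem diff_epsInv : DifferentiableAt ℝ (fun w => (ε w : ℂ)⁻¹) z := by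
  have e1 : DifferentiableAt ℝ (fun w => (((ε w)⁻¹ : ℝ) : ℂ)) z :=
    (Complex.ofRealCLM.contDiff.contDiffAt.comp z
      ((D.smooth_eps z hz).inv (D.eps_pos z hz).ne')).differentiableAt (by simp)
  simpa using e1

theorem sesq_dmat_a (u v t : Fin n → ℂ) :
    sesq (dmat a z u) v t = dz (fun w => (ε w : ℂ)⁻¹) z u * sesq (h z) v t
      + (ε z : ℂ)⁻¹ * sesq (dmat h z u) v t
      + linF (dvec b z u) v * conj (linF (b z) t)
      + linF (b z) v * linF (dvec (fun w i => conj (b w i)) z u) (fun i => conj (t i)) := by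
  have h1 : ∀ i j, dmat a z u i j = dz (fun w => (ε w : ℂ)⁻¹) z u * h z i j
      + (ε z : ℂ)⁻¹ * dmat h z u i j + dvec b z u i * conj (b z j)
      + b z i * dvec (fun w i => conj (b w i)) z u j := by
    intro i j
    have e : (fun w => a w i j) =ᶠ[nhds z]
        fun w => (ε w : ℂ)⁻¹ * h w i j + b w i * conj (b w j) := by
      filter_upwards [D.isOpen.mem_nhds hz] with w hw using D.a_eq w hw i j
    unfold dmat dvec
    rw [dz_congr e, dz_add ((D.diff_epsInv hz).fun_mul (D.diff_h hz i j))
      ((D.diff_b hz i).fun_mul (D.diff_bconj hz j)), dz_mul (D.diff_epsInv hz) (D.diff_h hz i j),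
      dz_mul (D.diff_b hz i) (D.diff_bconj hz j)]
    ring
  rw [conj_linF, ← sesq_prod_form, ← sesq_prod_form, ← sesq_smul_form, ← sesq_smul_form,
    ← sesq_add_form, ← sesq_add_form, ← sesq_add_form]
  congr 1; ext i j; exact h1 i j

omit hz in
theorem isHermNorm_h {Φ : (Fin n → ℂ) → (Fin n → ℂ) → ℝ}
    (hΦ : ∀ z ∈ T, ∀ η, Φ z η = Real.sqrt (sesq (h z) η η).re) : IsHermNorm T h Φ :=
  ⟨D.isOpen, fun _ hw => D.diff_h hw, D.pos, hΦ⟩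

omit hz in
theorem isHermNorm_a {Φ : (Fin n → ℂ) → (Fin n → ℂ) → ℝ}
    (hΦ : ∀ z ∈ T, ∀ η, Φ z η = Real.sqrt (sesq (a z) η η).re) : IsHermNorm T a Φ :=
  ⟨D.isOpen, fun _ hw => D.diff_a hw, fun _ hw => D.pos_a hw, hΦ⟩

/-! ### Comparison of the torsions -/

omit D hz in
/-- The alternation `∂_u m(v, t̄) - ∂_v m(u, t̄)`. -/
def alt (m : (Fin n → ℂ) → Fin n → Fin n → ℂ) (z u v t : Fin n → ℂ) : ℂ :=
  sesq (dmat m z u) v t - sesq (dmat m z v) u t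

omit D hz in
/-- The form measuring the deviation between the torsions of `a` and `h`. -/
def torsionDiff (h a : (Fin n → ℂ) → Fin n → Fin n → ℂ) (b W : (Fin n → ℂ) → Fin n → ℂ)
    (ε : (Fin n → ℂ) → ℝ) (z s v t : Fin n → ℂ) : ℂ :=
  alt a z s v t - (ε z : ℂ)⁻¹ * (alt h z s v t + linF (b z) s * alt h z (W z) v t)

/-- This explains the W-term in `torsionDiff`: pairing θ*_h by a instead of h adds b(θ*_h) b̄(s),
and b(θ*_h) = h(θ*_h, W̄)/ε̃ is the torsion of h with W inserted. -/
theorem sesq_thetaStar_sub {Φh Φa : (Fin n → ℂ) → (Fin n → ℂ) → ℝ} (hh : IsHermNorm T h Φh)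
    (ha : IsHermNorm T a Φa) (η s : Fin n → ℂ) :
    sesq (a z) (thetaStar Φa z η - thetaStar Φh z η) s =
      conj (torsionDiff h a b W ε z s η η) := by
  have hw : conj (linF (b z) s) * sesq (h z) (thetaStar Φh z η) (W z) =
      ε z * (conj (linF (b z) s) * linF (b z) (thetaStar Φh z η)) := by
    rw [D.h_wind z hz]; ring
  rw [hh.sesq_thetaStar hz] at hw
  rw [sesq_sub_left, ha.sesq_thetaStar hz, D.sesq_a hz, hh.sesq_thetaStar hz]
  unfold torsionDiff alt
  have := D.eps_ne hz
  simp only [map_sub, map_mul, map_add, map_inv₀, Complex.conj_ofReal] at hw ⊢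
  field_simp
  linear_combination hw

/-- W is a-orthogonal to the kernel of b, so a(W + v, v̄) = a(v, v̄) while b(W + v) = b(W). This
direction lets `eq_zero_of_generic` assume b(η) ≠ 0 and a(η, v̄) ≠ 0. -/
theorem generic_dir (v : Fin n → ℂ) (hv : v ≠ 0) (hbv : linF (b z) v = 0) :
    linF (b z) (W z + v) ≠ 0 ∧
      linF (fun i => ∑ j, a z i j * conj (v j)) (W z + v) ≠ 0 := by
  obtain ⟨κ, hκ, hκe⟩ := D.exists_kappa hz
  constructor
  · rw [linF_add, hbv, hκe, add_zero]; exact_mod_cast hκ.ne'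
  · rw [← sesq_eq_linF, sesq_add_left, ← (D.pos_a hz).conj_sesq v (W z), D.sesq_a hz v (W z),
      D.h_wind z hz, hbv]
    simpa using (D.pos_a hz).sesq_self_ne hv

/-- Eliminating Q and polarizing says that S(s, v, η) is proportional to a(s, η̄) in s, for all v
and η. On the other hand the symmetric part of S in (s, v) has the special shape b(s) c(v) + b(v)
c(s) with c(W) = 0. For n ≥ 2 these are incompatible unless S = 0. -/
theorem torsionDiff_eq_zero (hn : 2 ≤ n)
    (hQ : ∀ η, η ≠ 0 → ∃ Q : ℂ, ∀ s, torsionDiff h a b W ε z s η η = Q * sesq (a z) s η)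
    (s v t : Fin n → ℂ) : torsionDiff h a b W ε z s v t = 0 := by
  obtain ⟨κ, hκ, hκe⟩ := D.exists_kappa hz
  have hκ0 : (κ : ℂ) ≠ 0 := by exact_mod_cast hκ.ne'
  have hκ1 : (1 + κ : ℂ) ≠ 0 := by exact_mod_cast (by linarith : (1 + κ : ℝ) ≠ 0)
  have hε := D.eps_ne hz
  obtain ⟨x, hx0, hbx⟩ := exists_ker hn (b z)
  obtain ⟨hd1, hd2⟩ := D.generic_dir hz x hx0 hbx
  -- polarization in the direction variable
  have hpol : ∀ s s' ζ η, torsionDiff h a b W ε z s ζ η * sesq (a z) s' η =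
      torsionDiff h a b W ε z s' ζ η * sesq (a z) s η := by
    have h0 : ∀ s s' η, torsionDiff h a b W ε z s η η * sesq (a z) s' η =
        torsionDiff h a b W ε z s' η η * sesq (a z) s η := by
      intro s s' η
      by_cases hη : η = 0
      · subst hη; simp [sesq]
      · obtain ⟨Q, hQ⟩ := hQ η hη
        rw [hQ, hQ]; ring
    intro s s' ζ η
    rw [← sub_eq_zero]
    set S := torsionDiff h a b W ε z with hS
    have hadd : ∀ s v v' t t', S s (v + v') (t + t') = S s v t + S s v t' + S s v' t + S s v' t' := by
      intro s v v' t t'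
      simp only [hS, torsionDiff, alt, sesq_add_left, sesq_add_right, sesq_dmat_add]
      ring
    have hsm : ∀ s v t (c c' : ℂ), S s (c • v) (c' • t) = c * conj c' * S s v t := by
      intro s v t c c'
      simp only [hS, torsionDiff, alt, sesq_smul_left, sesq_smul_right, sesq_dmat_smul]
      ring
    have hsm1 : ∀ s v t (c : ℂ), S s (c • v) t = c * S s v t := by
      intro s v t c
      have := hsm s v t c 1
      simpa using this
    have hsm2 : ∀ s v t (c : ℂ), S s v (c • t) = conj c * S s v t := by
      intro s v t c
      have := hsm s v t 1 c
      simpa using this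
    -- Replacing η by η + r ζ, the coefficient of r alone changes only the unbarred slot of S. The
    -- other coefficients, in the mixed powers of r and its conjugate, are irrelevant.
    refine coeff_eq_zero
      (c00 := S s η η * sesq (a z) s' η - S s' η η * sesq (a z) s η)
      (c01 := S s η ζ * sesq (a z) s' η + S s η η * sesq (a z) s' ζ
        - S s' η ζ * sesq (a z) s η - S s' η η * sesq (a z) s ζ)
      (c02 := S s η ζ * sesq (a z) s' ζ - S s' η ζ * sesq (a z) s ζ)
      (c11 := S s ζ ζ * sesq (a z) s' η + S s ζ η * sesq (a z) s' ζ
        - S s' ζ ζ * sesq (a z) s η - S s' ζ η * sesq (a z) s ζ)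
      (c12 := S s ζ ζ * sesq (a z) s' ζ - S s' ζ ζ * sesq (a z) s ζ) fun r => ?_
    have := h0 s s' (η + r • ζ)
    rw [hadd, hadd, sesq_add_right, sesq_add_right, hsm, hsm, hsm1, hsm1, hsm2, hsm2,
      sesq_smul_right, sesq_smul_right] at this
    linear_combination this
  refine eq_zero_of_generic hd1 hd2 (g := fun t => torsionDiff h a b W ε z s v t) ?_ ?_ t
  · unfold torsionDiff alt sesq
    fun_prop
  · clear t
    intro η hη1 hη2
    rw [← sesq_eq_linF] at hη2
    have hη2' : sesq (a z) x η ≠ 0 := by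
      rw [← (D.pos_a hz).conj_sesq]; simpa using hη2
    have haW : sesq (a z) (W z) η = (1 + κ) * conj (linF (b z) η) := by
      rw [← (D.pos_a hz).conj_sesq, D.sesq_a hz, D.h_wind z hz, hκe, Complex.conj_ofReal]
      simp only [map_mul, map_add, map_inv₀, Complex.conj_ofReal]
      field_simp
    have hcb : conj (linF (b z) η) ≠ 0 := by simpa using hη1
    -- symmetrized relation
    have hsym : ∀ s v, torsionDiff h a b W ε z s v η + torsionDiff h a b W ε z v s η =
        -((ε z : ℂ)⁻¹ * (linF (b z) s * alt h z (W z) v η + linF (b z) v * alt h z (W z) s η)) := by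
      intro s v
      unfold torsionDiff alt
      ring
    have hWW : alt h z (W z) (W z) η = 0 := by unfold alt; ring
    -- The symmetrized relation kills S(W, W, η). Proportionality then kills S(s, W, η), because
    -- a(W, η̄) ≠ 0.
    have h1 : ∀ s, torsionDiff h a b W ε z s (W z) η = 0 := by
      intro s
      have e1 := hsym (W z) (W z)
      rw [hWW] at e1
      have e2 : torsionDiff h a b W ε z (W z) (W z) η = 0 := by linear_combination e1 / 2
      have e3 := hpol s (W z) (W z) η
      rw [e2, haW, zero_mul] at e3
      exact (mul_eq_zero.mp e3).resolve_right (mul_ne_zero hκ1 hcb)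
    -- Symmetrizing at (W, v) and at (v, v) gives S(v, v) = (b(v)/κ) S(W, v), and proportionality
    -- rewrites S(W, v) through S(x, v).
    have h2 : ∀ v, (1 + κ) * conj (linF (b z) η) * torsionDiff h a b W ε z v v η =
        (1 + κ) * conj (linF (b z) η) * (linF (b z) v * (1 + κ) / κ * conj (linF (b z) η)) *
          (torsionDiff h a b W ε z x v η / sesq (a z) x η) := by
      intro v
      have e1 := hsym (W z) v
      rw [h1, hWW, hκe] at e1
      have e2 := hsym v v
      have e3 := hpol x (W z) v η
      rw [haW] at e3
      have e4 : torsionDiff h a b W ε z v v η = linF (b z) v / κ *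
          torsionDiff h a b W ε z (W z) v η := by
        field_simp
        field_simp at e1 e2
        refine mul_left_cancel₀ hε ?_
        linear_combination κ * e2 - linF (b z) v * e1
      rw [e4]
      field_simp
      linear_combination -linF (b z) v * e3
    -- Proportionality also gives S(v, v) a(x, η̄) = S(x, v) a(v, η̄). Comparing the two values
    -- leaves a product of two linear forms in v. The second factor is nonzero at x, so the first
    -- vanishes identically.
    have h3 : ∀ v, (torsionDiff h a b W ε z x v η) *
        (κ * sesq (a z) v η - linF (b z) v * (1 + κ) * conj (linF (b z) η)) = 0 := by
      intro v
      have e1 := h2 v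
      have e2 := hpol x v v η
      have e3 := mul_left_cancel₀ (mul_ne_zero hκ1 hcb) ((e1.trans (mul_assoc _ _ _)))
      field_simp at e3
      linear_combination κ * e2 + e3
    have h4 : ∀ v, torsionDiff h a b W ε z x v η = 0 := by
      have hadd : ∀ v v', torsionDiff h a b W ε z x (v + v') η =
          torsionDiff h a b W ε z x v η + torsionDiff h a b W ε z x v' η := by
        intro v v'
        simp only [torsionDiff, alt, sesq_add_left, sesq_dmat_add]
        ring
      have hxx : torsionDiff h a b W ε z x x η = 0 := by
        have := h3 x
        rw [hbx] at this
        refine (mul_eq_zero.mp this).resolve_right ?_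
        simpa using ⟨hκ.ne', hη2'⟩
      intro v
      by_cases hv : κ * sesq (a z) v η - linF (b z) v * (1 + κ) * conj (linF (b z) η) = 0
      · have := h3 (v + x)
        rw [hadd, hxx, add_zero] at this
        refine (mul_eq_zero.mp this).resolve_right ?_
        rw [sesq_add_left, linF_add, hbx, add_zero]
        have : κ * (sesq (a z) v η + sesq (a z) x η) - linF (b z) v * (1 + κ) *
            conj (linF (b z) η) = κ * sesq (a z) x η := by linear_combination hv
        rw [this]
        exact mul_ne_zero hκ0 hη2'
      · exact (mul_eq_zero.mp (h3 v)).resolve_right hv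
    have := hpol s x v η
    rw [h4, zero_mul] at this
    exact (mul_eq_zero.mp this).resolve_right hη2'

/-- Symmetrizing S = 0 in its first two slots removes both alternations and leaves b(s) T(W, v) +
b(v) T(W, s) = 0 for the torsion T of h. Setting s = W suffices. -/
theorem alt_wind_eq_zero (hS : ∀ s v t, torsionDiff h a b W ε z s v t = 0) (v t : Fin n → ℂ) :
    alt h z (W z) v t = 0 := by
  obtain ⟨κ, hκ, hκe⟩ := D.exists_kappa hz
  have hκ0 : (κ : ℂ) ≠ 0 := by exact_mod_cast hκ.ne'
  have hε := D.eps_ne hz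
  have e1 : ∀ s v t, linF (b z) s * alt h z (W z) v t + linF (b z) v * alt h z (W z) s t = 0 := by
    intro s v t
    have h1 := hS s v t
    have h2 := hS v s t
    unfold torsionDiff at h1 h2
    have h3 : (ε z : ℂ)⁻¹ * (linF (b z) s * alt h z (W z) v t + linF (b z) v * alt h z (W z) s t)
        = 0 := by
      unfold alt at h1 h2 ⊢
      linear_combination -h1 - h2
    exact (mul_eq_zero.mp h3).resolve_left (inv_ne_zero hε)
  have h1 := e1 (W z) v t
  have h2 := e1 (W z) (W z) t
  rw [hκe] at h1 h2
  have h3 : alt h z (W z) (W z) t = 0 := by unfold alt; ring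
  rw [h3, mul_zero, add_zero] at h1
  exact (mul_eq_zero.mp h1).resolve_left hκ0

theorem alt_a_eq (hS : ∀ s v t, torsionDiff h a b W ε z s v t = 0) (u v t : Fin n → ℂ) :
    alt a z u v t = (ε z : ℂ)⁻¹ * alt h z u v t := by
  have h1 := hS u v t
  unfold torsionDiff at h1
  rw [D.alt_wind_eq_zero hz hS] at h1
  linear_combination h1

end LocalNav

/-! ### Recurrence of b̄ and the resulting comparison of sprays -/

/-- The `(1,0)`-differential of the conjugate of a form: `∂_u b̄ (t̄)`. -/
def dconj (b : (Fin n → ℂ) → Fin n → ℂ) (z u t : Fin n → ℂ) : ℂ :=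
  linF (dvec (fun w i => conj (b w i)) z u) (fun i => conj (t i))

theorem dconj_add_left (b : (Fin n → ℂ) → Fin n → ℂ) (z u u' t : Fin n → ℂ) :
    dconj b z (u + u') t = dconj b z u t + dconj b z u' t := linF_dvec_add _ _ _ _ _

theorem dconj_add_right (b : (Fin n → ℂ) → Fin n → ℂ) (z u t t' : Fin n → ℂ) :
    dconj b z u (t + t') = dconj b z u t + dconj b z u t' := by
  unfold dconj
  rw [← linF_add]; congr 1; ext i; simp

theorem dconj_smul_right (b : (Fin n → ℂ) → Fin n → ℂ) (z : Fin n → ℂ) (c : ℂ)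
    (u t : Fin n → ℂ) : dconj b z u (c • t) = conj c * dconj b z u t := by
  unfold dconj
  rw [← linF_smul]; congr 1; ext i; simp

/-- The infinitesimal form of the generalized Berwald condition for `α + |β|` at the point `z`:
`b̄(t̄) (∂_ξ b(ξ) - 2 b(G_a(ξ))) + β(ξ) ∂_ξ b̄(t̄) = 0`. -/
def BerwaldAt (a : (Fin n → ℂ) → Fin n → Fin n → ℂ) (b W : (Fin n → ℂ) → Fin n → ℂ)
    (z : Fin n → ℂ) : Prop :=
  ∀ ξ t, conj (linF (b z) t) * (linF (dvec b z ξ) ξ -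
    sesq (dmat a z ξ) ξ (W z) / (1 + linF (b z) (W z))) + linF (b z) ξ * dconj b z ξ t = 0

namespace LocalNav

variable {T : Set (Fin n → ℂ)} {h a : (Fin n → ℂ) → Fin n → Fin n → ℂ}
  {b W : (Fin n → ℂ) → Fin n → ℂ} {ε : (Fin n → ℂ) → ℝ} (D : LocalNav T h a b W ε)
  {z : Fin n → ℂ} (hz : z ∈ T)
include D hz

theorem wind_form_ne : linF (b z) (W z) ≠ 0 := by
  obtain ⟨κ, hκ, hκe⟩ := D.exists_kappa hz
  rw [hκe]; exact_mod_cast hκ.ne'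

theorem one_add_wind_form_ne : 1 + linF (b z) (W z) ≠ 0 := by
  obtain ⟨κ, hκ, hκe⟩ := D.exists_kappa hz
  rw [hκe]; exact_mod_cast (by linarith : (1 + κ : ℝ) ≠ 0)

theorem conj_wind_form : conj (linF (b z) (W z)) = linF (b z) (W z) := by
  obtain ⟨κ, hκ, hκe⟩ := D.exists_kappa hz
  rw [hκe, Complex.conj_ofReal]

/-- Pairing with W by a also reads off b, up to the invertible factor 1 + b(W). -/
theorem sesq_a_wind (v : Fin n → ℂ) :
    sesq (a z) v (W z) = (1 + linF (b z) (W z)) * linF (b z) v := by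
  have := D.eps_ne hz
  rw [D.sesq_a hz, D.h_wind z hz, D.conj_wind_form hz]
  field_simp

/-- The conjugate form is recurrent: `∂_u b̄ = τ(u) b̄`. -/
theorem exists_recurrence (hB : BerwaldAt a b W z) : ∃ τ : (Fin n → ℂ) → ℂ,
    (∀ u v, τ (u + v) = τ u + τ v) ∧ (∀ u t, dconj b z u t = τ u * conj (linF (b z) t)) ∧
    ∀ ξ, linF (dvec b z ξ) ξ + τ ξ * linF (b z) ξ =
      sesq (dmat a z ξ) ξ (W z) / (1 + linF (b z) (W z)) := by
  have hκ := D.wind_form_ne hz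
  have hc := D.conj_wind_form hz
  have h2 : ∀ ξ, linF (dvec b z ξ) ξ - sesq (dmat a z ξ) ξ (W z) / (1 + linF (b z) (W z)) =
      -(linF (b z) ξ * (dconj b z ξ (W z) / linF (b z) (W z))) := by
    intro ξ
    have h1 := hB ξ (W z)
    rw [hc] at h1
    rw [← mul_div_assoc, ← neg_div, eq_div_iff hκ]
    linear_combination h1
  -- The factor τ is forced by the Berwald identity at t = W.
  refine ⟨fun u => dconj b z u (W z) / linF (b z) (W z), fun u v => ?_, fun u t => ?_, fun ξ => ?_⟩
  · simp only [dconj_add_left, add_div]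
  · have hy : ∀ ξ, linF (b z) ξ * (dconj b z ξ t -
        dconj b z ξ (W z) / linF (b z) (W z) * conj (linF (b z) t)) = 0 := by
      intro ξ
      have h1 := hB ξ t
      rw [h2] at h1
      linear_combination h1
    rw [← sub_eq_zero]
    -- The bracket is additive in u and vanishes off the kernel of b. If b(u) = 0, then neither W
    -- nor u + W lies in the kernel, and subtraction gives u.
    by_cases hu : linF (b z) u = 0
    · have h3 := (mul_eq_zero.mp (hy (W z))).resolve_left hκ
      have h4 := hy (u + W z)
      rw [linF_add, hu, zero_add] at h4
      have h5 := (mul_eq_zero.mp h4).resolve_left hκ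
      rw [dconj_add_left, dconj_add_left, add_div] at h5
      linear_combination h5 - h3
    · exact (mul_eq_zero.mp (hy u)).resolve_left hu
  · have := h2 ξ
    linear_combination this

/-- Under the Berwald condition the sprays of `a` and `h` differ by a multiple of the direction. -/
theorem spray_sub (hB : BerwaldAt a b W z) {Φh Φa : (Fin n → ℂ) → (Fin n → ℂ) → ℝ}
    (hh : IsHermNorm T h Φh) (ha : IsHermNorm T a Φa) (η : Fin n → ℂ) :
    (2 : ℂ) • spray Φa z η =
      (2 : ℂ) • spray Φh z η + (ε z * dz (fun w => (ε w : ℂ)⁻¹) z η) • η := by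
  obtain ⟨τ, -, hτ1, hτ2⟩ := D.exists_recurrence hz hB
  have hκ := D.one_add_wind_form_ne hz
  have hε := D.eps_ne hz
  refine (D.pos z hz).ext fun t => ?_
  have h1 := ha.sesq_spray hz η t
  have h2 := ha.sesq_spray hz η (W z)
  rw [D.sesq_a_wind hz] at h2
  have h3 := hτ2 η
  rw [← h2, mul_div_cancel_left₀ _ hκ] at h3
  have h4 := hh.sesq_spray hz η t
  have h5 := hτ1 η t
  unfold dconj at h5
  -- By `h3`, ∂_η b(η) + τ(η) b(η) = b(2G_a), so all b̄(t) terms cancel and only the derivative of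
  -- the conformal factor 1/ε̃ survives.
  rw [D.sesq_a hz, D.sesq_dmat_a hz, h5, ← h4, ← h3] at h1
  rw [sesq_add_left, sesq_smul_left _ (_ * _)]
  generalize dz (fun w => (ε w : ℂ)⁻¹) z η = e at h1 ⊢
  field_simp at h1
  linear_combination h1

theorem dz_eps_inv (u : Fin n → ℂ) :
    dz (fun w => (ε w : ℂ)) z u = -(ε z : ℂ) ^ 2 * dz (fun w => (ε w : ℂ)⁻¹) z u := by
  have hε := D.eps_ne hz
  have hd : DifferentiableAt ℝ (fun w => (ε w : ℂ)) z :=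
    (Complex.ofRealCLM.contDiff.contDiffAt.comp z (D.smooth_eps z hz)).differentiableAt (by simp)
  have h1 : (fun w => (ε w : ℂ) * (ε w : ℂ)⁻¹) =ᶠ[nhds z] fun _ => 1 := by
    filter_upwards [D.isOpen.mem_nhds hz] with w hw
    exact mul_inv_cancel₀ (D.eps_ne hw)
  have h2 := dz_congr h1 u
  rw [dz_mul hd (D.diff_epsInv hz)] at h2
  have h3 : dz (fun _ : Fin n → ℂ => (1 : ℂ)) z u = 0 := by
    rw [(HasWirt.const 1).dz_eq]; simp
  rw [h3] at h2
  generalize dz (fun w => (ε w : ℂ)⁻¹) z u = e at h2 ⊢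
  field_simp at h2
  linear_combination h2

/-! ### Consequences of a vanishing deviation form -/

section Torsion

variable (hS : ∀ s v t, torsionDiff h a b W ε z s v t = 0)
  {τ : (Fin n → ℂ) → ℂ} (hτ1 : ∀ u t, dconj b z u t = τ u * conj (linF (b z) t))
include hS hτ1

/-- Since the torsion of a is that of h over ε̃, expanding a = h/ε̃ + b ⊗ b̄ leaves only the terms
where 1/ε̃, b or b̄ is differentiated. Recurrence makes the last two proportional to b̄(t). -/
theorem wedge_eq_zero (u v t : Fin n → ℂ) :
    dz (fun w => (ε w : ℂ)⁻¹) z u * sesq (h z) v t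
      - dz (fun w => (ε w : ℂ)⁻¹) z v * sesq (h z) u t
      + conj (linF (b z) t) * (linF (dvec b z u) v - linF (dvec b z v) u
        + τ u * linF (b z) v - τ v * linF (b z) u) = 0 := by
  have h1 := D.alt_a_eq hz hS u v t
  have h2 := hτ1 u t
  have h3 := hτ1 v t
  unfold dconj at h2 h3
  unfold alt at h1
  rw [D.sesq_dmat_a hz, D.sesq_dmat_a hz, h2, h3] at h1
  linear_combination h1

/-- For x in the kernel of b, hence h-orthogonal to W, the triple (x, W, x) isolates ∂_W(1/ε̃) h(x,
x̄). -/
theorem dz_epsInv_wind (hn : 2 ≤ n) : dz (fun w => (ε w : ℂ)⁻¹) z (W z) = 0 := by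
  obtain ⟨x, hx0, hbx⟩ := exists_ker hn (b z)
  have h1 := D.wedge_eq_zero hz hS hτ1 x (W z) x
  have h2 : sesq (h z) (W z) x = 0 := by
    rw [← (D.pos z hz).conj_sesq, D.h_wind z hz, hbx]; simp
  rw [h2, hbx, map_zero, zero_mul, mul_zero, zero_sub, add_zero, neg_eq_zero] at h1
  exact (mul_eq_zero.mp h1).resolve_right ((D.pos z hz).sesq_self_ne hx0)

theorem curl_wind (hn : 2 ≤ n) (u : Fin n → ℂ) :
    linF (dvec b z u) (W z) - linF (dvec b z (W z)) u + τ u * linF (b z) (W z)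
      - τ (W z) * linF (b z) u = -(ε z * dz (fun w => (ε w : ℂ)⁻¹) z u) := by
  have h1 := D.wedge_eq_zero hz hS hτ1 u (W z) (W z)
  have hκ := D.wind_form_ne hz
  rw [D.dz_epsInv_wind hz hS hτ1 hn, D.h_wind z hz, D.conj_wind_form hz] at h1
  refine mul_left_cancel₀ hκ ?_
  linear_combination h1

end Torsion

theorem dz_eps_wind (hn : 2 ≤ n) (hB : BerwaldAt a b W z)
    (hS : ∀ s v t, torsionDiff h a b W ε z s v t = 0) : dz (fun w => (ε w : ℂ)) z (W z) = 0 := by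
  obtain ⟨τ, -, hτ1, -⟩ := D.exists_recurrence hz hB
  rw [D.dz_eps_inv hz, D.dz_epsInv_wind hz hS hτ1 hn, mul_zero]

theorem alt_a_wind (hS : ∀ s v t, torsionDiff h a b W ε z s v t = 0) (v t : Fin n → ℂ) :
    alt a z (W z) v t = 0 := by
  rw [D.alt_a_eq hz hS, D.alt_wind_eq_zero hz hS, mul_zero]

/-- This is the conjugate of the Ω identity. The term b(N W) is a symmetrized derivative of b plus
τ-terms. Subtracting the remaining terms of Ω leaves half of the curl of b along W, which
`curl_wind` evaluates. -/
theorem nonlinConn_wind (hn : 2 ≤ n) (hB : BerwaldAt a b W z)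
    (hS : ∀ s v t, torsionDiff h a b W ε z s v t = 0) {Φ : (Fin n → ℂ) → (Fin n → ℂ) → ℝ}
    (ha : IsHermNorm T a Φ) (η : Fin n → ℂ) (hη : linF (b z) η ≠ 0) :
    linF (b z) (fun s => ∑ m, nonlinConn Φ z η s m * W z m) - linF (dvec b z (W z)) η
      - (linF (b z) η / conj (linF (b z) η)) * dconj b z (W z) η =
      1 / (2 * ε z) * dz (fun w => (ε w : ℂ)) z η := by
  obtain ⟨τ, hτ0, hτ1, hτ2⟩ := D.exists_recurrence hz hB
  have hκ := D.one_add_wind_form_ne hz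
  have hε := D.eps_ne hz
  have hη' : conj (linF (b z) η) ≠ 0 := by simpa using hη
  have h1 := ha.sesq_nonlinConn hz η (W z) (W z)
  rw [D.sesq_a_wind hz] at h1
  have h2 := D.alt_a_wind hz hS η (W z)
  unfold alt at h2
  have h3 := hτ2 (W z + η)
  have h4 := hτ2 (W z)
  have h5 := hτ2 η
  simp only [hτ0, linF_add, linF_dvec_add, sesq_dmat_add, sesq_add_left] at h3
  rw [eq_div_iff hκ] at h3 h4 h5
  have h6 := D.curl_wind hz hS hτ1 hn η
  rw [hτ1, D.dz_eps_inv hz]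
  -- Polarizing the recurrence identity at W + η produces ∂_W a(η, W̄) + ∂_η a(W, W̄). The two
  -- summands are equal because W annihilates the torsion of a, whence the factor 1/2.
  have h7 : linF (b z) (fun s => ∑ m, nonlinConn Φ z η s m * W z m) = (1 / 2) *
      (linF (dvec b z (W z)) η + linF (dvec b z η) (W z) + τ (W z) * linF (b z) η
        + τ η * linF (b z) (W z)) := by
    refine mul_left_cancel₀ hκ ?_
    linear_combination h1 + (1 / 2) * h2 - (1 / 2) * h3 + (1 / 2) * h4 + (1 / 2) * h5
  rw [h7]
  generalize dz (fun w => (ε w : ℂ)⁻¹) z η = e at h6 ⊢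
  field_simp
  linear_combination h6

end LocalNav

/-! ### The complex Randers metric `α + |β|` -/

theorem HasWirt.sqrt_re {u : (Fin n → ℂ) → ℂ} {p q z : Fin n → ℂ} (hu : HasWirt u p q z)
    (hre : ∀ᶠ w in nhds z, ((u w).re : ℂ) = u w) (h0 : 0 < (u z).re) :
    HasWirt (fun w => ((Real.sqrt (u w).re : ℝ) : ℂ)) (fun i => p i / (2 * (Real.sqrt (u z).re : ℝ)))
      (fun i => q i / (2 * (Real.sqrt (u z).re : ℝ))) z := by
  have hd : DifferentiableAt ℝ (fun w => (u w).re) z :=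
    Complex.reCLM.differentiableAt.comp z hu.diff
  refine hu.of_sq ?_ ?_ ?_
  · exact Complex.ofRealCLM.differentiableAt.comp z (hd.sqrt h0.ne')
  · filter_upwards [hre, hd.continuousAt.eventually (lt_mem_nhds h0)] with w h1 h2
    rw [← Complex.ofReal_mul, Real.mul_self_sqrt h2.le, h1]
  · exact_mod_cast (Real.sqrt_pos.mpr h0).ne'

theorem HasWirt.norm {u : (Fin n → ℂ) → ℂ} {p q z : Fin n → ℂ} (hu : HasWirt u p q z)
    (h0 : u z ≠ 0) :
    HasWirt (fun w => (‖u w‖ : ℂ)) (fun i => (p i * conj (u z) + u z * conj (q i)) / (2 * ‖u z‖))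
      (fun i => (q i * conj (u z) + u z * conj (p i)) / (2 * ‖u z‖)) z := by
  refine (hu.mul hu.conjugate).of_sq ?_ ?_ ?_
  · exact Complex.ofRealCLM.differentiableAt.comp z (hu.diff.norm ℝ h0)
  · refine Filter.Eventually.of_forall fun w => ?_
    rw [Complex.mul_conj, Complex.normSq_eq_norm_sq]; push_cast; ring
  · exact_mod_cast norm_ne_zero_iff.mpr h0

/-- The fundamental tensor of `α + |β|`. -/
def randersTensor (m : Fin n → Fin n → ℂ) (b ξ : Fin n → ℂ) (i j : Fin n) : ℂ :=
  let α : ℂ := (Real.sqrt (sesq m ξ ξ).re : ℝ)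
  let ν : ℂ := (‖linF b ξ‖ : ℝ)
  (1 + ν / α) * m i j + (1 + α / (2 * ν)) * (b i * conj (b j))
    + (conj (linF b ξ) * (b i * ∑ k, m k j * ξ k)
      + linF b ξ * ((∑ k, m i k * conj (ξ k)) * conj (b j))) / (2 * ν * α)
    - ν / (2 * α ^ 3) * ((∑ k, m i k * conj (ξ k)) * ∑ k, m k j * ξ k)

theorem sesq_randersTensor (m : Fin n → Fin n → ℂ) (b ξ v t : Fin n → ℂ) (α ν : ℂ)
    (hα : α = (Real.sqrt (sesq m ξ ξ).re : ℝ)) (hν : ν = (‖linF b ξ‖ : ℝ)) :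
    sesq (randersTensor m b ξ) v t = (1 + ν / α) * sesq m v t
      + (1 + α / (2 * ν)) * (linF b v * conj (linF b t))
      + (conj (linF b ξ) * (linF b v * sesq m ξ t)
        + linF b ξ * (sesq m v ξ * conj (linF b t))) / (2 * ν * α)
      - ν / (2 * α ^ 3) * (sesq m v ξ * sesq m ξ t) := by
  have h1 : randersTensor m b ξ = fun i j => (((1 + ν / α) * m i j
      + (1 + α / (2 * ν)) * (b i * conj (b j)))
      + (2 * ν * α)⁻¹ * (conj (linF b ξ) * (b i * ∑ k, m k j * ξ k)
        + linF b ξ * ((∑ k, m i k * conj (ξ k)) * conj (b j))))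
      + (-(ν / (2 * α ^ 3))) * ((∑ k, m i k * conj (ξ k)) * ∑ k, m k j * ξ k) := by
    ext i j
    simp only [randersTensor, hα, hν]
    ring
  rw [h1]
  simp only [sesq_add_form, sesq_smul_form, sesq_prod_form, ← conj_linF]
  rw [← sesq_eq_linF_conj, ← sesq_eq_linF, conj_linF b t]
  ring

theorem IsPosHerm.cauchy_schwarz {m : Fin n → Fin n → ℂ} (hm : IsPosHerm m) (v ξ : Fin n → ℂ) :
    ‖sesq m v ξ‖ ^ 2 ≤ (sesq m v v).re * (sesq m ξ ξ).re := by
  by_cases hξ : ξ = 0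
  · subst hξ; simp [sesq]
  have h0 := hm.pos ξ hξ
  -- This is the component of v orthogonal to ξ, scaled by m(ξ, ξ̄) to avoid division.
  have h1 := hm.nonneg ((sesq m ξ ξ) • v + (-sesq m v ξ) • ξ)
  have h2 : sesq m ((sesq m ξ ξ) • v + (-sesq m v ξ) • ξ) ((sesq m ξ ξ) • v + (-sesq m v ξ) • ξ) =
      (((sesq m ξ ξ).re * ((sesq m v v).re * (sesq m ξ ξ).re - ‖sesq m v ξ‖ ^ 2) : ℝ) : ℂ) := by
    simp only [sesq_add_left, sesq_add_right, sesq_smul_left, sesq_smul_right, map_neg,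
      hm.conj_sesq]
    push_cast
    rw [hm.sesq_self, hm.sesq_self, ← Complex.mul_conj', hm.conj_sesq]
    ring
  rw [h2, Complex.ofReal_re] at h1
  have := nonneg_of_mul_nonneg_right h1 h0
  linarith

/-- With V = m(v, v̄), x = |m(v, ξ̄)| and y = |b(v)|, Cauchy-Schwarz gives (x/α)² ≤ V. So the cross
term, at least -y x/α, is absorbed by V + y², and the last negative term is at most half of (ν/α) V.
-/
theorem re_sesq_randersTensor_pos {m : Fin n → Fin n → ℂ} (hm : IsPosHerm m) {b ξ : Fin n → ℂ}
    (hξ : linF b ξ ≠ 0) {v : Fin n → ℂ} (hv : v ≠ 0) :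
    0 < (sesq (randersTensor m b ξ) v v).re := by
  have hξ0 : ξ ≠ 0 := by rintro rfl; simp [linF] at hξ
  set α := Real.sqrt (sesq m ξ ξ).re with hα
  set ν := ‖linF b ξ‖ with hν
  have hα0 : 0 < α := Real.sqrt_pos.mpr (hm.pos ξ hξ0)
  have hα2 : α ^ 2 = (sesq m ξ ξ).re := Real.sq_sqrt (hm.nonneg ξ)
  have hν0 : 0 < ν := norm_pos_iff.mpr hξ
  have hV := hm.pos v hv
  have hcs := hm.cauchy_schwarz v ξ
  rw [← hα2] at hcs
  set V := (sesq m v v).re with hVd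
  set x := ‖sesq m v ξ‖ with hx
  set y := ‖linF b v‖ with hy
  have hx0 : 0 ≤ x := norm_nonneg _
  have hy0 : 0 ≤ y := norm_nonneg _
  have h1 := sesq_randersTensor m b ξ v v α ν rfl rfl
  set c : ℂ := conj (linF b ξ) * (linF b v * sesq m ξ v) with hc
  have hcc : linF b ξ * (sesq m v ξ * conj (linF b v)) = conj c := by
    rw [hc, map_mul, map_mul, hm.conj_sesq, Complex.conj_conj]; ring
  have hcn : ‖c‖ = ν * y * x := by
    rw [hc, norm_mul, norm_mul, RCLike.norm_conj, ← hm.conj_sesq v ξ, RCLike.norm_conj, mul_assoc]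
  have hcr : -(ν * y * x) ≤ c.re := by
    rw [← hcn]; exact (abs_le.mp (Complex.abs_re_le_norm c)).1
  have h2 : sesq (randersTensor m b ξ) v v = (((1 + ν / α) * V + (1 + α / (2 * ν)) * y ^ 2
      + 2 * c.re / (2 * ν * α) - ν / (2 * α ^ 3) * x ^ 2 : ℝ) : ℂ) := by
    rw [h1, hcc, ← hm.conj_sesq v ξ, Complex.mul_conj', Complex.mul_conj', Complex.add_conj,
      ← hm.sesq_self]
    push_cast
    rfl
  rw [h2, Complex.ofReal_re]
  have e1 : 2 * c.re / (2 * ν * α) ≥ -(y * x / α) := by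
    rw [ge_iff_le, ← neg_div, div_le_div_iff₀ hα0 (by positivity)]
    nlinarith
  have e2 : ν / (2 * α ^ 3) * x ^ 2 ≤ ν / (2 * α) * V := by
    calc ν / (2 * α ^ 3) * x ^ 2 ≤ ν / (2 * α ^ 3) * (V * α ^ 2) :=
          mul_le_mul_of_nonneg_left hcs (by positivity)
      _ = ν / (2 * α) * V := by field_simp
  have e3 : (x / α) ^ 2 ≤ V := by
    rw [div_pow, div_le_iff₀ (by positivity)]; exact hcs
  have e4 : y * x / α = y * (x / α) := by ring
  have e5 : 0 ≤ ν / (2 * α) * V := by positivity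
  have e6 : ν / α * V = 2 * (ν / (2 * α) * V) := by field_simp
  have e7 : 0 ≤ α / (2 * ν) * y ^ 2 := by positivity
  have e8 : 0 ≤ (y - x / α) ^ 2 := sq_nonneg _
  nlinarith [sq_nonneg y, sq_nonneg (x / α)]

/-- `Φ = α + |β|` over the open set `T`. -/
def IsRanders (T : Set (Fin n → ℂ)) (a : (Fin n → ℂ) → Fin n → Fin n → ℂ)
    (b : (Fin n → ℂ) → Fin n → ℂ) (Φ : (Fin n → ℂ) → (Fin n → ℂ) → ℝ) : Prop :=
  ∀ z ∈ T, ∀ η, Φ z η = Real.sqrt (sesq (a z) η η).re + ‖linF (b z) η‖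

theorem fundTensor_randers {m : Fin n → Fin n → ℂ} (hm : IsPosHerm m) {b : Fin n → ℂ}
    {Φ : (Fin n → ℂ) → (Fin n → ℂ) → ℝ} {z : Fin n → ℂ}
    (hΦ : ∀ η, Φ z η = Real.sqrt (sesq m η η).re + ‖linF b η‖) {ξ : Fin n → ℂ}
    (hξ : linF b ξ ≠ 0) (i j : Fin n) :
    fundTensor Φ z ξ i j = randersTensor m b ξ i j := by
  have hne : ∀ ζ, linF b ζ ≠ 0 → ζ ≠ 0 := by rintro ζ h rfl; simp [linF] at h
  have hα : ∀ ζ, linF b ζ ≠ 0 → HasWirt (fun w => ((Real.sqrt (sesq m w w).re : ℝ) : ℂ))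
      (fun i => (∑ k, m i k * conj (ζ k)) / (2 * (Real.sqrt (sesq m ζ ζ).re : ℝ)))
      (fun j => (∑ k, m k j * ζ k) / (2 * (Real.sqrt (sesq m ζ ζ).re : ℝ))) ζ := fun ζ hζ =>
    (hasWirt_sesq_self m ζ).sqrt_re (Filter.Eventually.of_forall hm.sesq_self) (hm.pos ζ (hne ζ hζ))
  have hν : ∀ ζ, linF b ζ ≠ 0 → HasWirt (fun w => (‖linF b w‖ : ℂ))
      (fun i => b i * conj (linF b ζ) / (2 * ‖linF b ζ‖))
      (fun j => linF b ζ * conj (b j) / (2 * ‖linF b ζ‖)) ζ := fun ζ hζ =>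
    ((hasWirt_linF b ζ).norm hζ).congr_val (fun i => by simp) (fun i => by simp)
  have hopen : IsOpen {ζ : Fin n → ℂ | linF b ζ ≠ 0} := by
    refine isOpen_ne_fun ?_ continuous_const
    unfold linF; fun_prop
  have h1 : (fun ζ => ((Φ z ζ ^ 2 : ℝ) : ℂ)) = fun ζ =>
      (((Real.sqrt (sesq m ζ ζ).re : ℝ) : ℂ) + (‖linF b ζ‖ : ℂ)) *
        (((Real.sqrt (sesq m ζ ζ).re : ℝ) : ℂ) + (‖linF b ζ‖ : ℂ)) := by
    ext ζ; rw [hΦ]; push_cast; ring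
  have hpos : ∀ ζ, linF b ζ ≠ 0 → ((Real.sqrt (sesq m ζ ζ).re : ℝ) : ℂ) ≠ 0 := fun ζ hζ => by
    exact_mod_cast (Real.sqrt_pos.mpr (hm.pos ζ (hne ζ hζ))).ne'
  have hposν : ∀ ζ, linF b ζ ≠ 0 → (‖linF b ζ‖ : ℂ) ≠ 0 := fun ζ hζ => by
    exact_mod_cast norm_ne_zero_iff.mpr hζ
  -- The second derivative needs the first one on a neighbourhood, which is available because β ≠ 0
  -- is an open condition.
  have h2 : (fun ξ => wirtBar j (fun ζ => ((Φ z ζ ^ 2 : ℝ) : ℂ)) ξ) =ᶠ[nhds ξ] fun ζ =>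
      (((Real.sqrt (sesq m ζ ζ).re : ℝ) : ℂ) + (‖linF b ζ‖ : ℂ)) *
        (linF (fun k => m k j) ζ / ((Real.sqrt (sesq m ζ ζ).re : ℝ) : ℂ)
          + linF b ζ * conj (b j) / (‖linF b ζ‖ : ℂ)) := by
    filter_upwards [hopen.mem_nhds hξ] with ζ hζ
    have h3 := ((hα ζ hζ).add (hν ζ hζ)).mul ((hα ζ hζ).add (hν ζ hζ))
    rw [h1, h3.bar_eq, show linF (fun k => m k j) ζ = ∑ k, m k j * ζ k from rfl]
    have := hpos ζ hζ
    have := hposν ζ hζ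
    field_simp
    ring
  have h4 := ((hα ξ hξ).add (hν ξ hξ)).mul
    (((hasWirt_linF (fun k => m k j) ξ).div (hα ξ hξ) (hpos ξ hξ)).add
      (((hasWirt_linF b ξ).mul_const (conj (b j))).div (hν ξ hξ) (hposν ξ hξ)))
  unfold fundTensor
  rw [Matrix.of_apply, wirt_congr h2, h4.wirt_eq]
  have e1 := hpos ξ hξ
  have e2 := hposν ξ hξ
  have e3 : linF b ξ * conj (linF b ξ) = (‖linF b ξ‖ : ℂ) ^ 2 := Complex.mul_conj' _
  simp only [randersTensor, linF] at *
  generalize ((Real.sqrt (sesq m ξ ξ).re : ℝ) : ℂ) = α at *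
  generalize ((‖∑ i, b i * ξ i‖ : ℝ) : ℂ) = ν at *
  generalize (∑ i, b i * ξ i) = β at *
  generalize (∑ k, m k j * ξ k) = A at *
  generalize (∑ k, m i k * conj (ξ k)) = A' at *
  generalize conj β = β' at *
  field_simp
  linear_combination (-α ^ 4 * b i * conj (b j)) * e3

/-! ### Regularity of the spray -/

theorem differentiableAt_det {E ι : Type*} [NormedAddCommGroup E] [NormedSpace ℝ E] [Fintype ι]
    [DecidableEq ι] {A : E → Matrix ι ι ℂ} {x : E}
    (hA : ∀ i j, DifferentiableAt ℝ (fun y => A y i j) x) :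
    DifferentiableAt ℝ (fun y => (A y).det) x := by
  simp only [Matrix.det_apply']
  fun_prop

theorem differentiableAt_inv_apply {E ι : Type*} [NormedAddCommGroup E] [NormedSpace ℝ E]
    [Fintype ι] [DecidableEq ι] {A : E → Matrix ι ι ℂ} {x : E}
    (hA : ∀ i j, DifferentiableAt ℝ (fun y => A y i j) x) (hdet : IsUnit (A x).det) (i j : ι) :
    DifferentiableAt ℝ (fun y => (A y)⁻¹ i j) x := by
  have h1 : DifferentiableAt ℝ (fun y => ((A y).det)⁻¹) x :=
    (differentiableAt_det hA).fun_inv hdet.ne_zero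
  have h2 : DifferentiableAt ℝ (fun y => (A y).adjugate i j) x := by
    simp only [Matrix.adjugate_apply]
    refine differentiableAt_det fun k l => ?_
    simp only [Matrix.updateRow_apply]
    by_cases hk : k = j
    · simp [hk]
    · simpa [hk] using hA k l
  simp only [Matrix.inv_def, Ring.inverse_eq_inv', Matrix.smul_apply, smul_eq_mul]
  exact h1.fun_mul h2

theorem contDiffAt_sesq {E : Type*} [NormedAddCommGroup E] [NormedSpace ℝ E] {k : WithTop ℕ∞}
    {m : E → Fin n → Fin n → ℂ} {v t : E → Fin n → ℂ} {x : E}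
    (hm : ∀ i j, ContDiffAt ℝ k (fun y => m y i j) x)
    (hv : ∀ i, ContDiffAt ℝ k (fun y => v y i) x) (ht : ∀ i, ContDiffAt ℝ k (fun y => t y i) x) :
    ContDiffAt ℝ k (fun y => sesq (m y) (v y) (t y)) x := by
  unfold sesq
  exact ContDiffAt.sum fun i _ => ContDiffAt.sum fun j _ => ((hm i j).mul (hv i)).mul
    ((Complex.conjCLE : ℂ →L[ℝ] ℂ).contDiff.contDiffAt.comp x (ht j))

theorem contDiffAt_linF {E : Type*} [NormedAddCommGroup E] [NormedSpace ℝ E] {k : WithTop ℕ∞}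
    {b v : E → Fin n → ℂ} {x : E} (hb : ∀ i, ContDiffAt ℝ k (fun y => b y i) x)
    (hv : ∀ i, ContDiffAt ℝ k (fun y => v y i) x) :
    ContDiffAt ℝ k (fun y => linF (b y) (v y)) x := by
  unfold linF
  exact ContDiffAt.sum fun i _ => (hb i).mul (hv i)

theorem ContDiffAt.conjugate {E : Type*} [NormedAddCommGroup E] [NormedSpace ℝ E]
    {k : WithTop ℕ∞} {u : E → ℂ} {x : E} (hu : ContDiffAt ℝ k u x) :
    ContDiffAt ℝ k (fun y => conj (u y)) x :=
  (Complex.conjCLE : ℂ →L[ℝ] ℂ).contDiff.contDiffAt.comp x hu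

theorem ContDiffAt.complex_div {E : Type*} [NormedAddCommGroup E] [NormedSpace ℝ E]
    {k : WithTop ℕ∞} {u v : E → ℂ} {x : E} (hu : ContDiffAt ℝ k u x) (hv : ContDiffAt ℝ k v x)
    (h0 : v x ≠ 0) : ContDiffAt ℝ k (fun y => u y / v y) x := by
  simp only [div_eq_mul_inv]
  exact hu.mul (hv.inv h0)

theorem contDiffAt_sqrt_sesq {E : Type*} [NormedAddCommGroup E] [NormedSpace ℝ E]
    {k : WithTop ℕ∞} {m : E → Fin n → Fin n → ℂ} {v : E → Fin n → ℂ} {x : E}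
    (hm : ∀ i j, ContDiffAt ℝ k (fun y => m y i j) x)
    (hv : ∀ i, ContDiffAt ℝ k (fun y => v y i) x) (h0 : 0 < (sesq (m x) (v x) (v x)).re) :
    ContDiffAt ℝ k (fun y => Real.sqrt (sesq (m y) (v y) (v y)).re) x :=
  (Complex.reCLM.contDiff.contDiffAt.comp x (contDiffAt_sesq hm hv hv)).sqrt h0.ne'

theorem contDiffAt_randersTensor {E : Type*} [NormedAddCommGroup E] [NormedSpace ℝ E]
    {k : WithTop ℕ∞} {m : E → Fin n → Fin n → ℂ} {b v : E → Fin n → ℂ} {x : E}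
    (hm : ∀ i j, ContDiffAt ℝ k (fun y => m y i j) x)
    (hb : ∀ i, ContDiffAt ℝ k (fun y => b y i) x)
    (hv : ∀ i, ContDiffAt ℝ k (fun y => v y i) x) (h0 : 0 < (sesq (m x) (v x) (v x)).re)
    (h1 : linF (b x) (v x) ≠ 0) (i j : Fin n) :
    ContDiffAt ℝ k (fun y => randersTensor (m y) (b y) (v y) i j) x := by
  have hα : ContDiffAt ℝ k
      (fun y => ((Real.sqrt (sesq (m y) (v y) (v y)).re : ℝ) : ℂ)) x :=
    Complex.ofRealCLM.contDiff.contDiffAt.comp x (contDiffAt_sqrt_sesq hm hv h0)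
  have hβ := contDiffAt_linF hb hv
  have hν : ContDiffAt ℝ k (fun y => ((‖linF (b y) (v y)‖ : ℝ) : ℂ)) x :=
    Complex.ofRealCLM.contDiff.contDiffAt.comp x (hβ.norm ℝ h1)
  have hα0 : ((Real.sqrt (sesq (m x) (v x) (v x)).re : ℝ) : ℂ) ≠ 0 := by
    exact_mod_cast (Real.sqrt_pos.mpr h0).ne'
  have hν0 : ((‖linF (b x) (v x)‖ : ℝ) : ℂ) ≠ 0 := by
    exact_mod_cast norm_ne_zero_iff.mpr h1
  have hA : ContDiffAt ℝ k (fun y => ∑ l, m y l j * v y l) x :=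
    ContDiffAt.sum fun l _ => (hm l j).mul (hv l)
  have hA' : ContDiffAt ℝ k (fun y => ∑ l, m y i l * conj (v y l)) x :=
    ContDiffAt.sum fun l _ => (hm i l).mul (ContDiffAt.conjugate (hv l))
  have hβ' := ContDiffAt.conjugate hβ
  have hbj := ContDiffAt.conjugate (hb j)
  have h2 : (2 * ((‖linF (b x) (v x)‖ : ℝ) : ℂ)) ≠ 0 := mul_ne_zero two_ne_zero hν0
  unfold randersTensor
  simp only []
  exact ((((contDiffAt_const.add (ContDiffAt.complex_div hν hα hα0)).mul (hm i j)).add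
    ((contDiffAt_const.add (ContDiffAt.complex_div hα (contDiffAt_const.mul hν) h2)).mul
      ((hb i).mul hbj))).add
    (ContDiffAt.complex_div ((hβ'.mul ((hb i).mul hA)).add (hβ.mul (hA'.mul hbj)))
      ((contDiffAt_const.mul hν).mul hα) (mul_ne_zero h2 hα0))).sub
    ((ContDiffAt.complex_div hν (contDiffAt_const.mul (hα.pow 3))
      (mul_ne_zero two_ne_zero (pow_ne_zero 3 hα0))).mul (hA'.mul hA))

namespace LocalNav

variable {T : Set (Fin n → ℂ)} {h a : (Fin n → ℂ) → Fin n → Fin n → ℂ}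
  {b W : (Fin n → ℂ) → Fin n → ℂ} {ε : (Fin n → ℂ) → ℝ} (D : LocalNav T h a b W ε)
  {Φ : (Fin n → ℂ) → (Fin n → ℂ) → ℝ} (hΦ : IsRanders T a b Φ)
  {z : Fin n → ℂ} (hz : z ∈ T) {ξ : Fin n → ℂ} (hξ : linF (b z) ξ ≠ 0)
include D hz

include hξ in
omit D hz in
theorem ne_zero_of_form_ne : ξ ≠ 0 := by
  rintro rfl; simp [linF] at hξ

include hξ in
theorem eventually_form_ne : ∀ᶠ p : (Fin n → ℂ) × (Fin n → ℂ) in nhds (ξ, z),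
    p.2 ∈ T ∧ linF (b p.2) p.1 ≠ 0 := by
  have h1 : ∀ᶠ p : (Fin n → ℂ) × (Fin n → ℂ) in nhds (ξ, z), p.2 ∈ T :=
    continuous_snd.continuousAt.eventually (D.isOpen.mem_nhds hz)
  have h2 : ContDiffAt ℝ ∞ (fun p : (Fin n → ℂ) × (Fin n → ℂ) => linF (b p.2) p.1) (ξ, z) :=
    contDiffAt_linF (fun i => (D.smooth_b z hz i).comp (ξ, z) contDiffAt_snd)
      (fun i => (contDiff_apply ℝ ℂ i).contDiffAt.comp (ξ, z) contDiffAt_fst)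
  exact h1.and (h2.continuousAt.eventually_ne hξ)

include hΦ hξ

/-- Joint smoothness in position and direction is needed: the spray contains base derivatives of g,
which are later differentiated in the direction. -/
theorem contDiffAt_fundTensor (i j : Fin n) :
    ContDiffAt ℝ ∞ (fun p : (Fin n → ℂ) × (Fin n → ℂ) => fundTensor Φ p.2 p.1 i j) (ξ, z) := by
  have h1 : (fun p : (Fin n → ℂ) × (Fin n → ℂ) => fundTensor Φ p.2 p.1 i j) =ᶠ[nhds (ξ, z)]
      fun p => randersTensor (a p.2) (b p.2) p.1 i j := by
    filter_upwards [D.eventually_form_ne hz hξ] with p hp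
    exact fundTensor_randers (D.pos_a hp.1) (hΦ _ hp.1) hp.2 i j
  refine ContDiffAt.congr_of_eventuallyEq ?_ h1
  exact contDiffAt_randersTensor
    (fun i j => ContDiffAt.comp (g := fun w => a w i j) (ξ, z) (D.smooth_a hz i j) contDiffAt_snd)
    (fun i => ContDiffAt.comp (g := fun w => b w i) (ξ, z) (D.smooth_b z hz i) contDiffAt_snd)
    (fun i => (contDiff_apply ℝ ℂ i).contDiffAt.comp (ξ, z) contDiffAt_fst)
    ((D.pos_a hz).pos ξ (ne_zero_of_form_ne hξ)) hξ i j

theorem isUnit_det_fundTensor : IsUnit (fundTensor Φ z ξ).det := by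
  refine isUnit_det_of_sesq fun v hv h0 => ?_
  have h1 : (fun i j => fundTensor Φ z ξ i j) = randersTensor (a z) (b z) ξ := by
    ext i j; exact fundTensor_randers (D.pos_a hz) (hΦ z hz) hξ i j
  have := re_sesq_randersTensor_pos (D.pos_a hz) hξ hv
  rw [← h1, h0] at this
  simp at this

/-- As `fderiv` is zero by default at points of non-differentiability, a vanishing `wirtBar` yields
holomorphy only together with this real differentiability. -/
theorem differentiableAt_spray (i : Fin n) :
    DifferentiableAt ℝ (fun ζ => spray Φ z ζ i) ξ := by
  have h1 : ∀ i j, DifferentiableAt ℝ (fun ζ => fundTensor Φ z ζ i j) ξ := by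
    intro i j
    have h := (D.contDiffAt_fundTensor hΦ hz hξ i j).comp ξ
      (f := fun ζ : Fin n → ℂ => (ζ, z)) (contDiffAt_id.prodMk contDiffAt_const)
    exact h.differentiableAt (by simp)
  have h2 : ∀ m i, DifferentiableAt ℝ (fun ζ => (fundTensor Φ z ζ)⁻¹ m i) ξ := fun m i => differentiableAt_inv_apply h1 (D.isUnit_det_fundTensor hΦ hz hξ) m i
  have h3 : ∀ l m j, DifferentiableAt ℝ
      (fun ζ => wirt j (fun w => fundTensor Φ w ζ l m) z) ξ := by
    intro l m j
    have h4 : DifferentiableAt ℝ (fun ζ => fderiv ℝ (fun w => fundTensor Φ w ζ l m) z) ξ :=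
      (ContDiffAt.fderiv (n := ∞) (m := 1) (f := fun ζ w => fundTensor Φ w ζ l m)
        (g := fun _ => z) (D.contDiffAt_fundTensor hΦ hz hξ l m) contDiffAt_const
        (by norm_cast)).differentiableAt (by simp)
    have h5 : ∀ v, DifferentiableAt ℝ
        (fun ζ => fderiv ℝ (fun w => fundTensor Φ w ζ l m) z v) ξ :=
      fun v => h4.clm_apply (differentiableAt_const v)
    exact ((h5 _).fun_sub ((h5 _).const_mul _)).const_mul _
  have h6 : ∀ k, DifferentiableAt ℝ (fun ζ : Fin n → ℂ => ζ k) ξ := fun k =>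
    differentiableAt_apply k ξ
  unfold spray nonlinConn
  exact (DifferentiableAt.fun_sum fun j _ => (DifferentiableAt.fun_sum fun m _ =>
    DifferentiableAt.fun_sum fun l _ => ((h2 m i).fun_mul (h3 l m j)).fun_mul (h6 l)).fun_mul
      (h6 j)).const_mul _

/-- Homogeneity gives g(ξ, ξ̄) = F² and g(v, ξ̄) = F (a(v, ξ̄)/α + b(v) β̄/|β|). So the spray
equation paired with ξ̄ compares ∂_ξ(F²) with this linear form at 2G. Dividing by F and clearing α
and |β| gives the identity. -/
theorem spray_euler :
    (‖linF (b z) ξ‖ : ℂ) * (sesq (dmat a z ξ) ξ ξ - sesq (a z) ((2 : ℂ) • spray Φ z ξ) ξ) =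
      -((Real.sqrt (sesq (a z) ξ ξ).re : ℝ) : ℂ) * (conj (linF (b z) ξ) *
        (linF (dvec b z ξ) ξ - linF (b z) ((2 : ℂ) • spray Φ z ξ))
          + linF (b z) ξ * dconj b z ξ ξ) := by
  have hP := D.pos_a hz
  have hξ0 := ne_zero_of_form_ne hξ
  have h1 := sesq_spray (D.isUnit_det_fundTensor hΦ hz hξ) ξ
  have hg : ∀ w ∈ T, linF (b w) ξ ≠ 0 → (fun i j => fundTensor Φ w ξ i j) =
      randersTensor (a w) (b w) ξ := by
    intro w hw hw'
    ext i j; exact fundTensor_randers (D.pos_a hw) (hΦ w hw) hw' i j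
  rw [hg z hz hξ] at h1
  have hdg : ∀ i j, DifferentiableAt ℝ (fun w => fundTensor Φ w ξ i j) z := by
    intro i j
    have h := (D.contDiffAt_fundTensor hΦ hz hξ i j).comp z
      (f := fun w : Fin n → ℂ => (ξ, w)) (contDiffAt_const.prodMk contDiffAt_id)
    exact h.differentiableAt (by simp)
  rw [← dz_sesq hdg] at h1
  have hev : ∀ᶠ w in nhds z, w ∈ T ∧ linF (b w) ξ ≠ 0 :=
    (Continuous.prodMk_right ξ).continuousAt.eventually (D.eventually_form_ne hz hξ)
  have hαs : ContDiffAt ℝ ∞ (fun w => Real.sqrt (sesq (a w) ξ ξ).re) z :=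
    contDiffAt_sqrt_sesq (D.smooth_a hz) (fun i => contDiffAt_const) (hP.pos ξ hξ0)
  have hαd : DifferentiableAt ℝ (fun w => ((Real.sqrt (sesq (a w) ξ ξ).re : ℝ) : ℂ)) z :=
    (Complex.ofRealCLM.contDiff.contDiffAt.comp z hαs).differentiableAt (by simp)
  have hβd := differentiableAt_linF (D.diff_b hz) ξ
  have hνd : DifferentiableAt ℝ (fun w => ((‖linF (b w) ξ‖ : ℝ) : ℂ)) z :=
    Complex.ofRealCLM.differentiableAt.comp z (hβd.norm ℝ hξ)
  have hsq : (fun w => sesq (fun i j => fundTensor Φ w ξ i j) ξ ξ) =ᶠ[nhds z] fun w =>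
      (((Real.sqrt (sesq (a w) ξ ξ).re : ℝ) : ℂ) + ((‖linF (b w) ξ‖ : ℝ) : ℂ)) *
      (((Real.sqrt (sesq (a w) ξ ξ).re : ℝ) : ℂ) + ((‖linF (b w) ξ‖ : ℝ) : ℂ)) := by
    filter_upwards [hev] with w hw
    have hPw := D.pos_a hw.1
    rw [hg w hw.1 hw.2, sesq_randersTensor _ _ _ _ _ _ _ rfl rfl]
    have e1 : (((Real.sqrt (sesq (a w) ξ ξ).re : ℝ) : ℂ)) ^ 2 = sesq (a w) ξ ξ := by
      rw [← Complex.ofReal_pow, Real.sq_sqrt (hPw.nonneg ξ), hPw.sesq_self]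
    have e2 : linF (b w) ξ * conj (linF (b w) ξ) = ((‖linF (b w) ξ‖ : ℝ) : ℂ) ^ 2 :=
      Complex.mul_conj' _
    have e3 : ((Real.sqrt (sesq (a w) ξ ξ).re : ℝ) : ℂ) ≠ 0 := by
      exact_mod_cast (Real.sqrt_pos.mpr (hPw.pos ξ hξ0)).ne'
    have e4 : ((‖linF (b w) ξ‖ : ℝ) : ℂ) ≠ 0 := by exact_mod_cast norm_ne_zero_iff.mpr hw.2
    generalize ((Real.sqrt (sesq (a w) ξ ξ).re : ℝ) : ℂ) = α at *
    rw [← e1]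
    generalize ((‖linF (b w) ξ‖ : ℝ) : ℂ) = ν at *
    generalize linF (b w) ξ = β at *
    generalize conj β = β' at *
    field_simp
    linear_combination (2 * ν + 3 * α) * e2
  rw [dz_congr hsq, dz_mul (hαd.fun_add hνd) (hαd.fun_add hνd), dz_add hαd hνd,
    sesq_randersTensor _ _ _ _ _ _ _ rfl rfl] at h1
  have hA : dz (fun w => sesq (a w) ξ ξ) z ξ =
      2 * ((Real.sqrt (sesq (a z) ξ ξ).re : ℝ) : ℂ) *
        dz (fun w => ((Real.sqrt (sesq (a w) ξ ξ).re : ℝ) : ℂ)) z ξ := by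
    have e : (fun w => sesq (a w) ξ ξ) =ᶠ[nhds z] fun w =>
        ((Real.sqrt (sesq (a w) ξ ξ).re : ℝ) : ℂ) * ((Real.sqrt (sesq (a w) ξ ξ).re : ℝ) : ℂ) := by
      filter_upwards [hev] with w hw
      rw [← Complex.ofReal_mul, Real.mul_self_sqrt ((D.pos_a hw.1).nonneg ξ),
        (D.pos_a hw.1).sesq_self]
    rw [dz_congr e, dz_mul hαd hαd]
    ring
  have hN : conj (linF (b z) ξ) * linF (dvec b z ξ) ξ + linF (b z) ξ * dconj b z ξ ξ =
      2 * ((‖linF (b z) ξ‖ : ℝ) : ℂ) * dz (fun w => ((‖linF (b w) ξ‖ : ℝ) : ℂ)) z ξ := by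
    have e : (fun w => linF (b w) ξ * linF (fun i => conj (b w i)) (fun i => conj (ξ i))) =
        fun w => ((‖linF (b w) ξ‖ : ℝ) : ℂ) * ((‖linF (b w) ξ‖ : ℝ) : ℂ) := by
      ext w
      rw [← conj_linF, Complex.mul_conj']; ring
    have e1 := dz_mul hβd (differentiableAt_linF (D.diff_bconj hz) (fun i => conj (ξ i))) ξ
    rw [e, dz_mul hνd hνd, dz_linF (D.diff_b hz), dz_linF (D.diff_bconj hz), ← conj_linF] at e1
    unfold dconj
    linear_combination -e1
  rw [dz_sesq (D.diff_a hz)] at hA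
  have e1 : (((Real.sqrt (sesq (a z) ξ ξ).re : ℝ) : ℂ)) ^ 2 = sesq (a z) ξ ξ := by
    rw [← Complex.ofReal_pow, Real.sq_sqrt (hP.nonneg ξ), hP.sesq_self]
  have e2 : linF (b z) ξ * conj (linF (b z) ξ) = ((‖linF (b z) ξ‖ : ℝ) : ℂ) ^ 2 :=
    Complex.mul_conj' _
  have e3 : 0 < Real.sqrt (sesq (a z) ξ ξ).re := Real.sqrt_pos.mpr (hP.pos ξ hξ0)
  have e4 : 0 < ‖linF (b z) ξ‖ := norm_pos_iff.mpr hξ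
  have e5 : ((Real.sqrt (sesq (a z) ξ ξ).re : ℝ) : ℂ) + ((‖linF (b z) ξ‖ : ℝ) : ℂ) ≠ 0 := by
    exact_mod_cast (add_pos e3 e4).ne'
  have e3' : ((Real.sqrt (sesq (a z) ξ ξ).re : ℝ) : ℂ) ≠ 0 := by exact_mod_cast e3.ne'
  have e4' : ((‖linF (b z) ξ‖ : ℝ) : ℂ) ≠ 0 := by exact_mod_cast e4.ne'
  generalize dz (fun w => ((Real.sqrt (sesq (a w) ξ ξ).re : ℝ) : ℂ)) z ξ = dα at *
  generalize dz (fun w => ((‖linF (b w) ξ‖ : ℝ) : ℂ)) z ξ = dν at *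
  generalize ((Real.sqrt (sesq (a z) ξ ξ).re : ℝ) : ℂ) = α at *
  rw [← e1] at h1
  generalize ((‖linF (b z) ξ‖ : ℝ) : ℂ) = ν at *
  generalize sesq (a z) ((2 : ℂ) • spray Φ z ξ) ξ = G1 at *
  generalize linF (b z) ((2 : ℂ) • spray Φ z ξ) = G2 at *
  generalize linF (b z) ξ = β at *
  generalize conj β = β' at *
  field_simp at h1
  refine mul_left_cancel₀ e5 ?_
  linear_combination (α + ν) * ν * hA + (α + ν) * α * hN - (1 / 2) * h1 + (1 / 2) * G1 * e2

end LocalNav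

/-! ### Polarization: separating `ξ` from `ξ̄` -/

/-- If `c₀ + c₁ t̄ + c₂ t̄² + c₃ t̄³` vanishes near `0` and the coefficients are holomorphic,
then `c₃(0) = 0`. -/
theorem leading_coeff_eq_zero {c0 c1 c2 c3 : ℂ → ℂ}
    (h0 : ∀ᶠ t in nhds 0, DifferentiableAt ℂ c0 t) (h1 : ∀ᶠ t in nhds 0, DifferentiableAt ℂ c1 t)
    (h2 : ∀ᶠ t in nhds 0, DifferentiableAt ℂ c2 t) (h3 : ∀ᶠ t in nhds 0, DifferentiableAt ℂ c3 t)
    (h : ∀ᶠ t in nhds 0, c0 t + c1 t * conj t + c2 t * conj t ^ 2 + c3 t * conj t ^ 3 = 0) :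
    c3 0 = 0 := by
  obtain ⟨r, hr, hball⟩ := Metric.nhds_basis_closedBall.mem_iff.mp
    (h0.and (h1.and (h2.and (h3.and h))))
  have hr0 : (r : ℂ) ≠ 0 := by exact_mod_cast hr.ne'
  -- On |t| = r the conjugate of t is r²/t. Multiplying the identity by t³ gives a holomorphic
  -- function vanishing on the circle, hence at the centre, where only c3 remains.
  let g : ℂ → ℂ := fun t => t ^ 3 * c0 t + (r : ℂ) ^ 2 * t ^ 2 * c1 t + (r : ℂ) ^ 4 * t * c2 t
    + (r : ℂ) ^ 6 * c3 t
  have hg : DiffContOnCl ℂ g (Metric.ball 0 r) := by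
    refine DifferentiableOn.diffContOnCl fun t ht => ?_
    rw [closure_ball _ hr.ne'] at ht
    obtain ⟨d0, d1, d2, d3, -⟩ := hball ht
    have hd : DifferentiableAt ℂ g t := by
      simp only [g]
      fun_prop
    exact hd.differentiableWithinAt
  have hfr : Set.EqOn g (fun _ => 0) (frontier (Metric.ball 0 r)) := by
    intro t ht
    rw [frontier_ball _ hr.ne'] at ht
    obtain ⟨-, -, -, -, e⟩ := hball (Metric.sphere_subset_closedBall ht)
    have ht' : t * conj t = (r : ℂ) ^ 2 := by
      rw [Complex.mul_conj', ← mem_sphere_zero_iff_norm.mp ht]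
    simp only [g]
    linear_combination t ^ 3 * e - (c1 t * t ^ 2 + c2 t * t * (t * conj t + r ^ 2) + c3 t *
      ((t * conj t) ^ 2 + (t * conj t) * r ^ 2 + r ^ 4)) * ht'
  have := Complex.eqOn_of_eqOn_frontier Metric.isBounded_ball hg diffContOnCl_const hfr
    (Metric.mem_ball_self hr)
  simp only [g] at this
  have h6 : (r : ℂ) ^ 6 * c3 0 = 0 := by linear_combination this
  exact (mul_eq_zero.mp h6).resolve_left (pow_ne_zero 6 hr0)

/-- Polarization of the identity `β β̄ p² = ℓ q²` along a complex line. -/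
theorem mul_sq_eq_of_polarization {β p0 p1 q0 q1 l0 l1 : ℂ → ℂ} {B0 B1 : ℂ}
    (hβ : ∀ᶠ t in nhds 0, DifferentiableAt ℂ β t) (hp0 : ∀ᶠ t in nhds 0, DifferentiableAt ℂ p0 t)
    (hp1 : ∀ᶠ t in nhds 0, DifferentiableAt ℂ p1 t) (hq0 : ∀ᶠ t in nhds 0, DifferentiableAt ℂ q0 t)
    (hq1 : ∀ᶠ t in nhds 0, DifferentiableAt ℂ q1 t) (hl0 : ∀ᶠ t in nhds 0, DifferentiableAt ℂ l0 t)
    (hl1 : ∀ᶠ t in nhds 0, DifferentiableAt ℂ l1 t)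
    (h : ∀ᶠ t in nhds 0, β t * (B0 + conj t * B1) * (p0 t + conj t * p1 t) ^ 2 =
      (l0 t + conj t * l1 t) * (q0 t + conj t * q1 t) ^ 2) :
    β 0 * B1 * p1 0 ^ 2 = l1 0 * q1 0 ^ 2 := by
  rw [← sub_eq_zero]
  refine leading_coeff_eq_zero
    (c0 := fun t => β t * B0 * p0 t ^ 2 - l0 t * q0 t ^ 2)
    (c1 := fun t => β t * (B1 * p0 t ^ 2 + 2 * B0 * p0 t * p1 t)
      - (l1 t * q0 t ^ 2 + 2 * l0 t * q0 t * q1 t))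
    (c2 := fun t => β t * (B0 * p1 t ^ 2 + 2 * B1 * p0 t * p1 t)
      - (l0 t * q1 t ^ 2 + 2 * l1 t * q0 t * q1 t))
    (c3 := fun t => β t * B1 * p1 t ^ 2 - l1 t * q1 t ^ 2) ?_ ?_ ?_ ?_ ?_
  iterate 4
    filter_upwards [hβ, hp0, hp1, hq0, hq1, hl0, hl1] with t _ _ _ _ _ _ _
    fun_prop
  filter_upwards [h] with t ht
  linear_combination ht

/-- Conjugate-linear functionals. -/
structure IsConjLin (f : (Fin n → ℂ) → ℂ) : Prop where
  add : ∀ v w, f (v + w) = f v + f w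
  smul : ∀ (c : ℂ) v, f (c • v) = conj c * f v

/-- Unique factorization for products of linear forms: `β B p² = ℓ q²` with `B`, `ℓ` independent
forces `p = q = 0`. -/
theorem eq_zero_of_mul_sq_eq {p q l B : (Fin n → ℂ) → ℂ} (hp : IsConjLin p) (hq : IsConjLin q)
    (hl : IsConjLin l) (hB : IsConjLin B) {β : ℂ} (hβ : β ≠ 0)
    (h : ∀ s, β * B s * p s ^ 2 = l s * q s ^ 2) {x y : Fin n → ℂ} (hBx : B x = 0) (hlx : l x ≠ 0)
    (hBy : B y ≠ 0) (s : Fin n → ℂ) : p s = 0 ∧ q s = 0 := by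
  -- On the line u + t x the left side is a multiple of the square of conj t, and the right side is
  -- conj t times a square. Three values of t separate the coefficients.
  have key : ∀ u, l u = 0 → B u ≠ 0 → p u = 0 ∧ q u = 0 ∧ p x = 0 ∧ q x = 0 := by
    intro u hlu hBu
    have hpu : p u = 0 := by
      have := h u
      rw [hlu, zero_mul] at this
      simpa [hβ, hBu] using this
    have ht : ∀ t : ℂ, β * B u * (conj t * p x) ^ 2 = conj t * l x * (q u + conj t * q x) ^ 2 := by
      intro t
      have := h (u + t • x)
      rw [hB.add, hB.smul, hp.add, hp.smul, hl.add, hl.smul, hq.add, hq.smul, hBx, hlu, hpu] at this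
      linear_combination this
    have h1 := ht 1
    have h2 := ht (-1)
    have h3 := ht 2
    simp only [map_one, map_neg, map_ofNat] at h1 h2 h3
    have e1 : l x * q u ^ 2 = 0 := by linear_combination -h1 + (1 / 3) * h2 + (1 / 6) * h3
    have e2 : l x * q x ^ 2 = 0 := by
      linear_combination (1 / 2) * h1 + (1 / 6) * h2 - (1 / 6) * h3
    have hqu : q u = 0 := by simpa [hlx] using e1
    have hqx : q x = 0 := by simpa [hlx] using e2
    refine ⟨hpu, hqu, ?_, hqx⟩
    rw [hqu, hqx] at h1
    simpa [hβ, hBu] using h1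
  -- Translation along x moves any s into the kernel of l without changing B, so `key` applies.
  have hproj : ∀ s, ∃ c : ℂ, l (s + c • x) = 0 ∧ B (s + c • x) = B s := by
    intro s
    refine ⟨conj (-l s / l x), ?_, ?_⟩
    · rw [hl.add, hl.smul, Complex.conj_conj, div_mul_cancel₀ _ hlx]; ring
    · rw [hB.add, hB.smul, hBx]; ring
  have key2 : ∀ s, B s ≠ 0 → p s = 0 ∧ q s = 0 := by
    intro s hs
    obtain ⟨c, hc1, hc2⟩ := hproj s
    obtain ⟨k1, k2, k3, k4⟩ := key (s + c • x) hc1 (by rwa [hc2])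
    rw [hp.add, hp.smul, k3, mul_zero, add_zero] at k1
    rw [hq.add, hq.smul, k4, mul_zero, add_zero] at k2
    exact ⟨k1, k2⟩
  by_cases hs : B s = 0
  · obtain ⟨k1, k2⟩ := key2 (s + y) (by rwa [hB.add, hs, zero_add])
    obtain ⟨k3, k4⟩ := key2 y hBy
    rw [hp.add, k3, add_zero] at k1
    rw [hq.add, k4, add_zero] at k2
    exact ⟨k1, k2⟩
  · exact key2 s hs

theorem isConjLin_sesq (m : Fin n → Fin n → ℂ) (v : Fin n → ℂ) : IsConjLin (sesq m v) :=
  ⟨sesq_add_right m v, fun c t => sesq_smul_right m c v t⟩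

theorem isConjLin_conj_linF (b : Fin n → ℂ) : IsConjLin fun t => conj (linF b t) :=
  ⟨fun v w => by rw [linF_add, map_add], fun c v => by rw [linF_smul, map_mul]⟩

theorem isConjLin_dconj (b : (Fin n → ℂ) → Fin n → ℂ) (z u : Fin n → ℂ) :
    IsConjLin (dconj b z u) :=
  ⟨dconj_add_right b z u, fun c t => dconj_smul_right b z c u t⟩

theorem IsConjLin.add_fun {f g : (Fin n → ℂ) → ℂ} (hf : IsConjLin f) (hg : IsConjLin g) :
    IsConjLin fun t => f t + g t :=
  ⟨fun v w => by rw [hf.add, hg.add]; ring, fun c v => by rw [hf.smul, hg.smul]; ring⟩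

theorem IsConjLin.const_mul {f : (Fin n → ℂ) → ℂ} (hf : IsConjLin f) (k : ℂ) :
    IsConjLin fun t => k * f t :=
  ⟨fun v w => by rw [hf.add]; ring, fun c v => by rw [hf.smul]; ring⟩

namespace LocalNav

variable {T : Set (Fin n → ℂ)} {h a : (Fin n → ℂ) → Fin n → Fin n → ℂ}
  {b W : (Fin n → ℂ) → Fin n → ℂ} {ε : (Fin n → ℂ) → ℝ} (D : LocalNav T h a b W ε)
  {Φ : (Fin n → ℂ) → (Fin n → ℂ) → ℝ} (hΦ : IsRanders T a b Φ)
  {z : Fin n → ℂ} (hz : z ∈ T)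
include D hz hΦ

/-- If the spray of `α + |β|` is holomorphic in the direction, the spray equation splits. -/
theorem spray_split (hGB : ∀ η, linF (b z) η ≠ 0 → ∀ i k,
      wirtBar k (fun ξ => spray Φ z ξ i) η = 0) {η : Fin n → ℂ} (hη : linF (b z) η ≠ 0)
    (v : Fin n → ℂ) :
    linF (b z) η * conj (linF (b z) v) *
        (sesq (dmat a z η) η v + -sesq (a z) ((2 : ℂ) • spray Φ z η) v) ^ 2 =
      sesq (a z) η v * ((linF (dvec b z η) η - linF (b z) ((2 : ℂ) • spray Φ z η)) *
        conj (linF (b z) v) + linF (b z) η * dconj b z η v) ^ 2 := by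
  have hhol : ∀ ξ, linF (b z) ξ ≠ 0 → ∀ i, DifferentiableAt ℂ (fun ζ => spray Φ z ζ i) ξ :=
    fun ξ hξ i => differentiableAt_complex_of_wirtBar_eq_zero
      (D.differentiableAt_spray hΦ hz hξ i) (hGB ξ hξ i)
  set p : (Fin n → ℂ) → (Fin n → ℂ) → ℂ := fun ξ s =>
    sesq (dmat a z ξ) ξ s + -sesq (a z) ((2 : ℂ) • spray Φ z ξ) s with hp
  set q : (Fin n → ℂ) → (Fin n → ℂ) → ℂ := fun ξ s =>
    (linF (dvec b z ξ) ξ - linF (b z) ((2 : ℂ) • spray Φ z ξ)) *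
        conj (linF (b z) s) + linF (b z) ξ * dconj b z ξ s with hq
  have hpl : ∀ ξ, IsConjLin (p ξ) := fun ξ =>
    ⟨fun s s' => by simp only [hp, sesq_add_right]; ring,
      fun c s => by simp only [hp, sesq_smul_right]; ring⟩
  have hql : ∀ ξ, IsConjLin (q ξ) := fun ξ =>
    ((isConjLin_conj_linF (b z)).const_mul _).add_fun ((isConjLin_dconj b z ξ).const_mul _)
  have hpd : ∀ s ξ, linF (b z) ξ ≠ 0 → DifferentiableAt ℂ (fun ζ => p ζ s) ξ := by
    intro s ξ hξ
    have := hhol ξ hξ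
    simp only [hp, sesq, dmat, dz, Pi.smul_apply, smul_eq_mul]
    fun_prop
  have hqd : ∀ s ξ, linF (b z) ξ ≠ 0 → DifferentiableAt ℂ (fun ζ => q ζ s) ξ := by
    intro s ξ hξ
    have := hhol ξ hξ
    simp only [hq, linF, dconj, dvec, dz, Pi.smul_apply, smul_eq_mul]
    fun_prop
  have hline : ∀ f : (Fin n → ℂ) → ℂ, (∀ ξ, linF (b z) ξ ≠ 0 → DifferentiableAt ℂ f ξ) →
      ∀ᶠ t in nhds (0 : ℂ), DifferentiableAt ℂ (fun t => f (η + t • v)) t := by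
    intro f hf
    have hc : Continuous fun t : ℂ => linF (b z) (η + t • v) := by
      unfold linF; fun_prop
    filter_upwards [hc.continuousAt.eventually_ne (by simpa using hη : linF (b z) (η + (0 : ℂ) • v) ≠ 0)]
      with t ht
    have : DifferentiableAt ℂ (fun t : ℂ => η + t • v) t := by fun_prop
    exact DifferentiableAt.comp t (hf _ ht) this
  have hbd : ∀ ξ, linF (b z) ξ ≠ 0 → DifferentiableAt ℂ (fun ζ => linF (b z) ζ) ξ := by
    intro ξ _; unfold linF; fun_prop
  have hld : ∀ s ξ, linF (b z) ξ ≠ 0 → DifferentiableAt ℂ (fun ζ => sesq (a z) ζ s) ξ := by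
    intro s ξ _; unfold sesq; fun_prop
  have hβ := hline _ hbd
  have hp0 := hline _ (hpd η)
  have hp1 := hline _ (hpd v)
  have hq0 := hline _ (hqd η)
  have hq1 := hline _ (hqd v)
  have hl0 := hline _ (hld η)
  have hl1 := hline _ (hld v)
  set B0 := conj (linF (b z) η) with hB0
  set B1 := conj (linF (b z) v) with hB1
  have hfin := mul_sq_eq_of_polarization (B0 := B0) (B1 := B1) hβ hp0 hp1 hq0 hq1 hl0 hl1
    (by
      have hc : Continuous fun t : ℂ => linF (b z) (η + t • v) := by
        unfold linF; fun_prop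
      filter_upwards [hc.continuousAt.eventually_ne
        (by simpa using hη : linF (b z) (η + (0 : ℂ) • v) ≠ 0)] with t ht
      have e := D.spray_euler hΦ hz ht
      have hP := D.pos_a hz
      set ξ := η + t • v with hξ
      have e1 : (((Real.sqrt (sesq (a z) ξ ξ).re : ℝ) : ℂ)) ^ 2 = sesq (a z) ξ ξ := by
        rw [← Complex.ofReal_pow, Real.sq_sqrt (hP.nonneg ξ), hP.sesq_self]
      have e2 : linF (b z) ξ * conj (linF (b z) ξ) = ((‖linF (b z) ξ‖ : ℝ) : ℂ) ^ 2 :=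
        Complex.mul_conj' _
      -- Squaring removes the non-polynomial factors α and |β|. Along ξ = η + t v every factor is
      -- then affine in conj t with coefficients holomorphic in t.
      have e3 : linF (b z) ξ * conj (linF (b z) ξ) * p ξ ξ ^ 2 = sesq (a z) ξ ξ * q ξ ξ ^ 2 := by
        rw [e2, ← e1, ← mul_pow, ← mul_pow]
        have e4 : ((‖linF (b z) ξ‖ : ℝ) : ℂ) * p ξ ξ =
            -(((Real.sqrt (sesq (a z) ξ ξ).re : ℝ) : ℂ) * q ξ ξ) := by
          simp only [hp, hq]
          linear_combination e
        rw [e4]; ring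
      have f1 : p ξ ξ = p ξ η + conj t * p ξ v :=
        ((hpl ξ).add η (t • v)).trans (by rw [(hpl ξ).smul])
      have f2 : q ξ ξ = q ξ η + conj t * q ξ v :=
        ((hql ξ).add η (t • v)).trans (by rw [(hql ξ).smul])
      have f3 : sesq (a z) ξ ξ = sesq (a z) ξ η + conj t * sesq (a z) ξ v :=
        (sesq_add_right _ ξ η (t • v)).trans (by rw [sesq_smul_right])
      have f4 : conj (linF (b z) ξ) = B0 + conj t * B1 := by
        rw [hξ, linF_add, linF_smul, map_add, map_mul]
      rwa [f1, f2, f3, f4] at e3)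
  simp only [zero_smul, add_zero] at hfin
  exact hfin

theorem berwaldAt (hn : 2 ≤ n) (hGB : ∀ η, linF (b z) η ≠ 0 → ∀ i k,
      wirtBar k (fun ξ => spray Φ z ξ i) η = 0) : BerwaldAt a b W z := by
  obtain ⟨x, hx0, hbx⟩ := exists_ker hn (b z)
  obtain ⟨hd1, hd2⟩ := D.generic_dir hz x hx0 hbx
  have hκ := D.one_add_wind_form_ne hz
  intro ξ t
  refine eq_zero_of_generic hd1 hd2 (g := fun ξ => conj (linF (b z) t) * (linF (dvec b z ξ) ξ -
    sesq (dmat a z ξ) ξ (W z) / (1 + linF (b z) (W z))) + linF (b z) ξ * dconj b z ξ t) ?_ ?_ ξ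
  · simp only [linF, sesq, dconj, dmat, dvec, dz]
    fun_prop
  · clear ξ
    intro ξ h1 h2
    rw [← sesq_eq_linF] at h2
    -- The vector x in the kernel of b with a(ξ, x̄) ≠ 0 witnesses that the two linear forms are
    -- independent. This is where n ≥ 2 enters.
    have hsplit := eq_zero_of_mul_sq_eq (l := sesq (a z) ξ) (B := fun t => conj (linF (b z) t))
      ((isConjLin_sesq (dmat a z ξ) ξ).add_fun
        (g := fun s => -sesq (a z) ((2 : ℂ) • spray Φ z ξ) s)
        ⟨fun s s' => by rw [sesq_add_right]; ring, fun c s => by rw [sesq_smul_right]; ring⟩)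
      (((isConjLin_conj_linF (b z)).const_mul (linF (dvec b z ξ) ξ -
        linF (b z) ((2 : ℂ) • spray Φ z ξ))).add_fun
        ((isConjLin_dconj b z ξ).const_mul (linF (b z) ξ)))
      (isConjLin_sesq (a z) ξ) (isConjLin_conj_linF (b z)) h1
      (fun s => D.spray_split hΦ hz hGB h1 s) (x := x) (y := W z)
      (by simp [hbx]) h2 (by simpa using D.wind_form_ne hz)
    have e1 := (hsplit (W z)).1
    have e2 := (hsplit t).2
    rw [D.sesq_a_wind hz] at e1
    -- Testing p = 0 against W expresses b(2G) by a alone, so the spray of F disappears from the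
    -- condition q = 0.
    have e3 : sesq (dmat a z ξ) ξ (W z) / (1 + linF (b z) (W z)) =
        linF (b z) ((2 : ℂ) • spray Φ z ξ) := by
      rw [div_eq_iff hκ]
      linear_combination e1
    simp only [e3]
    linear_combination e2

end LocalNav

/-! ### Coordinates on a complex manifold -/

section Coordinates

variable {M : Type*} [TopologicalSpace M] [ChartedSpace (Fin n → ℂ) M]
  {φ : OpenPartialHomeomorph M (Fin n → ℂ)}

theorem mdifferentiable_of_mem_charts (hφ : φ ∈ charts n M) :
    φ.MDifferentiable 𝓘(ℂ, Fin n → ℂ) 𝓘(ℂ, Fin n → ℂ) :=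
  ⟨(contMDiffOn_of_mem_maximalAtlas hφ).mdifferentiableOn (by simp),
    (contMDiffOn_symm_of_mem_maximalAtlas hφ).mdifferentiableOn (by simp)⟩

theorem tangentOf_add (φ : OpenPartialHomeomorph M (Fin n → ℂ)) (z η ζ : Fin n → ℂ) :
    tangentOf φ z (η + ζ) = tangentOf φ z η + tangentOf φ z ζ :=
  map_add (mfderiv 𝓘(ℂ, Fin n → ℂ) 𝓘(ℂ, Fin n → ℂ) φ.symm z) η ζ

theorem tangentOf_smul (φ : OpenPartialHomeomorph M (Fin n → ℂ)) (z : Fin n → ℂ) (c : ℂ)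
    (η : Fin n → ℂ) : tangentOf φ z (c • η) = c • tangentOf φ z η :=
  map_smul (mfderiv 𝓘(ℂ, Fin n → ℂ) 𝓘(ℂ, Fin n → ℂ) φ.symm z) c η

theorem mfderiv_tangentOf (hφ : φ ∈ charts n M) {z : Fin n → ℂ} (hz : z ∈ φ.target)
    (η : Fin n → ℂ) :
    mfderiv 𝓘(ℂ, Fin n → ℂ) 𝓘(ℂ, Fin n → ℂ) φ (φ.symm z) (tangentOf φ z η) = η := by
  have h := (mdifferentiable_of_mem_charts hφ).comp_symm_deriv hz
  exact congrArg (fun L => L η) h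

theorem tangentOf_vecComp (W : ∀ x : M, HolTangent n x) (hφ : φ ∈ charts n M) {z : Fin n → ℂ}
    (hz : z ∈ φ.target) : tangentOf φ z (vecComp W φ z) = W (φ.symm z) := by
  have h := (mdifferentiable_of_mem_charts hφ).symm_comp_deriv (φ.map_target hz)
  have h1 := congrArg (fun L => L (W (φ.symm z))) h
  -- The chain rule uses the base point φ(φ⁻¹ z), equal to z only propositionally. Viewing all
  -- fibres as ℂⁿ permits the replacement.
  have h2 := congrArg (fun y => (mfderiv 𝓘(ℂ, Fin n → ℂ) 𝓘(ℂ, Fin n → ℂ) φ.symm y :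
    (Fin n → ℂ) →L[ℂ] (Fin n → ℂ)) (vecComp W φ z)) (φ.right_inv hz)
  exact h2.symm.trans h1

theorem tangentOf_ne_zero (hφ : φ ∈ charts n M) {z : Fin n → ℂ} (hz : z ∈ φ.target)
    {η : Fin n → ℂ} (hη : η ≠ 0) : tangentOf φ z η ≠ 0 := by
  intro h
  apply hη
  rw [← mfderiv_tangentOf hφ hz η, h]
  exact map_zero _

end Coordinates

section Metric

variable {M : Type*} [TopologicalSpace M] [ChartedSpace (Fin n → ℂ) M]
  {h : ∀ x : M, HolTangent n x → HolTangent n x → ℂ}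

theorem IsHermitianMetric.tangentOf_left (hh : IsHermitianMetric h)
    (φ : OpenPartialHomeomorph M (Fin n → ℂ)) (z η : Fin n → ℂ) (w : HolTangent n (φ.symm z)) :
    h (φ.symm z) (tangentOf φ z η) w = ∑ i, η i * h (φ.symm z) (coordVec φ z i) w :=
  eq_sum_of_linear (f := fun η => h (φ.symm z) (tangentOf φ z η) w)
    (fun v v' => by rw [tangentOf_add, hh.add_left])
    (fun c v => by rw [tangentOf_smul, hh.smul_left]) η

theorem IsHermitianMetric.tangentOf_eq_sesq (hh : IsHermitianMetric h)
    (φ : OpenPartialHomeomorph M (Fin n → ℂ)) (z η ζ : Fin n → ℂ) :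
    h (φ.symm z) (tangentOf φ z η) (tangentOf φ z ζ) = sesq (formComp h φ z) η ζ := by
  rw [hh.tangentOf_left, sesq]
  refine Finset.sum_congr rfl fun i _ => ?_
  rw [← hh.conj_symm, hh.tangentOf_left, map_sum, Finset.mul_sum]
  refine Finset.sum_congr rfl fun j _ => ?_
  rw [map_mul, hh.conj_symm]
  unfold formComp
  ring

theorem IsHermitianMetric.isPosHerm (hh : IsHermitianMetric h)
    {φ : OpenPartialHomeomorph M (Fin n → ℂ)} (hφ : φ ∈ charts n M) {z : Fin n → ℂ}
    (hz : z ∈ φ.target) : IsPosHerm (formComp h φ z) :=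
  ⟨fun _ _ => hh.conj_symm _ _ _, fun v hv => by
    rw [← hh.tangentOf_eq_sesq]; exact hh.pos _ _ (tangentOf_ne_zero hφ hz hv)⟩

end Metric

/-! ### Navigation data read in a chart -/

section Navigation

variable {M : Type*} [TopologicalSpace M] [ChartedSpace (Fin n → ℂ) M]
  {h : ∀ x : M, HolTangent n x → HolTangent n x → ℂ} {f : M → ℝ} {W : ∀ x : M, HolTangent n x}
  (hd : IsNavigationData h f W) {φ : OpenPartialHomeomorph M (Fin n → ℂ)} (hφ : φ ∈ charts n M)
include hd

theorem IsNavigationData.epsT_pos (x : M) : 0 < epsT h f W x := by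
  have h0 := hd.wind_pos x
  have h1 := hd.wind_lt x
  unfold epsT; nlinarith

theorem IsNavigationData.linF_covComp (φ : OpenPartialHomeomorph M (Fin n → ℂ))
    (z η : Fin n → ℂ) :
    linF (covComp (newForm h f W) φ z) η = newForm h f W (φ.symm z) (tangentOf φ z η) := by
  unfold newForm
  rw [hd.metric.tangentOf_left, Finset.sum_div]
  refine Finset.sum_congr rfl fun i _ => ?_
  simp only [covComp]
  ring

theorem IsNavigationData.hnorm_sq (x : M) (v : HolTangent n x) :
    hnorm h x v ^ 2 = (h x v v).re := by
  refine Real.sq_sqrt ?_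
  by_cases hv : v = 0
  · have := hd.metric.smul_left x 0 v v
    rw [zero_smul, zero_mul] at this
    subst hv
    rw [this]; simp
  · exact (hd.metric.pos x v hv).le

include hφ

theorem IsNavigationData.contDiffOn_epsT :
    ContDiffOn ℝ ∞ (fun z => epsT h f W (φ.symm z)) φ.target := by
  intro z hz
  have hn := φ.open_target.mem_nhds hz
  have hf := (hd.smooth_speed φ hφ).contDiffAt hn
  have hW : ∀ i, ContDiffAt ℝ ∞ (fun z => vecComp W φ z i) z := fun i =>
    (contDiff_apply ℝ ℂ i).contDiffAt.comp z ((hd.smooth_wind φ hφ).contDiffAt hn)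
  have hs := contDiffAt_sesq
    (fun i j => (hd.metric.smooth φ hφ i j).contDiffAt hn) hW hW
  have h1 : (fun z => epsT h f W (φ.symm z)) =ᶠ[nhds z] fun z => f (φ.symm z) ^ 2 -
      (sesq (formComp h φ z) (vecComp W φ z) (vecComp W φ z)).re := by
    filter_upwards [hn] with w hw
    unfold epsT
    rw [hd.hnorm_sq, ← hd.metric.tangentOf_eq_sesq, tangentOf_vecComp W hφ hw]
  exact (((hf.pow 2).sub (Complex.reCLM.contDiff.contDiffAt.comp z hs)).congr_of_eventuallyEq
    h1).contDiffWithinAt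

theorem IsNavigationData.newForm_eq {z : Fin n → ℂ} (hz : z ∈ φ.target) (η : Fin n → ℂ) :
    newForm h f W (φ.symm z) (tangentOf φ z η) =
      sesq (formComp h φ z) η (vecComp W φ z) / epsT h f W (φ.symm z) := by
  unfold newForm
  rw [← hd.metric.tangentOf_eq_sesq, tangentOf_vecComp W hφ hz]

/-- Navigation data in a chart. -/
theorem IsNavigationData.localNav : LocalNav φ.target (formComp h φ)
    (formComp (newMetric h f W) φ) (covComp (newForm h f W) φ) (vecComp W φ)
    (fun z => epsT h f W (φ.symm z)) where
  isOpen := φ.open_target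
  smooth_h z hz i j := (hd.metric.smooth φ hφ i j).contDiffAt (φ.open_target.mem_nhds hz)
  smooth_b z hz i := by
    have hn := φ.open_target.mem_nhds hz
    have hW : ∀ i, ContDiffAt ℝ ∞ (fun z => vecComp W φ z i) z := fun i =>
      (contDiff_apply ℝ ℂ i).contDiffAt.comp z ((hd.smooth_wind φ hφ).contDiffAt hn)
    have hs := contDiffAt_sesq (v := fun _ => Pi.single i 1)
      (fun i j => (hd.metric.smooth φ hφ i j).contDiffAt hn) (fun _ => contDiffAt_const) hW
    have he : ContDiffAt ℝ ∞ (fun z => ((epsT h f W (φ.symm z) : ℝ) : ℂ)) z :=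
      Complex.ofRealCLM.contDiff.contDiffAt.comp z ((hd.contDiffOn_epsT hφ).contDiffAt hn)
    refine (ContDiffAt.complex_div hs he (by exact_mod_cast (hd.epsT_pos _).ne')
      ).congr_of_eventuallyEq ?_
    filter_upwards [hn] with w hw
    exact hd.newForm_eq hφ hw (Pi.single i 1)
  smooth_eps z hz := (hd.contDiffOn_epsT hφ).contDiffAt (φ.open_target.mem_nhds hz)
  pos z hz := hd.metric.isPosHerm hφ hz
  eps_pos z _ := hd.epsT_pos _
  wind_ne z hz h0 := by
    have h1 := hd.wind_pos (φ.symm z)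
    rw [hnorm, ← tangentOf_vecComp W hφ hz, hd.metric.tangentOf_eq_sesq, h0] at h1
    simp [sesq] at h1
  a_eq z hz i j := by
    simp only [formComp, newMetric, covComp, newForm, map_div₀, Complex.conj_ofReal]
    ring
  h_wind z hz v := by
    have he : ((epsT h f W (φ.symm z) : ℝ) : ℂ) ≠ 0 := by exact_mod_cast (hd.epsT_pos _).ne'
    rw [hd.linF_covComp, hd.newForm_eq hφ hz, mul_div_cancel₀ _ he]

theorem IsNavigationData.newMetric_tangentOf {z : Fin n → ℂ} (hz : z ∈ φ.target)
    (η ζ : Fin n → ℂ) :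
    newMetric h f W (φ.symm z) (tangentOf φ z η) (tangentOf φ z ζ) =
      sesq (formComp (newMetric h f W) φ z) η ζ := by
  rw [(hd.localNav hφ).sesq_a hz, hd.linF_covComp, hd.linF_covComp, ← hd.metric.tangentOf_eq_sesq]
  simp only [newMetric, newForm, map_div₀, Complex.conj_ofReal]
  ring

theorem IsNavigationData.isHermNorm_h :
    IsHermNorm φ.target (formComp h φ) (inChart (hnorm h) φ) :=
  (hd.localNav hφ).isHermNorm_h fun z _ η => by
    rw [← hd.metric.tangentOf_eq_sesq]; rfl

theorem IsNavigationData.isHermNorm_newMetric :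
    IsHermNorm φ.target (formComp (newMetric h f W) φ) (inChart (hnorm (newMetric h f W)) φ) :=
  (hd.localNav hφ).isHermNorm_a fun z hz η => by
    rw [← hd.newMetric_tangentOf hφ hz]; rfl

theorem IsNavigationData.isRanders : IsRanders φ.target (formComp (newMetric h f W) φ)
    (covComp (newForm h f W) φ) (inChart (randersSolution h f W) φ) := by
  intro z hz η
  unfold inChart
  rw [randersSolution_eq hd, hd.linF_covComp, ← hd.newMetric_tangentOf hφ hz]
  rfl

/-- The Berwald hypothesis speaks only of points of smoothness. Where β ≠ 0 both α and |β| are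
smooth, so it covers every direction needed by the local argument. -/
theorem IsNavigationData.berwaldAt (hn : 2 ≤ n)
    (hGB : IsGeneralizedBerwald (randersSolution h f W)) {z : Fin n → ℂ} (hz : z ∈ φ.target) :
    BerwaldAt (formComp (newMetric h f W) φ) (covComp (newForm h f W) φ) (vecComp W φ) z := by
  have D := hd.localNav hφ
  refine D.berwaldAt (hd.isRanders hφ) hz hn fun η hη i k => ?_
  have hη0 := LocalNav.ne_zero_of_form_ne hη
  refine hGB φ hφ z hz η hη0 ?_ i k
  have hev : (fun p : (Fin n → ℂ) × (Fin n → ℂ) => inChart (randersSolution h f W) φ p.1 p.2)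
      =ᶠ[nhds (z, η)] fun p => Real.sqrt (sesq (formComp (newMetric h f W) φ p.1) p.2 p.2).re +
        ‖linF (covComp (newForm h f W) φ p.1) p.2‖ := by
    filter_upwards [continuous_fst.continuousAt.eventually (φ.open_target.mem_nhds hz)] with p hp
    exact hd.isRanders hφ p.1 hp p.2
  refine ContDiffAt.congr_of_eventuallyEq ?_ hev
  have hv : ∀ i, ContDiffAt ℝ ∞ (fun p : (Fin n → ℂ) × (Fin n → ℂ) => p.2 i) (z, η) := fun i =>
    (contDiff_apply ℝ ℂ i).contDiffAt.comp (z, η) contDiffAt_snd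
  have h1 := contDiffAt_sqrt_sesq (m := fun p : (Fin n → ℂ) × (Fin n → ℂ) =>
    formComp (newMetric h f W) φ p.1) (v := fun p => p.2) (x := (z, η)) (k := ∞)
    (fun i j => ContDiffAt.comp (g := fun w => formComp (newMetric h f W) φ w i j) (z, η)
      (D.smooth_a hz i j) contDiffAt_fst) hv ((D.pos_a hz).pos η hη0)
  have h2 := contDiffAt_linF (b := fun p : (Fin n → ℂ) × (Fin n → ℂ) =>
    covComp (newForm h f W) φ p.1) (v := fun p => p.2) (x := (z, η)) (k := ∞)
    (fun i => ContDiffAt.comp (g := fun w => covComp (newForm h f W) φ w i) (z, η)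
      (D.smooth_b z hz i) contDiffAt_fst) hv
  exact h1.add (h2.norm ℝ hη)

end Navigation

/-! ### The `(1,0)`-differential of a function on a complex manifold -/

theorem dz_eq_fderiv (u : (Fin n → ℂ) → ℂ) (z v : Fin n → ℂ) :
    dz u z v = (1 / 2 : ℂ) * (fderiv ℝ u z v - Complex.I * fderiv ℝ u z (Complex.I • v)) := by
  rw [fderiv_eq_sum_wirt, fderiv_eq_sum_wirt]
  have h1 : ∑ i, wirt i u z * (Complex.I • v) i = Complex.I * dz u z v := by
    simp only [dz, Finset.mul_sum, Pi.smul_apply, smul_eq_mul]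
    exact Finset.sum_congr rfl fun i _ => by ring
  have h2 : ∑ i, wirtBar i u z * conj ((Complex.I • v) i) =
      -Complex.I * ∑ i, wirtBar i u z * conj (v i) := by
    simp only [Finset.mul_sum, Pi.smul_apply, smul_eq_mul, map_mul, Complex.conj_I]
    exact Finset.sum_congr rfl fun i _ => by ring
  rw [h1, h2, show ∑ i, wirt i u z * v i = dz u z v from rfl]
  linear_combination (-(1 / 2 : ℂ) * (∑ i, wirtBar i u z * conj (v i)) +
    (1 / 2 : ℂ) * dz u z v) * Complex.I_sq

/-- Chain rule for the `(1,0)`-differential along a holomorphic map. -/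
theorem dz_comp {u : (Fin n → ℂ) → ℂ} {g : (Fin n → ℂ) → Fin n → ℂ} {z : Fin n → ℂ}
    (hu : DifferentiableAt ℝ u (g z)) (hg : DifferentiableAt ℂ g z) (v : Fin n → ℂ) :
    dz (fun w => u (g w)) z v = dz u (g z) (fderiv ℂ g z v) := by
  have h1 : HasFDerivAt (fun w => u (g w))
      ((fderiv ℝ u (g z)).comp ((fderiv ℂ g z).restrictScalars ℝ)) z :=
    hu.hasFDerivAt.comp z (hg.hasFDerivAt.restrictScalars ℝ)
  rw [dz_eq_fderiv, dz_eq_fderiv, h1.fderiv]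
  simp only [ContinuousLinearMap.comp_apply, ContinuousLinearMap.coe_restrictScalars', map_smul]

theorem contDiffAt_wirt {u : (Fin n → ℂ) → ℂ} {z : Fin n → ℂ} (hu : ContDiffAt ℝ ∞ u z)
    (i : Fin n) : ContDiffAt ℝ ∞ (fun w => wirt i u w) z := by
  have h1 : ContDiffAt ℝ ∞ (fderiv ℝ u) z := hu.fderiv_right (by norm_cast)
  have h2 : ∀ v, ContDiffAt ℝ ∞ (fun w => fderiv ℝ u w v) z := fun v =>
    h1.clm_apply contDiffAt_const
  unfold wirt
  exact contDiffAt_const.mul ((h2 _).sub (contDiffAt_const.mul (h2 _)))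

section Manifold

variable {M : Type*} [TopologicalSpace M] [ChartedSpace (Fin n → ℂ) M]
  [IsManifold 𝓘(ℂ, Fin n → ℂ) ω M]

/-- The `(1,0)`-differential of a smooth function on `M`. -/
theorem exists_dz {u : M → ℂ}
    (hu : ∀ φ ∈ charts n M, ContDiffOn ℝ ∞ (fun z => u (φ.symm z)) φ.target) :
    ∃ P : ∀ x : M, HolTangent n x → ℂ, ∀ φ ∈ charts n M, ∀ z ∈ φ.target, ∀ η,
      P (φ.symm z) (tangentOf φ z η) = dz (fun w => u (φ.symm w)) z η := by
  -- A tangent vector at x is by definition its coordinate vector in the preferred chart at x. The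
  -- chain rule along the holomorphic transition map gives the formula in every other chart.
  refine ⟨fun x v => dz (fun w => u ((chartAt (Fin n → ℂ) x).symm w)) (chartAt (Fin n → ℂ) x x) v,
    fun φ hφ z hz η => ?_⟩
  set ψ := chartAt (Fin n → ℂ) (φ.symm z) with hψ
  have hψm : ψ ∈ charts n M := IsManifold.chart_mem_maximalAtlas _
  have hsrc : φ.symm z ∈ ψ.source := mem_chart_source _ _
  have hmd : MDifferentiableAt 𝓘(ℂ, Fin n → ℂ) 𝓘(ℂ, Fin n → ℂ) φ.symm z :=
    (mdifferentiable_of_mem_charts hφ).mdifferentiableAt_symm hz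
  have hwr : writtenInExtChartAt 𝓘(ℂ, Fin n → ℂ) 𝓘(ℂ, Fin n → ℂ) z φ.symm =
      fun w => ψ (φ.symm w) := rfl
  have hpt : extChartAt 𝓘(ℂ, Fin n → ℂ) z z = z := rfl
  have htan : (tangentOf φ z η : Fin n → ℂ) = fderiv ℂ (fun w => ψ (φ.symm w)) z η := by
    have h1 : fderivWithin ℂ (writtenInExtChartAt 𝓘(ℂ, Fin n → ℂ) 𝓘(ℂ, Fin n → ℂ) z φ.symm)
        (Set.range 𝓘(ℂ, Fin n → ℂ)) (extChartAt 𝓘(ℂ, Fin n → ℂ) z z) =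
        fderiv ℂ (fun w => ψ (φ.symm w)) z := by
      rw [hwr, hpt, modelWithCornersSelf_coe, Set.range_id, fderivWithin_univ]
    exact congrArg (fun L => L η) (hmd.mfderiv.trans h1)
  have hdiff : DifferentiableAt ℂ (fun w => ψ (φ.symm w)) z := by
    have := hmd.differentiableWithinAt_writtenInExtChartAt
    rwa [hwr, hpt, modelWithCornersSelf_coe, Set.range_id, differentiableWithinAt_univ] at this
  have hud : DifferentiableAt ℝ (fun w => u (ψ.symm w)) (ψ (φ.symm z)) :=
    ((hu ψ hψm).contDiffAt (ψ.open_target.mem_nhds (ψ.map_source hsrc))).differentiableAt (by simp)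
  have hev : (fun w => u (φ.symm w)) =ᶠ[nhds z] fun w => u (ψ.symm (ψ (φ.symm w))) := by
    have hc : ContinuousAt φ.symm z := φ.continuousAt_symm hz
    filter_upwards [hc.eventually (ψ.open_source.mem_nhds hsrc)] with w hw
    rw [ψ.left_inv hw]
  rw [dz_congr hev, dz_comp (u := fun w => u (ψ.symm w)) hud hdiff, ← htan]

end Manifold

/-! ### Conformal metrics -/

/-- Sprays of conformal Hermitian metrics differ by a multiple of the direction. -/
theorem spray_conformal {T : Set (Fin n → ℂ)} {h a : (Fin n → ℂ) → Fin n → Fin n → ℂ}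
    {Φh Φa : (Fin n → ℂ) → (Fin n → ℂ) → ℝ} (hh : IsHermNorm T h Φh) (ha : IsHermNorm T a Φa)
    {l : (Fin n → ℂ) → ℂ} {z : Fin n → ℂ} (hz : z ∈ T) (hl : DifferentiableAt ℝ l z)
    (h0 : l z ≠ 0) (hal : ∀ w ∈ T, ∀ i j, a w i j = l w * h w i j) (η : Fin n → ℂ) :
    (2 : ℂ) • spray Φa z η = (2 : ℂ) • spray Φh z η + ((l z)⁻¹ * dz l z η) • η := by
  refine (ha.pos z hz).ext fun t => ?_
  have hd : dmat a z η = fun i j => dz l z η * h z i j + l z * dmat h z η i j := by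
    ext i j
    have e : (fun w => a w i j) =ᶠ[nhds z] fun w => l w * h w i j := by
      filter_upwards [ha.isOpen.mem_nhds hz] with w hw using hal w hw i j
    unfold dmat
    rw [dz_congr e, dz_mul hl (hh.diff z hz i j)]
  have hs : ∀ v, sesq (a z) v t = l z * sesq (h z) v t := by
    intro v
    rw [← sesq_smul_form]
    congr 1; ext i j; exact hal z hz i j
  rw [ha.sesq_spray hz, hd, sesq_add_form, sesq_smul_form, sesq_smul_form, sesq_add_left,
    sesq_smul_left _ (_ * _), hs, hs, hh.sesq_spray hz]
  field_simp
  ring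

/-- In dimension at most one the torsion vanishes. -/
theorem thetaStar_eq_zero [Subsingleton (Fin n)] (Φ : (Fin n → ℂ) → (Fin n → ℂ) → ℝ)
    (z η : Fin n → ℂ) (k : Fin n) : thetaStar Φ z η k = 0 := by
  unfold thetaStar
  refine Finset.sum_eq_zero fun m _ => Finset.sum_eq_zero fun q _ => Finset.sum_eq_zero fun p _ =>
    Finset.sum_eq_zero fun j _ => ?_
  rw [Subsingleton.elim j m]
  simp

/-! ### The sprays of h and a differ by a multiple of the direction -/

section Navigation

variable {M : Type*} [TopologicalSpace M] [ChartedSpace (Fin n → ℂ) M]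
  {h : ∀ x : M, HolTangent n x → HolTangent n x → ℂ} {f : M → ℝ} {W : ∀ x : M, HolTangent n x}
  (hd : IsNavigationData h f W)
include hd

/-- The factor comes from ε̃ + ‖W‖² = f². In dimension one W spans the tangent space, so this is the
conformal factor between the metrics. -/
theorem IsNavigationData.newMetric_wind (x : M) :
    newMetric h f W x (W x) (W x) = ((f x : ℂ) ^ 2 / (epsT h f W x : ℂ) ^ 2) * h x (W x) (W x) := by
  have he : ((epsT h f W x : ℝ) : ℂ) ≠ 0 := by exact_mod_cast (hd.epsT_pos x).ne'
  have h1 : h x (W x) (W x) = (f x : ℂ) ^ 2 - (epsT h f W x : ℂ) := by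
    have e1 : h x (W x) (W x) = (((h x (W x) (W x)).re : ℝ) : ℂ) :=
      (Complex.conj_eq_iff_re.mp (hd.metric.conj_symm x _ _)).symm
    rw [e1, ← hd.hnorm_sq]
    unfold epsT
    push_cast; ring
  unfold newMetric
  rw [hd.metric.conj_symm, h1]
  field_simp
  ring

/-- In dimension one the two metrics are conformal. -/
theorem IsNavigationData.conformal [Subsingleton (Fin n)]
    {φ : OpenPartialHomeomorph M (Fin n → ℂ)} (hφ : φ ∈ charts n M) {z : Fin n → ℂ}
    (hz : z ∈ φ.target) (i j : Fin n) : formComp (newMetric h f W) φ z i j =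
      ((f (φ.symm z) : ℂ) ^ 2 / (epsT h f W (φ.symm z) : ℂ) ^ 2) * formComp h φ z i j := by
  have h1 := hd.newMetric_wind (φ.symm z)
  rw [← tangentOf_vecComp W hφ hz, hd.newMetric_tangentOf hφ hz, hd.metric.tangentOf_eq_sesq] at h1
  have hs : ∀ m : Fin n → Fin n → ℂ, sesq m (vecComp W φ z) (vecComp W φ z) =
      m i j * (vecComp W φ z i * conj (vecComp W φ z j)) := by
    intro m
    unfold sesq
    rw [Finset.sum_eq_single i, Finset.sum_eq_single j]
    · ring
    · intro k _ hk; exact absurd (Subsingleton.elim k j) hk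
    · simp
    · intro k _ hk; exact absurd (Subsingleton.elim k i) hk
    · simp
  have hne : vecComp W φ z i ≠ 0 := fun h0 => (hd.localNav hφ).wind_ne z hz (by
    ext k; rw [Subsingleton.elim k i, h0]; rfl)
  have hne' : conj (vecComp W φ z j) ≠ 0 := by
    rw [Subsingleton.elim j i]; simpa using hne
  rw [hs, hs] at h1
  refine mul_right_cancel₀ (mul_ne_zero hne hne') ?_
  rw [h1]; ring

/-- The spray coefficients of `h` and `a` differ by a multiple of the direction, given by a smooth
function on the holomorphic tangent bundle. -/
theorem IsNavigationData.exists_spray_eq [IsManifold 𝓘(ℂ, Fin n → ℂ) ω M]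
    (hGB : IsGeneralizedBerwald (randersSolution h f W)) :
    ∃ P : ∀ x : M, HolTangent n x → ℂ,
      (∀ φ ∈ charts n M, ContDiffOn ℝ ∞
        (fun p : (Fin n → ℂ) × (Fin n → ℂ) => P (φ.symm p.1) (tangentOf φ p.1 p.2))
        (φ.target ×ˢ Set.univ)) ∧
      ∀ φ ∈ charts n M, ∀ z ∈ φ.target, ∀ η : Fin n → ℂ, ∀ i,
        spray (inChart (hnorm (newMetric h f W)) φ) z η i = spray (inChart (hnorm h) φ) z η i
          + P (φ.symm z) (tangentOf φ z η) * η i := by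
  have hcast : ∀ u : M → ℝ, (∀ φ ∈ charts n M, ContDiffOn ℝ ∞ (fun z => u (φ.symm z)) φ.target) →
      ∀ φ ∈ charts n M, ContDiffOn ℝ ∞ (fun z => (u (φ.symm z) : ℂ)) φ.target :=
    fun u hu φ hφ => Complex.ofRealCLM.contDiff.comp_contDiffOn (hu φ hφ)
  have he : ∀ x, ((epsT h f W x : ℝ) : ℂ) ≠ 0 := fun x => by exact_mod_cast (hd.epsT_pos x).ne'
  -- Both dimension ranges give a logarithmic derivative of a global function: u = 1/ε̃ for n ≥ 2,
  -- from the Berwald condition, and u = f²/ε̃² for n ≤ 1, from conformality.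
  obtain ⟨u, hus, hu0, hu⟩ : ∃ u : M → ℂ,
      (∀ φ ∈ charts n M, ∀ z ∈ φ.target, ContDiffAt ℝ ∞ (fun z => u (φ.symm z)) z) ∧
      (∀ x, u x ≠ 0) ∧
      ∀ φ ∈ charts n M, ∀ z ∈ φ.target, ∀ η : Fin n → ℂ,
        (2 : ℂ) • spray (inChart (hnorm (newMetric h f W)) φ) z η =
          (2 : ℂ) • spray (inChart (hnorm h) φ) z η
            + ((u (φ.symm z))⁻¹ * dz (fun w => u (φ.symm w)) z η) • η := by
    have hes : ∀ φ ∈ charts n M, ∀ z ∈ φ.target,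
        ContDiffAt ℝ ∞ (fun z => ((epsT h f W (φ.symm z) : ℝ) : ℂ)) z := fun φ hφ z hz =>
      (hcast _ (fun φ hφ => hd.contDiffOn_epsT hφ) φ hφ).contDiffAt (φ.open_target.mem_nhds hz)
    by_cases hn : 2 ≤ n
    · refine ⟨fun x => ((epsT h f W x : ℝ) : ℂ)⁻¹, fun φ hφ z hz => (hes φ hφ z hz).inv (he _),
        fun x => inv_ne_zero (he x), fun φ hφ z hz η => ?_⟩
      rw [inv_inv]
      exact (hd.localNav hφ).spray_sub hz (hd.berwaldAt hφ hn hGB hz) (hd.isHermNorm_h hφ)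
        (hd.isHermNorm_newMetric hφ) η
    · have : Subsingleton (Fin n) := Fin.subsingleton_iff_le_one.mpr (by omega)
      have hf : ∀ x, (f x : ℂ) ≠ 0 := fun x => by
        exact_mod_cast ((hd.wind_pos x).trans (hd.wind_lt x)).ne'
      have hs : ∀ φ ∈ charts n M, ∀ z ∈ φ.target, ContDiffAt ℝ ∞
          (fun z => (f (φ.symm z) : ℂ) ^ 2 / (epsT h f W (φ.symm z) : ℂ) ^ 2) z :=
        fun φ hφ z hz => ContDiffAt.complex_div
          (((hcast f hd.smooth_speed φ hφ).contDiffAt (φ.open_target.mem_nhds hz)).pow 2)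
          ((hes φ hφ z hz).pow 2) (pow_ne_zero 2 (he _))
      have h0 : ∀ x, (f x : ℂ) ^ 2 / (epsT h f W x : ℂ) ^ 2 ≠ 0 := fun x =>
        div_ne_zero (pow_ne_zero 2 (hf x)) (pow_ne_zero 2 (he x))
      refine ⟨fun x => (f x : ℂ) ^ 2 / (epsT h f W x : ℂ) ^ 2, hs, h0, fun φ hφ z hz η => ?_⟩
      exact spray_conformal (hd.isHermNorm_h hφ) (hd.isHermNorm_newMetric hφ) hz
        ((hs φ hφ z hz).differentiableAt (by simp)) (h0 _)
        (fun w hw i j => hd.conformal hφ hw i j) η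
  obtain ⟨P, hP⟩ := exists_dz (u := u)
    fun φ hφ z hz => (hus φ hφ z hz).contDiffWithinAt
  -- The factor is half the (1,0)-part of d log u. It is linear in the fibre, hence smooth across
  -- the zero section too.
  refine ⟨fun x v => (1 / 2 : ℂ) * ((u x)⁻¹ * P x v), fun φ hφ p hp => ?_,
    fun φ hφ z hz η i => ?_⟩
  · have hp1 : p.1 ∈ φ.target := hp.1
    have h1 : ContDiffAt ℝ ∞ (fun p : (Fin n → ℂ) × (Fin n → ℂ) =>
        (1 / 2 : ℂ) * ((u (φ.symm p.1))⁻¹ * ∑ i, wirt i (fun w => u (φ.symm w)) p.1 * p.2 i)) p := by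
      refine contDiffAt_const.mul (ContDiffAt.mul ?_ (ContDiffAt.sum fun i _ =>
        ContDiffAt.mul ?_ ?_))
      · exact ContDiffAt.inv (ContDiffAt.comp (g := fun w => u (φ.symm w)) p (hus φ hφ _ hp1)
          contDiffAt_fst) (hu0 _)
      · exact ContDiffAt.comp (g := fun w => wirt i (fun w => u (φ.symm w)) w) p
          (contDiffAt_wirt (hus φ hφ _ hp1) i) contDiffAt_fst
      · exact (contDiff_apply ℝ ℂ i).contDiffAt.comp p contDiffAt_snd
    refine h1.contDiffWithinAt.congr (fun q hq => ?_) ?_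
    · simp only [hP φ hφ q.1 hq.1, dz]
    · simp only [hP φ hφ p.1 hp1, dz]
  · have h1 := congrFun (hu φ hφ z hz η) i
    rw [← hP φ hφ z hz] at h1
    simp only [Pi.smul_apply, Pi.add_apply, smul_eq_mul] at h1
    linear_combination (1 / 2 : ℂ) * h1

end Navigation

/-! ### Consequences of equal torsions in index notation -/

namespace LocalNav

variable {T : Set (Fin n → ℂ)} {h a : (Fin n → ℂ) → Fin n → Fin n → ℂ}
  {b W : (Fin n → ℂ) → Fin n → ℂ} {ε : (Fin n → ℂ) → ℝ} (D : LocalNav T h a b W ε)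
  {z : Fin n → ℂ} (hz : z ∈ T)
include D hz

theorem wirtBar_a (l m k : Fin n) :
    wirtBar k (fun w => a w l m) z = conj (wirt k (fun w => a w m l) z) := by
  rw [wirtBar_eq_conj (D.diff_a hz l m)]
  congr 1
  refine wirt_congr ?_ k
  filter_upwards [D.isOpen.mem_nhds hz] with w hw
  exact (D.pos_a hw).herm l m

/-- Hermitian symmetry turns the ∂̄-derivatives in Γ into conjugates of ∂-derivatives, with the form
indices swapped. -/
theorem sum_torsion_wind (l s : Fin n) :
    ∑ m, (wirtBar s (fun w => a w l m) z - wirtBar m (fun w => a w l s) z) * conj (W z m) =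
      -conj (alt a z (W z) (Pi.single s 1) (Pi.single l 1)) := by
  have h1 : sesq (dmat a z (W z)) (Pi.single s 1) (Pi.single l 1) =
      ∑ m, wirt m (fun w => a w s l) z * W z m := by
    rw [sesq_single_right]
    simp [Pi.single_apply, dmat, dz]
  have h2 : sesq (dmat a z (Pi.single s 1)) (W z) (Pi.single l 1) =
      ∑ m, wirt s (fun w => a w m l) z * W z m := by
    rw [sesq_single_right]
    simp [Pi.single_apply, dmat, dz]
  unfold alt
  rw [h1, h2, map_sub, map_sum, map_sum, neg_sub, ← Finset.sum_sub_distrib]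
  refine Finset.sum_congr rfl fun m _ => ?_
  rw [D.wirtBar_a hz, D.wirtBar_a hz, map_mul, map_mul]
  ring

theorem wirtBar_bconj (r m : Fin n) :
    wirtBar m (fun w => conj (b w r)) z = conj (wirt m (fun w => b w r) z) :=
  (hasWirt_of_diff (D.diff_b hz r)).conjugate.bar_eq m

theorem sum_wirtBar_eps (v : Fin n → ℂ) :
    ∑ m, wirtBar m (fun w => (ε w : ℂ)) z * conj (v m) = conj (dz (fun w => (ε w : ℂ)) z v) := by
  have hd : DifferentiableAt ℝ (fun w => (ε w : ℂ)) z :=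
    (Complex.ofRealCLM.contDiff.contDiffAt.comp z (D.smooth_eps z hz)).differentiableAt (by simp)
  rw [sum_wirtBar_mul_conj hd]
  simp only [Complex.conj_ofReal]

/-- The coefficient β̄²/|β|² is the conjugate of β/β̄, so the contraction is the conjugate of the
expression in `nonlinConn_wind`. -/
theorem sum_omega_wind (N : Fin n → Fin n → ℂ) (η : Fin n → ℂ) :
    ∑ m, ((∑ s, conj (N s m) * conj (b z s))
        - (∑ r, wirtBar m (fun w => conj (b w r)) z * conj (η r))
        - (conj (∑ i, b z i * η i) ^ 2 / (‖∑ i, b z i * η i‖ : ℂ) ^ 2) *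
          ∑ l, wirtBar m (fun w => b w l) z * η l) * conj (W z m) =
      conj (linF (b z) (fun s => ∑ m, N s m * W z m) - linF (dvec b z (W z)) η
        - (linF (b z) η / conj (linF (b z) η)) * dconj b z (W z) η) := by
  have h1 : linF (b z) (fun s => ∑ m, N s m * W z m) = ∑ m, (∑ s, N s m * b z s) * W z m := by
    simp only [linF, Finset.mul_sum, Finset.sum_mul]
    rw [Finset.sum_comm]
    exact Finset.sum_congr rfl fun m _ => Finset.sum_congr rfl fun s _ => by ring
  have h2 : linF (dvec b z (W z)) η = ∑ m, (∑ r, wirt m (fun w => b w r) z * η r) * W z m := by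
    simp only [linF, dvec, dz, Finset.sum_mul]
    rw [Finset.sum_comm]
    exact Finset.sum_congr rfl fun m _ => Finset.sum_congr rfl fun s _ => by ring
  have h3 : dconj b z (W z) η =
      ∑ m, (∑ r, wirt m (fun w => conj (b w r)) z * conj (η r)) * W z m := by
    simp only [dconj, linF, dvec, dz, Finset.sum_mul]
    rw [Finset.sum_comm]
    exact Finset.sum_congr rfl fun m _ => Finset.sum_congr rfl fun s _ => by ring
  have h4 : conj (linF (b z) η / conj (linF (b z) η)) =
      conj (∑ i, b z i * η i) ^ 2 / (‖∑ i, b z i * η i‖ : ℂ) ^ 2 := by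
    rw [show ∑ i, b z i * η i = linF (b z) η from rfl, ← Complex.mul_conj', map_div₀,
      Complex.conj_conj]
    by_cases h0 : linF (b z) η = 0
    · rw [h0]; simp
    · have h0' : conj (linF (b z) η) ≠ 0 := by simpa using h0
      field_simp
  rw [map_sub, map_sub, map_mul, h4]
  generalize conj (∑ i, b z i * η i) ^ 2 / (‖∑ i, b z i * η i‖ : ℂ) ^ 2 = k
  rw [h1, h2, h3, map_sum, map_sum, map_sum, Finset.mul_sum,
    ← Finset.sum_sub_distrib, ← Finset.sum_sub_distrib]
  refine Finset.sum_congr rfl fun m _ => ?_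
  simp only [map_mul, map_sum, D.wirtBar_bconj hz, Complex.conj_conj,
    wirtBar_eq_conj (D.diff_b hz _)]
  ring

end LocalNav

/-! ### The equivalence on the manifold -/

section Navigation

variable {M : Type*} [TopologicalSpace M] [ChartedSpace (Fin n → ℂ) M]
  {h : ∀ x : M, HolTangent n x → HolTangent n x → ℂ} {f : M → ℝ} {W : ∀ x : M, HolTangent n x}
  (hd : IsNavigationData h f W)
include hd

/-- If the torsions differ by multiples of the direction then the deviation vanishes. -/
theorem IsNavigationData.torsionDiff_eq_zero (hn : 2 ≤ n)
    {φ : OpenPartialHomeomorph M (Fin n → ℂ)} (hφ : φ ∈ charts n M) {z : Fin n → ℂ}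
    (hz : z ∈ φ.target)
    (hQ : ∀ η : Fin n → ℂ, η ≠ 0 → ∃ Q : ℂ, ∀ i, thetaStar (inChart (hnorm (newMetric h f W)) φ) z η i =
      thetaStar (inChart (hnorm h) φ) z η i + Q * η i) (s v t : Fin n → ℂ) :
    LocalNav.torsionDiff (formComp h φ) (formComp (newMetric h f W) φ)
      (covComp (newForm h f W) φ) (vecComp W φ) (fun z => epsT h f W (φ.symm z)) z s v t = 0 := by
  have D := hd.localNav hφ
  refine D.torsionDiff_eq_zero hz hn (fun η hη => ?_) s v t
  obtain ⟨Q, hQ⟩ := hQ η hη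
  refine ⟨conj Q, fun s => ?_⟩
  have h1 := D.sesq_thetaStar_sub hz (hd.isHermNorm_h hφ) (hd.isHermNorm_newMetric hφ) η s
  have h2 : thetaStar (inChart (hnorm (newMetric h f W)) φ) z η -
      thetaStar (inChart (hnorm h) φ) z η = Q • η := by
    ext i
    simp only [Pi.sub_apply, Pi.smul_apply, smul_eq_mul, hQ i]
    ring
  rw [h2, sesq_smul_left] at h1
  rw [← Complex.conj_conj (LocalNav.torsionDiff _ _ _ _ _ _ _ _ _), ← h1, map_mul,
    (D.pos_a hz).conj_sesq]

variable [IsManifold 𝓘(ℂ, Fin n → ℂ) ω M]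

theorem IsNavigationData.projectivelyRelated_iff
    (hGB : IsGeneralizedBerwald (randersSolution h f W)) :
    ProjectivelyRelated (hnorm h) (hnorm (newMetric h f W)) ↔
      SameThetaStar (hnorm h) (hnorm (newMetric h f W)) := by
  obtain ⟨P, hPs, hP⟩ := hd.exists_spray_eq hGB
  constructor
  · rintro ⟨P', -, hP'⟩ φ hφ z hz η hη i
    by_cases hn : 2 ≤ n
    -- Subtracting the two spray relations shows that θ*_a - θ*_h is 2(P - P') times the direction.
    · have hS := hd.torsionDiff_eq_zero hn hφ hz fun ζ hζ =>
        ⟨2 * (P (φ.symm z) (tangentOf φ z ζ) - P' (φ.symm z) (tangentOf φ z ζ)), fun i => by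
          have h1 := hP φ hφ z hz ζ i
          have h2 := hP' φ hφ z hz ζ hζ i
          linear_combination 2 * h1 - 2 * h2⟩
      have D := hd.localNav hφ
      have h1 := (D.pos_a hz).eq_zero fun s =>
        (D.sesq_thetaStar_sub hz (hd.isHermNorm_h hφ) (hd.isHermNorm_newMetric hφ) η s).trans
          (by rw [hS, map_zero])
      exact (congrFun (sub_eq_zero.mp h1) i).symm
    · have : Subsingleton (Fin n) := Fin.subsingleton_iff_le_one.mpr (by omega)
      rw [thetaStar_eq_zero, thetaStar_eq_zero]
  · intro hθ
    refine ⟨P, hPs, fun φ hφ z hz η hη i => ?_⟩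
    rw [hθ φ hφ z hz η hη i, sub_self, mul_zero, add_zero]
    exact hP φ hφ z hz η i

end Navigation

end Zermelo

end

theorem theorem4p5 {n : ℕ} {M : Type*} [TopologicalSpace M] [ChartedSpace (Fin n → ℂ) M]
    [IsManifold 𝓘(ℂ, Fin n → ℂ) ω M]
    (h : ∀ x : M, Zermelo.HolTangent n x → Zermelo.HolTangent n x → ℂ)
    (f : M → ℝ) (W : ∀ x : M, Zermelo.HolTangent n x)
    (hdata : Zermelo.IsNavigationData h f W)
    (hGB : Zermelo.IsGeneralizedBerwald (Zermelo.randersSolution h f W)) :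
    (Zermelo.ProjectivelyRelated (Zermelo.hnorm h) (Zermelo.hnorm (Zermelo.newMetric h f W)) ↔
      Zermelo.SameThetaStar (Zermelo.hnorm h) (Zermelo.hnorm (Zermelo.newMetric h f W))) ∧
    (2 ≤ n →
      (Zermelo.ProjectivelyRelated (Zermelo.hnorm h) (Zermelo.hnorm (Zermelo.newMetric h f W)) ∨
        Zermelo.SameThetaStar (Zermelo.hnorm h) (Zermelo.hnorm (Zermelo.newMetric h f W))) →
      ∀ φ ∈ Zermelo.charts n M, ∀ z ∈ φ.target,
        (∀ l s, ∑ m, Zermelo.Gam (Zermelo.newMetric h f W) φ z l s m *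
          conj (Zermelo.vecComp W φ z m) = 0) ∧
        (∀ η : Fin n → ℂ, ∑ i, Zermelo.covComp (Zermelo.newForm h f W) φ z i * η i ≠ 0 →
          ∑ m, Zermelo.Omg (Zermelo.newMetric h f W) (Zermelo.newForm h f W) φ z η m *
              conj (Zermelo.vecComp W φ z m) =
            1 / (2 * (Zermelo.epsT h f W (φ.symm z) : ℂ)) *
              ∑ m, Zermelo.wirtBar m (fun w => (Zermelo.epsT h f W (φ.symm w) : ℂ)) z *
                conj (η m)) ∧
        ∑ m, Zermelo.wirtBar m (fun w => (Zermelo.epsT h f W (φ.symm w) : ℂ)) z *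
          conj (Zermelo.vecComp W φ z m) = 0) := by
  have hiff := hdata.projectivelyRelated_iff hGB
  refine ⟨hiff, fun hn hor φ hφ z hz => ?_⟩
  have hθ := hor.elim hiff.mp id
  have D := hdata.localNav hφ
  -- Equality of the θ* is the case of the zero multiple.
  have hS := hdata.torsionDiff_eq_zero hn hφ hz fun η hη =>
    ⟨0, fun i => by rw [hθ φ hφ z hz η hη i, zero_mul, add_zero]⟩
  have hB := hdata.berwaldAt hφ hn hGB hz
  refine ⟨fun l s => ?_, fun η hη => ?_, ?_⟩
  · exact (D.sum_torsion_wind hz l s).trans (by rw [D.alt_a_wind hz hS, map_zero, neg_zero])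
  · refine (D.sum_omega_wind hz (Zermelo.nonlinConn
      (Zermelo.inChart (Zermelo.hnorm (Zermelo.newMetric h f W)) φ) z η) η).trans ?_
    rw [D.nonlinConn_wind hz hn hB hS (hdata.isHermNorm_newMetric hφ) η hη, D.sum_wirtBar_eps hz]
    simp only [map_mul, map_div₀, map_one, map_ofNat, Complex.conj_ofReal]
  · exact (D.sum_wirtBar_eps hz _).trans (by rw [D.dz_eps_wind hz hn hB hS, map_zero])
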